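/- **Tableaux.** A generalized partition with $r$ rows is $\lambda\in\mathbb Z^r$ with $\lambda_1\ge\dots\ge\lambda_r$. Write $\mu\xrightarrow{c}\lambda$ if $\lambda$ arises from $\mu$ by adding $1$ in $c$ distinct rows (when $c\ge 0$) or subtracting $1$ in $-c$ distinct rows (when $c\le 0$); these rows are the rows of the edge. An $r$-row fluctuating tableau of type $(c_1,\dots,c_n)$ is a sequence of generalized partitions $T=(\mathbf 0=\lambda^0\xrightarrow{c_1}\lambda^1\xrightarrow{c_2}\cdots\xrightarrow{c_n}\lambda^n)$; it is rectangular if $\lambda^n_1=\dots=\lambda^n_r$. Put $t=\sum_j|c_j|$. **Promotion and evacuation.** A local rule diagram is a square with corners $\lambda$ (upper left), $\nu$ (upper right), $\kappa$ (lower left), $\mu$ (lower right), with vertical edges $\kappa\xrightarrow{c}\lambda$, $\mu\xrightarrow{c}\nu$ and horizontal edges $\lambda\xrightarrow{d}\nu$, $\kappa\xrightarrow{d}\mu$, such that $\mu=\mathrm{sort}(\nu+\kappa-\lambda)$ and $\lambda=\mathrm{sort}(\nu+\kappa-\mu)$, where $\mathrm{sort}$ is the weakly decreasing rearrangement. From $\lambda^{0j}=\lambda^j$,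 $\lambda^{ii}=\lambda^0$ and $\lambda^{i,n+i}=\lambda^n$, fill in $\lambda^{ij}$ for $i\ge 0$, $i\le j\le n+i$, by local rules (rows are indexed downwards, columns to the right). The promotion is $\mathcal P(T)=(\lambda^{11}\to\lambda^{12}\to\dots\to\lambda^{1,n+1})$, and the evacuation is $\mathcal E(T)=(\lambda^{nn}\to\lambda^{n-1,n}\to\dots\to\lambda^{0n})$; the part $0\le i\le j\le n$ is the evacuation diagram of $T$. Dually, from $\lambda^{0j}=\lambda^j$ and $\lambda^{-k,n-k}=\lambda^n$ fill in $\lambda^{-k,j}$, $0\le k\le n$, $0\le j\le n-k$, by local rules; this is the dual evacuation diagram of $T$, and $\mathcal E^*(T)=(\lambda^{00}\to\lambda^{-1,0}\to\dots\to\lambda^{-n,0})$. These are fluctuating tableaux, of types $(c_2,\dots,c_n,c_1)$, $(c_n,\dots,c_1)$ and $(c_n,\dots,c_1)$ respectively. **Grids.** Index rows from $0$ (top) to $r-1$. To a local rule diagram as above assign a $|c|\times|d|$ matrix $M$ of finite sets. Let $\alpha_a$ and $\alpha'_a$ be the $a$-th rows of the edges $\kappa\to\lambda$ and $\mu\to\nu$,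 counted from the bottom if $c\ge 0$ and from the top if $c\le 0$. Let $\beta_b$ and $\beta'_b$ be the $b$-th rows of the edges $\lambda\to\nu$ and $\kappa\to\mu$, counted from the top if $d\ge 0$ and from the bottom if $d\le 0$. Say that $a$ and $b$ swap if $\alpha_a-\beta_b$ and $\alpha'_a-\beta'_b$ are nonzero and of opposite signs. - If $c,d\ge 0$ and $a,b$ swap, then $M_{ab}=\{\alpha_a+\#\{b'\le b: a,b'\text{ swap}\}\}$. - If $c,d\le 0$ and $a,b$ swap, then $M_{ab}=\{\alpha_a-\#\{b'<b: a,b'\text{ swap}\}\}$. - If $c$ and $d$ have opposite signs, $\alpha_a=\beta_b$ and $\alpha'_a=\beta'_b$, then $M_{ab}=\{j+1,\dots,k\}$ where $j\le k$ are the numbers $\alpha_a,\alpha'_a$ in increasing order. - In all other cases $M_{ab}=\varnothing$. **Promotion matrix.** $\mathrm{PM}(T)$ is the $t\times t$ matrix of finite sets, divided into blocks $M^{uv}$ of size $|c_u|\times|c_v|$ ($1\le u,v\le n$), where - for $u<v$, $M^{uv}$ is the matrix of the square $\lambda^{u-1,v-1},\lambda^{u-1,v},\lambda^{u,v-1},\lambda^{uv}$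 (in the order upper left, upper right, lower left, lower right) of the evacuation diagram of $T$; - for $u>v$, $M^{uv}$ is the matrix of the square $\lambda^{-(n-u+1),v-1},\lambda^{-(n-u+1),v},\lambda^{-(n-u),v-1},\lambda^{-(n-u),v}$ (same order) of the dual evacuation diagram of $\mathcal E^*(\mathcal E(T))$; - $M^{uu}_{aa}=\{0\}$; if $c_u>0$, then $M^{uu}_{ab}=\{b-a\}$ for $a<b$ and $\{r-a+b\}$ for $a>b$; if $c_u<0$, then $M^{uu}_{ab}=\{r-b+a\}$ for $a<b$ and $\{a-b\}$ for $a>b$. For $0\le i\le r-1$ the promotion function $\mathrm{prom}_i(T):[t]\rightharpoonup[t]$ is the partial function with $\mathrm{prom}_i(T)(a)=b$ whenever $i\in\mathrm{PM}(T)_{ab}$; moreover $\mathrm{prom}_r(T):=\mathrm{prom}_0(T)$. **Theorem 5.6.** Let $T$ be an $r$-row rectangular fluctuating tableau of type $(c_1,\dots,c_n)$ with $|c_1|+\dots+|c_n|=t$. Let $\sigma=(1\,2\,\cdots\,t)$ be the long cycle and $w_0$ the permutation $a\mapsto t+1-a$ of $[t]$. Then for all $0\le i\le r$: 1. $\mathrm{prom}_i(T)$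 is a permutation of $[t]$; 2. $\mathrm{prom}_i(T)=\mathrm{prom}_{r-i}(T)^{-1}$; 3. $\mathrm{prom}_i(\mathcal P(T))=\sigma^{-|c_1|}\,\mathrm{prom}_i(T)\,\sigma^{|c_1|}$ (if $n\ge 1$; products are composed from right to left); 4. $\mathrm{prom}_i(\mathcal E(T))=w_0\,\mathrm{prom}_{r-i}(T)\,w_0$. -/

import Mathlib

/-- An integer tuple `(α_1, …, α_r)`; row `k : Fin r` is counted from the top, starting at `0`.
A generalized partition is an antitone tuple. -/
abbrev IntTuple (r : ℕ) : Type := Fin r → ℤ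

/-- `SkewColumn c μ ν` is the relation `μ --c--> ν`: the tuple `ν` is obtained from `μ` by adding
one cell to each of `c` distinct rows (if `c ≥ 0`), or by removing one cell from each of `-c`
distinct rows (if `c ≤ 0`). -/
def SkewColumn {r : ℕ} (c : ℤ) (μ ν : IntTuple r) : Prop :=
  ∃ S : Finset (Fin r), S.card = c.natAbs ∧ ∀ k, ν k = μ k + if k ∈ S then c.sign else 0

/-- An `r`-row fluctuating tableau of length `n` and type `c = (c_1, …, c_n)`: a sequence
`0 = λ^0 --c_1--> λ^1 --c_2--> ⋯ --c_n--> λ^n` of generalized partitions. -/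
structure FluctuatingTableau (r n : ℕ) (c : Fin n → ℤ) where
  shape : Fin (n + 1) → IntTuple r
  antitone_shape : ∀ j, Antitone (shape j)
  shape_zero : shape 0 = 0
  step : ∀ j : Fin n, SkewColumn (c j) (shape j.castSucc) (shape j.succ)

/-- The weakly decreasing rearrangement of a tuple. -/
def sortDesc {r : ℕ} (α : IntTuple r) : IntTuple r :=
  fun k => α (Tuple.sort α (Fin.rev k))

/-- The local rule. In a square with corners `x`, `y`, `z` and one unknown corner opposite to `x`,
the unknown corner is `sort (y + z - x)`. The rule is the same whether the unknown corner is
the lower right one or the upper left one. -/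
def localRule {r : ℕ} (x y z : IntTuple r) : IntTuple r := sortDesc (y + z - x)

/-- Growth triangle with top row `R 0, R 1, …` : entry `(i, j)` with `i ≤ j` is
determined by the boundary conditions `(0, j) ↦ R j`, `(i, i) ↦ R 0` and by the local rule,
which fills the lower right corner of each square. (Entries with `j < i` play no role.) -/
def growth {r : ℕ} (R : ℕ → IntTuple r) : ℕ → ℕ → IntTuple r
  | 0, j => R j
  | _ + 1, 0 => R 0
  | i + 1, j + 1 =>
      if j ≤ i then R 0
      else localRule (growth R i j) (growth R i (j + 1)) (growth R (i + 1) j)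

section Auxiliary

variable {r : ℕ}

theorem sortDesc_antitone (α : IntTuple r) : Antitone (sortDesc α) := fun _ _ h =>
  Tuple.monotone_sort α (Fin.rev_le_rev.2 h)

theorem sortDesc_of_antitone {α : IntTuple r} (h : Antitone α) : sortDesc α = α := by
  have := Tuple.unique_antitone (f := α) (σ := Fin.revPerm.trans (Tuple.sort α))
    (τ := Equiv.refl _) (fun _ _ hab => Tuple.monotone_sort α (Fin.rev_le_rev.2 hab)) h
  exact this

theorem sum_sortDesc (α : IntTuple r) : ∑ k, sortDesc α k = ∑ k, α k :=
  Equiv.sum_comp (Fin.revPerm.trans (Tuple.sort α)) α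

theorem sortDesc_mono {α β : IntTuple r} (h : ∀ k, α k ≤ β k) (k : Fin r) :
    sortDesc α k ≤ sortDesc β k := by
  by_contra hlt
  push Not at hlt
  let σ : Equiv.Perm (Fin r) := Fin.revPerm.trans (Tuple.sort α)
  let τ : Equiv.Perm (Fin r) := Fin.revPerm.trans (Tuple.sort β)
  have hσ : ∀ m, sortDesc α m = α (σ m) := fun _ => rfl
  have hτ : ∀ m, sortDesc β m = β (τ m) := fun _ => rfl
  have hmaps : ∀ m ∈ Finset.Iic k, τ.symm (σ m) ∈ Finset.Iio k := by
    intro m hm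
    rw [Finset.mem_Iic] at hm
    rw [Finset.mem_Iio]
    by_contra hge
    push Not at hge
    have h1 : sortDesc α k ≤ sortDesc α m := sortDesc_antitone α hm
    have h2 : sortDesc β (τ.symm (σ m)) ≤ sortDesc β k := sortDesc_antitone β hge
    rw [hτ, Equiv.apply_symm_apply] at h2
    rw [hσ m] at h1
    have := h (σ m)
    linarith
  have hcard := Finset.card_le_card_of_injOn (fun m => τ.symm (σ m)) hmaps
    (fun a _ b _ hab => σ.injective (τ.symm.injective hab))
  rw [Fin.card_Iic, Fin.card_Iio] at hcard
  omega

theorem skewColumn_iff {c : ℤ} {μ ν : IntTuple r} : SkewColumn c μ ν ↔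
    (∀ k, ν k - μ k = 0 ∨ ν k - μ k = c.sign) ∧ ∑ k, (ν k - μ k) = c := by
  constructor
  · rintro ⟨S, hS, h⟩
    refine ⟨fun k => ?_, ?_⟩
    · rw [h k]; split_ifs <;> simp
    · have : ∀ k, ν k - μ k = if k ∈ S then c.sign else 0 := fun k => by rw [h k]; ring
      simp only [this, Finset.sum_ite_mem, Finset.univ_inter, Finset.sum_const, hS, nsmul_eq_mul]
      rw [mul_comm, Int.natCast_natAbs, Int.sign_mul_abs]
  · rintro ⟨h, hsum⟩
    refine ⟨Finset.univ.filter (fun k => ν k ≠ μ k), ?_, fun k => ?_⟩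
    · have h' : ∀ k, ν k - μ k = if ν k ≠ μ k then c.sign else 0 := by
        intro k
        split_ifs with hk
        · rcases h k with h0 | h0
          · exact absurd (sub_eq_zero.1 h0) hk
          · exact h0
        · push Not at hk
          rw [hk, sub_self]
      rw [Finset.sum_congr rfl (fun k _ => h' k), ← Finset.sum_filter, Finset.sum_const,
        nsmul_eq_mul] at hsum
      rcases eq_or_ne c 0 with rfl | hc
      · rw [Int.natAbs_zero, Finset.card_eq_zero, Finset.filter_eq_empty_iff]
        intro k _ hk
        rcases h k with h0 | h0
        · exact hk (sub_eq_zero.1 h0)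
        · exact hk (sub_eq_zero.1 (by simpa using h0))
      · have := congrArg Int.natAbs hsum
        rwa [Int.natAbs_mul, Int.natAbs_natCast, Int.natAbs_sign_of_ne_zero hc, mul_one] at this
    · simp only [Finset.mem_filter, Finset.mem_univ, true_and]
      split_ifs with hk
      · rcases h k with h0 | h0
        · exact absurd (sub_eq_zero.1 h0) hk
        · linarith
      · push Not at hk
        rw [hk, add_zero]

theorem SkewColumn.neg {c : ℤ} {μ ν : IntTuple r} (h : SkewColumn c μ ν) : SkewColumn (-c) ν μ := by
  rw [skewColumn_iff] at h ⊢
  refine ⟨fun k => ?_, ?_⟩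
  · rw [Int.sign_neg]
    rcases h.1 k with h | h
    · left; linarith
    · right; linarith
  · rw [← h.2, ← Finset.sum_neg_distrib]
    exact Finset.sum_congr rfl fun k _ => by ring

theorem sortDesc_sub {s : ℤ} (hs : s = -1 ∨ s = 0 ∨ s = 1) {κ α : IntTuple r} (hκ : Antitone κ)
    (h : ∀ k, α k - κ k = 0 ∨ α k - κ k = s) (k : Fin r) :
    sortDesc α k - κ k = 0 ∨ sortDesc α k - κ k = s := by
  have hκs : ∀ x : ℤ, sortDesc (fun k => κ k + x) = fun k => κ k + x := fun x =>
    sortDesc_of_antitone fun a b hab => by simpa using hκ hab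
  have hlo := sortDesc_mono (α := fun k => κ k + min 0 s) (β := α)
    (fun k => by rcases h k with h | h <;> rcases hs with rfl | rfl | rfl <;> simp <;> linarith) k
  have hhi := sortDesc_mono (α := α) (β := fun k => κ k + max 0 s)
    (fun k => by rcases h k with h | h <;> rcases hs with rfl | rfl | rfl <;> simp <;> linarith) k
  rw [hκs] at hlo hhi
  rcases hs with rfl | rfl | rfl <;> simp at hlo hhi <;> omega

theorem sign_cases (c : ℤ) : c.sign = -1 ∨ c.sign = 0 ∨ c.sign = 1 := by
  rcases lt_trichotomy c 0 with h | h | h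
  · exact Or.inl (Int.sign_eq_neg_one_of_neg h)
  · exact Or.inr (Or.inl (by simp [h]))
  · exact Or.inr (Or.inr (Int.sign_eq_one_of_pos h))

/-- Local rules turn `κ --c--> x --d--> ν` into `κ --d--> μ --c--> ν`. -/
theorem localRule_spec {c d : ℤ} {κ x ν : IntTuple r} (hκ : Antitone κ) (hν : Antitone ν)
    (h1 : SkewColumn c κ x) (h2 : SkewColumn d x ν) :
    Antitone (localRule x ν κ) ∧ SkewColumn d κ (localRule x ν κ) ∧
      SkewColumn c (localRule x ν κ) ν := by
  rw [skewColumn_iff] at h1 h2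
  refine ⟨sortDesc_antitone _, skewColumn_iff.2 ⟨?_, ?_⟩, skewColumn_iff.2 ⟨?_, ?_⟩⟩
  · refine sortDesc_sub (sign_cases d) hκ fun k => ?_
    simp only [Pi.add_apply, Pi.sub_apply]
    rcases h2.1 k with h | h
    · left; linarith
    · right; linarith
  · rw [Finset.sum_sub_distrib, localRule, sum_sortDesc]
    rw [Finset.sum_sub_distrib] at h2
    simp only [Pi.add_apply, Pi.sub_apply, Finset.sum_add_distrib, Finset.sum_sub_distrib]
    linarith [h2.2]
  · intro k
    have hs : -c.sign = -1 ∨ -c.sign = 0 ∨ -c.sign = 1 := by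
      rcases sign_cases c with h | h | h <;> simp [h]
    have := sortDesc_sub hs (κ := ν) (α := ν + κ - x) hν (fun k => by
      simp only [Pi.add_apply, Pi.sub_apply]
      rcases h1.1 k with h | h
      · left; linarith
      · right; linarith) k
    rw [localRule]
    rcases this with h | h
    · left; linarith
    · right; linarith
  · rw [Finset.sum_sub_distrib, localRule, sum_sortDesc]
    rw [Finset.sum_sub_distrib] at h1
    simp only [Pi.add_apply, Pi.sub_apply, Finset.sum_add_distrib, Finset.sum_sub_distrib]
    linarith [h1.2]

theorem growth_diag (R : ℕ → IntTuple r) (i : ℕ) : growth R i i = R 0 := by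
  cases i with
  | zero => rw [growth]
  | succ i => rw [growth, if_pos le_rfl]

theorem growth_spec (R : ℕ → IntTuple r) (n : ℕ) (c : ℕ → ℤ) (hR : ∀ j ≤ n, Antitone (R j))
    (hstep : ∀ j < n, SkewColumn (c j) (R j) (R (j + 1))) :
    ∀ i ≤ n, (∀ j ≤ n, i ≤ j → Antitone (growth R i j)) ∧
      (∀ j < n, i ≤ j → SkewColumn (c j) (growth R i j) (growth R i (j + 1))) := by
  intro i
  induction i with
  | zero =>
    refine fun _ => ⟨fun j hj _ => ?_, fun j hj _ => ?_⟩
    · rw [growth]; exact hR j hj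
    · rw [growth, growth]; exact hstep j hj
  | succ i ih =>
    intro hi
    obtain ⟨ih1, ih2⟩ := ih (by omega)
    have key : ∀ j, i + 1 ≤ j → j ≤ n → Antitone (growth R (i + 1) j) ∧
        SkewColumn (c i) (growth R (i + 1) j) (growth R i j) ∧
        (j < n → SkewColumn (c j) (growth R (i + 1) j) (growth R (i + 1) (j + 1))) := by
      intro j hij
      have next : ∀ j, i + 1 ≤ j → j < n → Antitone (growth R (i + 1) j) →
          SkewColumn (c i) (growth R (i + 1) j) (growth R i j) →
          Antitone (growth R (i + 1) (j + 1)) ∧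
          SkewColumn (c j) (growth R (i + 1) j) (growth R (i + 1) (j + 1)) ∧
          SkewColumn (c i) (growth R (i + 1) (j + 1)) (growth R i (j + 1)) := by
        intro j hij hj ha hv
        have hrw : growth R (i + 1) (j + 1) =
            localRule (growth R i j) (growth R i (j + 1)) (growth R (i + 1) j) := by
          rw [growth, if_neg (by omega)]
        rw [hrw]
        exact localRule_spec ha (ih1 (j + 1) (by omega) (by omega)) hv (ih2 j hj (by omega))
      induction j, hij using Nat.le_induction with
      | base =>
        intro hj
        have ha : Antitone (growth R (i + 1) (i + 1)) := by
          rw [growth_diag]; exact hR 0 (by omega)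
        have hv : SkewColumn (c i) (growth R (i + 1) (i + 1)) (growth R i (i + 1)) := by
          have := ih2 i (by omega) le_rfl
          rwa [growth_diag] at this ⊢
        exact ⟨ha, hv, fun h => (next _ le_rfl h ha hv).2.1⟩
      | succ j hij ihj =>
        intro hj
        obtain ⟨ha, hv, _⟩ := ihj (by omega)
        obtain ⟨ha', _, hv'⟩ := next j hij (by omega) ha hv
        exact ⟨ha', hv', fun h => (next _ (by omega) h ha' hv').2.1⟩
    exact ⟨fun j hj hij => (key j hij hj).1, fun j hj hij => (key j hij hj.le).2.2 hj⟩

theorem growth_vertical (R : ℕ → IntTuple r) (n : ℕ) (c : ℕ → ℤ) (hR : ∀ j ≤ n, Antitone (R j))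
    (hstep : ∀ j < n, SkewColumn (c j) (R j) (R (j + 1))) (i j : ℕ) (hij : i + 1 ≤ j)
    (hj : j ≤ n) : SkewColumn (c i) (growth R (i + 1) j) (growth R i j) := by
  obtain ⟨h1, h2⟩ := growth_spec R n c hR hstep i (by omega)
  obtain ⟨h1', h2'⟩ := growth_spec R n c hR hstep (i + 1) (by omega)
  induction j, hij using Nat.le_induction with
  | base =>
    have := h2 i (by omega) le_rfl
    rwa [growth_diag] at this ⊢
  | succ j hij ihj =>
    have hrw : growth R (i + 1) (j + 1) =
        localRule (growth R i j) (growth R i (j + 1)) (growth R (i + 1) j) := by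
      rw [growth, if_neg (by omega)]
    rw [hrw]
    exact (localRule_spec (h1' j (by omega) hij) (h1 (j + 1) hj (by omega)) (ihj (by omega))
      (h2 j (by omega) (by omega))).2.2

end Auxiliary

namespace FluctuatingTableau

variable {r n : ℕ} {c : Fin n → ℤ}

/-- The final shape `λ^n` is a generalized rectangle: all its rows have the same length. -/
def IsRectangular (T : FluctuatingTableau r n c) : Prop :=
  ∀ k l : Fin r, T.shape (Fin.last n) k = T.shape (Fin.last n) l

/-- The shape `λ^j`, for `j ≤ n`. -/
def row (T : FluctuatingTableau r n c) (j : ℕ) : IntTuple r :=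
  T.shape ⟨min j n, Nat.lt_succ_of_le (min_le_right j n)⟩

/-- The evacuation diagram: `T.evacDiagram i j = λ^{ij}` for `0 ≤ i ≤ j ≤ n`, with
`λ^{0j} = λ^j` and `λ^{ii} = λ^0`, filled from the upper left by the local rule. Row `i` lies
above row `i + 1`. -/
def evacDiagram (T : FluctuatingTableau r n c) : ℕ → ℕ → IntTuple r :=
  growth T.row

/-- The dual evacuation diagram: `T.dualEvacDiagram k j = λ^{-k,j}` for `0 ≤ k`, `0 ≤ j ≤ n - k`,
with `λ^{0,j} = λ^j` and `λ^{-k,n-k} = λ^n`, filled from the lower right by the local rule.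
Row `-k` lies below row `-(k + 1)`. Counting columns from the right, it is the growth
triangle with first row `λ^n, λ^{n-1}, …, λ^0`. -/
def dualEvacDiagram (T : FluctuatingTableau r n c) (k j : ℕ) : IntTuple r :=
  growth (fun m => T.row (n - m)) k (n - j)

/-- The type of a tableau as a sequence indexed by `ℕ`, padded by zeros. -/
def typeSeq (c : Fin n → ℤ) (j : ℕ) : ℤ := if h : j < n then c ⟨j, h⟩ else 0

theorem typeSeq_val (c : Fin n → ℤ) (j : Fin n) : typeSeq c j = c j := by
  simp [typeSeq]

theorem row_antitone (T : FluctuatingTableau r n c) (j : ℕ) : Antitone (T.row j) :=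
  T.antitone_shape _

theorem row_zero (T : FluctuatingTableau r n c) : T.row 0 = 0 := by
  rw [← T.shape_zero, row]
  congr 1

theorem row_step (T : FluctuatingTableau r n c) (j : ℕ) (hj : j < n) :
    SkewColumn (typeSeq c j) (T.row j) (T.row (j + 1)) := by
  have h := T.step ⟨j, hj⟩
  rw [← typeSeq_val c] at h
  have e1 : T.row j = T.shape (Fin.castSucc ⟨j, hj⟩) := by
    rw [row]; congr 1; ext; simp [hj.le]
  have e2 : T.row (j + 1) = T.shape (Fin.succ ⟨j, hj⟩) := by
    rw [row]; congr 1; ext; simp [Nat.succ_le_of_lt hj]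
  rw [e1, e2]
  exact h

theorem revRow_step (T : FluctuatingTableau r n c) (m : ℕ) (hm : m < n) :
    SkewColumn (-typeSeq c (n - 1 - m)) (T.row (n - m)) (T.row (n - (m + 1))) := by
  have := (T.row_step (n - 1 - m) (by omega)).neg
  rw [show n - 1 - m + 1 = n - m by omega] at this
  rwa [show n - (m + 1) = n - 1 - m by omega]

/-- The promotion of `T`: the row `λ^{11} → λ^{12} → ⋯ → λ^{1n} → λ^{1,n+1}`, where
`λ^{11} = λ^0` and `λ^{1,n+1} = λ^n`. Its type is `(c_2, …, c_n, c_1)`. -/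
def promotion (T : FluctuatingTableau r n c) : FluctuatingTableau r n (c ∘ finRotate n) where
  shape k := if (k : ℕ) = n then T.row n else T.evacDiagram 1 (k + 1)
  antitone_shape k := by
    split_ifs with hk
    · exact T.row_antitone n
    · have := k.isLt
      exact (growth_spec T.row n (typeSeq c) (fun j _ => T.row_antitone j) T.row_step 1
        (by omega)).1 _ (by omega) (by omega)
  shape_zero := by
    split_ifs with hk
    · have hk' : n = 0 := hk.symm
      subst hk'
      exact T.row_zero
    · rw [evacDiagram]
      exact (growth_diag T.row 1).trans T.row_zero
  step k := by
    obtain ⟨m, rfl⟩ : ∃ m, n = m + 1 := ⟨n - 1, by have := k.isLt; omega⟩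
    have hk := k.isLt
    rw [if_neg (by simp; omega)]
    rcases eq_or_ne k (Fin.last m) with rfl | hne
    · rw [if_pos (by simp)]
      have := growth_vertical T.row (m + 1) (typeSeq c) (fun j _ => T.row_antitone j) T.row_step
        0 (m + 1) (by omega) le_rfl
      rw [show growth T.row 0 (m + 1) = T.row (m + 1) by rw [growth]] at this
      rw [Function.comp_apply, finRotate_last, ← typeSeq_val c 0]
      exact this
    · have hlt : (k : ℕ) < m := by
        have : (k : ℕ) ≠ m := fun h => hne (Fin.ext h)
        omega
      rw [if_neg (by simp; omega), Function.comp_apply, ← typeSeq_val c, coe_finRotate_of_ne_last hne]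
      exact (growth_spec T.row (m + 1) (typeSeq c) (fun j _ => T.row_antitone j) T.row_step 1
        (by omega)).2 (k + 1) (by omega) (by omega)

/-- The evacuation of `T`: the right column `λ^{nn} → ⋯ → λ^{1n} → λ^{0n}` of the evacuation
diagram, read upwards. Its type is `(c_n, …, c_1)`. -/
def evacuation (T : FluctuatingTableau r n c) : FluctuatingTableau r n (c ∘ Fin.rev) where
  shape k := T.evacDiagram (n - k) n
  antitone_shape k :=
    (growth_spec T.row n (typeSeq c) (fun j _ => T.row_antitone j) T.row_step (n - k)
      (by omega)).1 n le_rfl (by omega)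
  shape_zero := (growth_diag T.row n).trans T.row_zero
  step k := by
    have hk := k.isLt
    have := growth_vertical T.row n (typeSeq c) (fun j _ => T.row_antitone j) T.row_step
      (n - (k + 1)) n (by omega) le_rfl
    rw [Function.comp_apply, ← typeSeq_val c, Fin.val_rev]
    rw [show n - (k + 1 : ℕ) + 1 = n - k by omega] at this
    exact this

/-- The dual evacuation of `T`: the left column `λ^{00} → λ^{-1,0} → ⋯ → λ^{-n,0}` of the dual
evacuation diagram, read upwards. Its type is `(c_n, …, c_1)`. -/
def dualEvacuation (T : FluctuatingTableau r n c) : FluctuatingTableau r n (c ∘ Fin.rev) where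
  shape k := T.dualEvacDiagram k 0
  antitone_shape k :=
    (growth_spec (fun m => T.row (n - m)) n (fun m => -typeSeq c (n - 1 - m))
      (fun j _ => T.row_antitone _) T.revRow_step k (by omega)).1 n le_rfl (by omega)
  shape_zero := by
    have : T.dualEvacDiagram 0 0 = T.row 0 := by
      rw [dualEvacDiagram, growth]; simp
    exact this.trans T.row_zero
  step k := by
    have hk := k.isLt
    have := (growth_vertical (fun m => T.row (n - m)) n (fun m => -typeSeq c (n - 1 - m))
      (fun j _ => T.row_antitone _) T.revRow_step k n (by omega) le_rfl).neg
    rw [neg_neg] at this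
    rw [Function.comp_apply, ← typeSeq_val c, Fin.val_rev,
      show n - (k + 1 : ℕ) = n - 1 - k by omega]
    exact this

end FluctuatingTableau

/-- The rows in which `μ` and `ν` differ (row `0` is the top row). -/
def changedRows {r : ℕ} (μ ν : IntTuple r) : Finset ℕ :=
  (Finset.univ.filter fun k => μ k ≠ ν k).map Fin.valEmbedding

/-- The `a`-th element (starting at `a = 0`) of a set of rows, numbered from top to bottom. -/
def fromTop (s : Finset ℕ) (a : ℕ) : ℕ := (s.sort (· ≤ ·)).getD a 0

/-- The `a`-th element (starting at `a = 0`) of a set of rows, numbered from bottom to top. -/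
def fromBottom (s : Finset ℕ) (a : ℕ) : ℕ := (s.sort (· ≥ ·)).getD a 0

/-- The row of the `a`-th bullet among the cells of `μ --c--> ν`: the bullets are numbered
from bottom to top if `c ≥ 0`, and the barred bullets from top to bottom if `c ≤ 0`. -/
def bulletRow {r : ℕ} (c : ℤ) (μ ν : IntTuple r) (a : ℕ) : ℕ :=
  if 0 ≤ c then fromBottom (changedRows μ ν) a else fromTop (changedRows μ ν) a

/-- The row of the `b`-th letter `i` among the cells of `μ --d--> ν`: the letters `i` are numbered
from top to bottom if `d ≥ 0`, and the barred letters from bottom to top if `d ≤ 0`. -/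
def letterRow {r : ℕ} (d : ℤ) (μ ν : IntTuple r) (b : ℕ) : ℕ :=
  if 0 ≤ d then fromTop (changedRows μ ν) b else fromBottom (changedRows μ ν) b

/-- The local rule grid of the local rule diagram with upper left corner `x`, upper right
corner `ν`, lower left corner `κ`, lower right corner `μ`, vertical edges `κ --c--> x` and
`μ --c--> ν`, horizontal edges `x --d--> ν` and `κ --d--> μ`.

The diagram encodes a jeu de taquin slide `S → T`: in `S` the bullets fill the cells of `κ → x` and
the letters `i` those of `x → ν`; in `T` the letters fill `κ → μ` and the bullets `μ → ν`.
Entry `(a, b)`, for `a < |c|` and `b < |d|` (numbers starting at `0`), is: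
* `c, d ≥ 0`: bullet `a` moves down, swapping with letters one row at a time, in the order
  of their numbers. It swaps with letter `b` iff it is above that letter in `S` and below it in `T`,
  and the entry is then `{j}` with `j` the row of the bullet right after this swap.
* `c, d ≤ 0`: barred bullet `a` moves up in the same way, and the entry is `{j}` with `j` the row
  of the barred bullet right before its swap with barred letter `b`.
* `d ≤ 0 ≤ c` or `c ≤ 0 ≤ d`: if bullet `a` and letter `b` form a pair in one cell, that slides
  between the rows `j < k`, the entry is the interval `(j, k]`.
In all other cases the entry is empty. -/
def localRuleGrid {r : ℕ} (c d : ℤ) (x ν κ μ : IntTuple r) (a b : ℕ) : Finset ℕ :=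
  let bulletS := bulletRow c κ x
  let bulletT := bulletRow c μ ν
  let letterS := letterRow d x ν
  let letterT := letterRow d κ μ
  if 0 ≤ c ∧ 0 ≤ d then
    if bulletS a < letterS b ∧ letterT b < bulletT a then
      {bulletS a +
        ((Finset.range (b + 1)).filter
          fun b' => bulletS a < letterS b' ∧ letterT b' < bulletT a).card}
    else ∅
  else if c ≤ 0 ∧ d ≤ 0 then
    if letterS b < bulletS a ∧ bulletT a < letterT b then
      {bulletS a -
        ((Finset.range b).filter
          fun b' => letterS b' < bulletS a ∧ bulletT a < letterT b').card}
    else ∅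
  else if bulletS a = letterS b ∧ bulletT a = letterT b then
    if 0 ≤ c then Finset.Ioc (bulletS a) (bulletT a) else Finset.Ioc (bulletT a) (bulletS a)
  else ∅

/-- The upper triangular grid `U` for a step of size `c`, rows and columns numbered from `0`. -/
def upperTriangle (r : ℕ) (c : ℤ) (a b : ℕ) : Finset ℕ :=
  if a ≤ b then {if 0 ≤ c then b - a else r - (b - a)} else ∅

/-- The lower triangular grid `L` for a step of size `c`, rows and columns numbered from `0`. -/
def lowerTriangle (r : ℕ) (c : ℤ) (a b : ℕ) : Finset ℕ :=
  if b ≤ a then {if 0 ≤ c then r - (a - b) else a - b} else ∅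

/-- The diagonal blocks of the promotion matrix: the union of the two triangular grids, with the
entries on the main diagonal reduced modulo `r`. -/
def diagonalBlock (r : ℕ) (c : ℤ) (a b : ℕ) : Finset ℕ :=
  if a = b then (upperTriangle r c a b ∪ lowerTriangle r c a b).image (· % r)
  else upperTriangle r c a b ∪ lowerTriangle r c a b

namespace FluctuatingTableau

variable {r n : ℕ} {c : Fin n → ℤ}

/-- The promotion matrix of `T`, an `n × n` block matrix of finite sets whose block `(u, v)` has
size `|c_u| × |c_v|`. Blocks above the diagonal are the local rule grids of the evacuation diagram
of `T`, and blocks below the diagonal those of the dual evacuation diagram of `E*(E(T))`, where `E`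
is evacuation and `E*` is dual evacuation. (Here `u` and `v` are numbered from `0`.) -/
def promMatrix (T : FluctuatingTableau r n c) (p q : (j : Fin n) × Fin (c j).natAbs) :
    Finset ℕ :=
  let u : ℕ := p.1
  let v : ℕ := q.1
  if u < v then
    let D := T.evacDiagram
    localRuleGrid (c p.1) (c q.1) (D u v) (D u (v + 1)) (D (u + 1) v) (D (u + 1) (v + 1)) p.2 q.2
  else if v < u then
    let D := T.evacuation.dualEvacuation.dualEvacDiagram
    localRuleGrid (c p.1) (c q.1) (D (n - u) v) (D (n - u) (v + 1))
      (D (n - (u + 1)) v) (D (n - (u + 1)) (v + 1)) p.2 q.2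
  else diagonalBlock r (c p.1) p.2 q.2

/-- The graph of the partial function `prom_i(T) : [t] ⇀ [t]`, where `t = |c_1| + ⋯ + |c_n|` and
`[t]` is `{0, …, t - 1}`: it sends `a` to `b` if `i` lies in the entry `(a, b)` of the promotion
matrix, viewed as a `t × t` matrix by listing its blocks in order. By convention
`prom_r(T) = prom_0(T)`. -/
def PromGraph (T : FluctuatingTableau r n c) (i a b : ℕ) : Prop :=
  ∃ p q : (j : Fin n) × Fin (c j).natAbs,
    (finSigmaFinEquiv p : ℕ) = a ∧ (finSigmaFinEquiv q : ℕ) = b ∧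
      (if i = r then 0 else i) ∈ T.promMatrix p q

/-- The partial function `prom_i(T)` is (everywhere defined and equal to) the permutation `π`. -/
def PromEq (T : FluctuatingTableau r n c) (i : ℕ) {t : ℕ} (π : Equiv.Perm (Fin t)) : Prop :=
  ∀ a b : Fin t, T.PromGraph i a b ↔ π a = b

end FluctuatingTableau

/-! ### Sorting tuples -/

section Sorting

variable {r : ℕ}

/-! The local rule is best understood on classes of rows: the intervals on which the two outer
corners `κ` and `ν` are both constant. Sorting only reverses the entries of `x` inside each class
(`localRule_eq_reflect`). Hence the rule is an involution. As the cells added or removed by an edge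
sit at one end of each class, reversing a class translates them to its other end, and every bullet
and letter stays in its class with its number.

Two facts about grids follow. For positive steps, `i` lies in an entry only if `i + s = p + q + 1`,
where `p` and `q` are the rows of bullet and letter in the upper left half of the square and `s`
counts the rows with `κ p < x k` (`LocalSquare.mem_grid_iff`). This formula yields the behaviour of
grids under complement-transposition (`mem_grid_complTranspose`) and under antitransposition
(`mem_grid_antiTranspose`); other signs are handled by complements or directly. Moreover, row `a` of
a grid contains exactly the numbers that bullet `a` passes, each once (`sum_grid`).

Rectangularity enters through `growth_last_column`: the last column of the evacuation diagram is the
rotated complement of its first row. A dominance inequality for growth rectangles, applied to a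
rectangle and to its antidiagonal reflection, bounds all initial and all final sums, and equal
totals force equality. Consequently the dual evacuation diagram of `E*(E(T))` is the rotated
complement of the transposed evacuation diagram of `T`, so transposing the promotion matrix
exchanges `i` and `r - i` for `0 < i < r`.

To see that each such `i` occurs once in every row, follow one bullet through the blocks right of
the diagonal; by the result on the last column it reappears in the blocks left of the diagonal. The
signed numbers of passages of `i` telescope, and the diagonal block supplies what is missing
(`sum_promMatrix`). With the symmetry this makes `prom_i` a permutation with inverse `prom_{r-i}`;
`prom_0` is the identity. Promotion shifts the triangle by one step and evacuation reflects it in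
its antidiagonal, which gives the two conjugation formulas. -/

theorem sortDesc_comp_of_antitone {β : IntTuple r} (hβ : Antitone β) (σ : Equiv.Perm (Fin r)) :
    sortDesc (β ∘ σ) = β := by
  have h := Tuple.unique_antitone (f := β ∘ σ) (σ := Fin.revPerm.trans (Tuple.sort (β ∘ σ)))
    (τ := σ.symm) (fun _ _ hab => Tuple.monotone_sort (β ∘ σ) (Fin.rev_le_rev.2 hab))
    (by rw [Function.comp_assoc, Equiv.self_comp_symm]; exact hβ)
  rw [Function.comp_assoc β σ σ.symm, Equiv.self_comp_symm] at h
  exact h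

theorem exists_perm_sortDesc (α : IntTuple r) : ∃ σ : Equiv.Perm (Fin r), sortDesc α = α ∘ σ :=
  ⟨Fin.revPerm.trans (Tuple.sort α), rfl⟩

/-- The complement of `α` in the rectangle of width `m`, rotated by 180 degrees. -/
def rotCompl (m : ℤ) (α : IntTuple r) : IntTuple r := fun k => m - α k.rev

@[simp] theorem rotCompl_rotCompl (m : ℤ) (α : IntTuple r) : rotCompl m (rotCompl m α) = α := by
  funext k; simp [rotCompl]

theorem rotCompl_antitone (m : ℤ) {α : IntTuple r} (h : Antitone α) : Antitone (rotCompl m α) :=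
  fun a b hab => by
    have := h (Fin.rev_le_rev.2 hab)
    simp only [rotCompl]; linarith

theorem rotCompl_zero (m : ℤ) : rotCompl m (0 : IntTuple r) = fun _ => m := by
  funext k; simp [rotCompl]

theorem localRule_comm (x y z : IntTuple r) : localRule x y z = localRule x z y := by
  rw [localRule, localRule, add_comm]

/-- Complementing reverses the order of the entries and rotating reverses it back, so the rotated
complement of a sorted tuple is sorted. Both sides are therefore sorted rearrangements of the same
entries. -/
theorem localRule_rotCompl (m : ℤ) (x y z : IntTuple r) :
    localRule (rotCompl m x) (rotCompl m y) (rotCompl m z) = rotCompl m (localRule x y z) := by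
  obtain ⟨σ, hσ⟩ := exists_perm_sortDesc (y + z - x)
  have hanti := rotCompl_antitone m (sortDesc_antitone (y + z - x))
  rw [localRule, localRule, ← sortDesc_comp_of_antitone hanti
    ((Fin.revPerm.trans σ.symm).trans Fin.revPerm)]
  congr 1
  funext k
  simp only [hσ, rotCompl, Function.comp_apply, Pi.add_apply, Pi.sub_apply, Equiv.trans_apply,
    Fin.revPerm_apply, Fin.rev_rev, Equiv.apply_symm_apply]
  ring

/-- Boundaries of initial segments of rows are encoded as cardinalities, so that later arguments
about classes become linear arithmetic. -/
theorem lt_card_filter_iff (P : Fin r → Prop) [DecidablePred P] (h : ∀ j k, j ≤ k → P k → P j)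
    (k : Fin r) : (k : ℕ) < (Finset.univ.filter P).card ↔ P k :=
  Fin.lt_card_filter_univ_iff_apply_of_imp P fun i j => h j i

end Sorting

/-! ### The classes of rows on which both outer corners are constant -/

section Classes

variable {r : ℕ} (κ ν : IntTuple r)

/-- The first row `k` with `κ k = κ p` and `ν k = ν p`. -/
def classLo (p : Fin r) : ℕ := (Finset.univ.filter fun k => κ p < κ k ∨ ν p < ν k).card

/-- One more than the last row `k` with `κ k = κ p` and `ν k = ν p`. -/
def classEnd (p : Fin r) : ℕ := (Finset.univ.filter fun k => κ p ≤ κ k ∧ ν p ≤ ν k).card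

variable {κ ν}

theorem lt_classLo_iff (hκ : Antitone κ) (hν : Antitone ν) (p k : Fin r) :
    (k : ℕ) < classLo κ ν p ↔ κ p < κ k ∨ ν p < ν k :=
  lt_card_filter_iff _ (fun _ _ hjk h => h.imp (fun h => h.trans_le (hκ hjk))
    (fun h => h.trans_le (hν hjk))) k

theorem lt_classEnd_iff (hκ : Antitone κ) (hν : Antitone ν) (p k : Fin r) :
    (k : ℕ) < classEnd κ ν p ↔ κ p ≤ κ k ∧ ν p ≤ ν k :=
  lt_card_filter_iff _ (fun _ _ hjk h => h.imp (fun h => h.trans (hκ hjk))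
    (fun h => h.trans (hν hjk))) k

theorem mem_class_iff (hκ : Antitone κ) (hν : Antitone ν) (p k : Fin r) :
    (classLo κ ν p ≤ k ∧ (k : ℕ) < classEnd κ ν p) ↔ κ k = κ p ∧ ν k = ν p := by
  rw [← not_lt, lt_classLo_iff hκ hν, lt_classEnd_iff hκ hν]
  constructor <;> intro h <;> constructor <;> omega

theorem classLo_le (hκ : Antitone κ) (hν : Antitone ν) (p : Fin r) : classLo κ ν p ≤ p :=
  ((mem_class_iff hκ hν p p).2 ⟨rfl, rfl⟩).1

theorem lt_classEnd (hκ : Antitone κ) (hν : Antitone ν) (p : Fin r) : (p : ℕ) < classEnd κ ν p :=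
  ((mem_class_iff hκ hν p p).2 ⟨rfl, rfl⟩).2

theorem classEnd_le (p : Fin r) : classEnd κ ν p ≤ r := by
  simpa [classEnd] using
    (Finset.card_filter_le (Finset.univ : Finset (Fin r)) fun k => κ p ≤ κ k ∧ ν p ≤ ν k)

theorem class_congr {p k : Fin r} (h : κ k = κ p ∧ ν k = ν p) :
    classLo κ ν k = classLo κ ν p ∧ classEnd κ ν k = classEnd κ ν p := by
  simp only [classLo, classEnd, h.1, h.2, and_self]

/-- Reflection of every class. -/
def reflectRow (hκ : Antitone κ) (hν : Antitone ν) (p : Fin r) : Fin r :=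
  ⟨classLo κ ν p + classEnd κ ν p - 1 - p, by
    have := classLo_le hκ hν p; have := lt_classEnd hκ hν p; have := classEnd_le (κ := κ) (ν := ν) p
    omega⟩

theorem reflectRow_class (hκ : Antitone κ) (hν : Antitone ν) (p : Fin r) :
    κ (reflectRow hκ hν p) = κ p ∧ ν (reflectRow hκ hν p) = ν p := by
  rw [← mem_class_iff hκ hν]
  have := classLo_le hκ hν p; have := lt_classEnd hκ hν p
  simp only [reflectRow]
  omega

theorem reflectRow_reflectRow (hκ : Antitone κ) (hν : Antitone ν) (p : Fin r) :
    reflectRow hκ hν (reflectRow hκ hν p) = p := by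
  have h := class_congr (reflectRow_class hκ hν p)
  have := classLo_le hκ hν p; have := lt_classEnd hκ hν p
  ext
  rw [reflectRow, Fin.val_mk, h.1, h.2, reflectRow, Fin.val_mk]
  omega

/-- Reflection of every class, as a permutation of the rows. -/
def reflectPerm (hκ : Antitone κ) (hν : Antitone ν) : Equiv.Perm (Fin r) where
  toFun := reflectRow hκ hν
  invFun := reflectRow hκ hν
  left_inv := reflectRow_reflectRow hκ hν
  right_inv := reflectRow_reflectRow hκ hν

/-- The local rule reflects the entries within every class. -/
theorem localRule_eq_reflect {c d : ℤ} {x : IntTuple r} (hκ : Antitone κ) (hν : Antitone ν)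
    (hx : Antitone x) (h1 : SkewColumn c κ x) (h2 : SkewColumn d x ν) :
    localRule x ν κ = fun k => ν k + κ k - x (reflectRow hκ hν k) := by
  rw [skewColumn_iff] at h1 h2
  have hanti : Antitone fun k => ν k + κ k - x (reflectRow hκ hν k) := by
    have hc := sign_cases c
    have hd := sign_cases d
    intro k l hkl
    simp only
    -- Within a class the reflection reverses the decreasing `x`. Across classes `κ` or `ν` drops by
    -- at least one, which absorbs the difference of two entries of a step.
    by_cases hsame : κ l = κ k ∧ ν l = ν k
    · have hle : reflectRow hκ hν l ≤ reflectRow hκ hν k := by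
        have h := class_congr hsame
        have := classLo_le hκ hν l; have := lt_classEnd hκ hν l
        rw [Fin.le_def] at hkl ⊢
        simp only [reflectRow]
        omega
      have := hx hle
      omega
    · have hk := reflectRow_class hκ hν k
      have hl := reflectRow_class hκ hν l
      have h1k := h1.1 (reflectRow hκ hν k)
      have h1l := h1.1 (reflectRow hκ hν l)
      have h2k := h2.1 (reflectRow hκ hν k)
      have h2l := h2.1 (reflectRow hκ hν l)
      have hκkl := hκ hkl
      have hνkl := hν hkl
      rw [hk.1] at h1k
      rw [hl.1] at h1l
      rw [hk.2] at h2k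
      rw [hl.2] at h2l
      rcases hc with hc | hc | hc <;> rcases hd with hd | hd | hd <;> rw [hc] at h1k h1l <;>
        rw [hd] at h2k h2l <;> omega
  rw [localRule]
  conv_rhs => rw [← sortDesc_comp_of_antitone hanti (reflectPerm hκ hν)]
  congr 1
  funext k
  have hk := reflectRow_class hκ hν k
  have hr := reflectRow_reflectRow hκ hν k
  simp only [Function.comp_apply, reflectPerm, Equiv.coe_fn_mk, Pi.add_apply, Pi.sub_apply, hk.1,
    hk.2, hr]

/-- The local rule is an involution. -/
theorem localRule_localRule {c d : ℤ} {x : IntTuple r} (hκ : Antitone κ) (hν : Antitone ν)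
    (hx : Antitone x) (h1 : SkewColumn c κ x) (h2 : SkewColumn d x ν) :
    localRule (localRule x ν κ) ν κ = x := by
  rw [localRule_eq_reflect hκ hν hx h1 h2, localRule]
  conv_rhs => rw [← sortDesc_comp_of_antitone hx (reflectPerm hκ hν)]
  congr 1
  funext k
  simp [reflectPerm]

end Classes

/-! ### Dominance along a slide -/

section Dominance

variable {r : ℕ}

/-- Pigeonhole: otherwise the `i + 1` smallest values of `f` are all below `J i`, and since `J ≤ f`
they are attained at indices less than `i`. -/
theorem sorted_ge {k : ℕ} {J : Fin k → Fin r} (hJ : StrictMono J) {f : Fin k → Fin r}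
    (hf : ∀ i, J i ≤ f i) (i : Fin k) : J i ≤ f (Tuple.sort f i) := by
  by_contra hlt
  push Not at hlt
  have hmaps : ∀ m ∈ Finset.Iic i, Tuple.sort f m ∈ Finset.Iio i := by
    intro m hm
    rw [Finset.mem_Iic] at hm
    rw [Finset.mem_Iio, ← hJ.lt_iff_lt]
    exact (hf _).trans_lt ((Tuple.monotone_sort f hm).trans_lt hlt)
  have hcard := Finset.card_le_card_of_injOn (fun m => Tuple.sort f m) hmaps
    (fun a _ b _ hab => (Tuple.sort f).injective hab)
  rw [Fin.card_Iic, Fin.card_Iio] at hcard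
  omega

theorem exists_strictMono_ge {k : ℕ} {J : Fin k → Fin r} (hJ : StrictMono J) {f : Fin k → Fin r}
    (hf : ∀ i, J i ≤ f i) (hinj : Function.Injective f) (z : IntTuple r) :
    ∃ J' : Fin k → Fin r, StrictMono J' ∧ J ≤ J' ∧ ∑ i, z (J' i) = ∑ i, z (f i) :=
  ⟨f ∘ Tuple.sort f, (Tuple.monotone_sort f).strictMono_of_injective
    (hinj.comp (Tuple.sort f).injective), sorted_ge hJ hf,
    Equiv.sum_comp (Tuple.sort f) fun i => z (f i)⟩

/-- Sorting moves large entries up: the sum of a sorted tuple over a set of rows is at most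
the sum of the original tuple over some set of lower rows. -/
theorem exists_ge_sum_sortDesc {k : ℕ} (z : IntTuple r) {J : Fin k → Fin r} (hJ : StrictMono J) :
    ∃ J' : Fin k → Fin r, StrictMono J' ∧ J ≤ J' ∧
      ∑ i, sortDesc z (J i) ≤ ∑ i, z (J' i) := by
  -- `Tuple.sort` sorts increasingly; the order dual turns it into a decreasing bubble sort.
  let P : (Fin r → ℤᵒᵈ) → Prop := fun y => ∀ J : Fin k → Fin r, StrictMono J →
    ∃ J' : Fin k → Fin r, StrictMono J' ∧ J ≤ J' ∧
      ∑ i, OrderDual.ofDual (y (J i)) ≤ ∑ i, z (J' i)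
  have key : P ((OrderDual.toDual ∘ z) ∘ Tuple.sort (OrderDual.toDual ∘ z)) := by
    refine Tuple.bubble_sort_induction (P := P) ?_ ?_
    · exact fun J hJ => ⟨J, hJ, le_rfl, le_rfl⟩
    · intro y i j hij hlt hP J hJ
      have hlt' : OrderDual.ofDual (y i) < OrderDual.ofDual (y j) := hlt
      -- Let the swap move the larger entry from row `j` up to row `i`. A set containing both rows
      -- keeps its sum. If it contains only `i`, trading `i` for the lower row `j` recovers the sum
      -- before the swap. If it misses `i`, the swap did not increase its sum.
      by_cases hi : ∃ a, J a = i
      · by_cases hj : ∃ b, J b = j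
        · obtain ⟨J', h1, h2, h3⟩ := hP J hJ
          refine ⟨J', h1, h2, le_trans (le_of_eq ?_) h3⟩
          obtain ⟨a, ha⟩ := hi
          obtain ⟨b, hb⟩ := hj
          rw [← Equiv.sum_comp (Equiv.swap a b) fun i => OrderDual.ofDual (y (J i))]
          refine Finset.sum_congr rfl fun m _ => ?_
          simp only [Function.comp_apply]
          rw [← ha, ← hb]
          congr 2
          exact (hJ.injective.swap_apply a b m).symm ▸ rfl
        · obtain ⟨a, ha⟩ := hi
          push Not at hj
          have hinj : Function.Injective (Function.update J a j) := by
            intro m m' hmm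
            by_cases h : m = a <;> by_cases h' : m' = a
            · rw [h, h']
            · subst h; simp [h'] at hmm; exact absurd hmm.symm (hj m')
            · subst h'; simp [h] at hmm; exact absurd hmm (hj m)
            · simp [h, h'] at hmm; exact hJ.injective hmm
          obtain ⟨J1, h1, h2, h3⟩ := exists_strictMono_ge hJ (f := Function.update J a j)
            (fun m => by
              by_cases h : m = a
              · subst h; simp [ha, hij.le]
              · simp [h]) hinj fun m => OrderDual.ofDual (y m)
          obtain ⟨J', h1', h2', h3'⟩ := hP J1 h1
          refine ⟨J', h1', h2.trans h2', le_trans (le_of_eq ?_) h3'⟩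
          rw [h3]
          refine Finset.sum_congr rfl fun m _ => ?_
          by_cases h : m = a
          · subst h; simp [ha]
          · have hne : J m ≠ i := fun hh => h (hJ.injective (hh.trans ha.symm))
            simp [h, Equiv.swap_apply_of_ne_of_ne hne (hj m)]
      · push Not at hi
        obtain ⟨J', h1, h2, h3⟩ := hP J hJ
        refine ⟨J', h1, h2, le_trans (Finset.sum_le_sum fun m _ => ?_) h3⟩
        by_cases h : J m = j
        · simp only [Function.comp_apply, h, Equiv.swap_apply_right]; exact hlt'.le
        · simp [Equiv.swap_apply_of_ne_of_ne (hi m) h]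
  obtain ⟨J', h1, h2, h3⟩ := key J hJ
  refine ⟨J', h1, h2, le_trans (le_of_eq ?_) h3⟩
  have hs : sortDesc z = z ∘ Tuple.sort (OrderDual.toDual ∘ z) := by
    have hanti : Antitone (z ∘ Tuple.sort (OrderDual.toDual ∘ z)) := fun a b hab =>
      Tuple.monotone_sort (OrderDual.toDual ∘ z) hab
    rw [← sortDesc_comp_of_antitone hanti (Tuple.sort (OrderDual.toDual ∘ z)).symm,
      Function.comp_assoc, Equiv.self_comp_symm, Function.comp_id]
  rw [hs]
  rfl

/-- `Reach x q K w`: the number `w` is the sum of the increments of `x 0, x 1, …, x q` over the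
rows of a sequence of `k`-subsets that moves upwards and stays below `K`. -/
def Reach {k : ℕ} (x : ℕ → IntTuple r) : ℕ → (Fin k → Fin r) → ℤ → Prop
  | 0, _, w => w = 0
  | q + 1, K, w => ∃ K₁ : Fin k → Fin r, StrictMono K₁ ∧ K ≤ K₁ ∧
      Reach x q K₁ (w - ∑ i, (x (q + 1) (K₁ i) - x q (K₁ i)))

/-- Lifts a path of sets from the lower row of a strip of squares to the upper row. The end set may
be lowered from `K` to `K'`, at the price of the change of `κ q`; this freedom is what makes the
induction close. -/
theorem Reach.slide {k : ℕ} {x κ : ℕ → IntTuple r} {q : ℕ} (hκ : ∀ j ≤ q, Antitone (κ j))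
    (h : ∀ j < q, κ (j + 1) = localRule (x j) (x (j + 1)) (κ j)) {K K' : Fin k → Fin r}
    (hK' : StrictMono K') (hKK' : K ≤ K') {w : ℤ} (hw : Reach κ q K w) :
    ∃ w', w + ∑ i, κ q (K' i) - ∑ i, κ q (K i) ≤ w' ∧ Reach x q K' w' := by
  induction q generalizing K K' w with
  | zero =>
    refine ⟨0, ?_, rfl⟩
    have : w = 0 := hw
    have := Finset.sum_le_sum fun i (_ : i ∈ Finset.univ) => hκ 0 le_rfl (hKK' i)
    linarith
  | succ q ih =>
    obtain ⟨K₁, hK₁, hle, hreach⟩ := hw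
    have hJ : StrictMono (K₁ ⊔ K') := fun a b hab => by
      simp only [Pi.sup_apply]
      exact sup_lt_iff.2 ⟨lt_sup_of_lt_left (hK₁ hab), lt_sup_of_lt_right (hK' hab)⟩
    obtain ⟨K₂, hK₂, hle₂, hsum⟩ := exists_ge_sum_sortDesc (x (q + 1) + κ q - x q) hJ
    obtain ⟨w', hw', hr⟩ := ih (fun j hj => hκ j (by omega)) (fun j hj => h j (by omega))
      hK₂ (le_sup_left.trans hle₂) hreach
    refine ⟨w' + ∑ i, (x (q + 1) (K₂ i) - x q (K₂ i)), ?_, K₂, hK₂, le_sup_right.trans hle₂, ?_⟩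
    · have hrule : κ (q + 1) = sortDesc (x (q + 1) + κ q - x q) := h q (by omega)
      -- Supermodularity, coordinate by coordinate: one of `K₁ i`, `K' i` is the maximum, the other
      -- is below `K i` and so has the smaller value of `κ`.
      have hmod : ∑ i, κ (q + 1) (K₁ i) + ∑ i, κ (q + 1) (K' i) ≤
          ∑ i, κ (q + 1) (K i) + ∑ i, κ (q + 1) ((K₁ ⊔ K') i) := by
        rw [← Finset.sum_add_distrib, ← Finset.sum_add_distrib]
        refine Finset.sum_le_sum fun i _ => ?_
        have ha := hκ (q + 1) le_rfl (hle i)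
        have hb := hκ (q + 1) le_rfl (hKK' i)
        rcases le_total (K₁ i) (K' i) with h | h
        · simp only [Pi.sup_apply, sup_eq_right.2 h]; linarith
        · simp only [Pi.sup_apply, sup_eq_left.2 h]; linarith
      rw [← hrule] at hsum
      simp only [Pi.add_apply, Pi.sub_apply, Finset.sum_add_distrib, Finset.sum_sub_distrib]
        at hsum hw' ⊢
      linarith
    · rwa [add_sub_cancel_right]

/-- Summation by parts: each passage from `K` to a lower set can only decrease the value of an
antitone tuple, and the initial set lies above the lowest set `L`. -/
theorem Reach.le {k : ℕ} {x : ℕ → IntTuple r} {q : ℕ} (hx : ∀ j ≤ q, Antitone (x j))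
    {K L : Fin k → Fin r} (hL : ∀ K₁ : Fin k → Fin r, StrictMono K₁ → K₁ ≤ L) (hK : StrictMono K)
    {w : ℤ} (hw : Reach x q K w) : w ≤ ∑ i, x q (K i) - ∑ i, x 0 (L i) := by
  induction q generalizing K w with
  | zero =>
    have : w = 0 := hw
    have := Finset.sum_le_sum fun i (_ : i ∈ Finset.univ) => hx 0 le_rfl (hL K hK i)
    linarith
  | succ q ih =>
    obtain ⟨K₁, hK₁, hle, hreach⟩ := hw
    have h1 := ih (fun j hj => hx j (by omega)) hK₁ hreach
    have h2 := Finset.sum_le_sum fun i (_ : i ∈ Finset.univ) => hx (q + 1) le_rfl (hle i)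
    rw [Finset.sum_sub_distrib] at h1
    linarith

theorem Reach.const {k : ℕ} (x : ℕ → IntTuple r) (q : ℕ) {K : Fin k → Fin r} (hK : StrictMono K) :
    Reach x q K (∑ i, x q (K i) - ∑ i, x 0 (K i)) := by
  induction q with
  | zero => exact sub_self _
  | succ q ih =>
    refine ⟨K, hK, le_rfl, ?_⟩
    rw [Finset.sum_sub_distrib]
    convert ih using 1
    ring

/-- In a growth rectangle with lower left corner `0`, the upper left corner `α`, the upper right
corner `ν` and the lower right corner `μ` satisfy `μ ≤ ν - w₀ α` in dominance order. -/
theorem sum_growthRectangle_le {a b k : ℕ} {Γ : ℕ → ℕ → IntTuple r}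
    (hanti : ∀ i ≤ a, ∀ j ≤ b, Antitone (Γ i j))
    (hrule : ∀ i < a, ∀ j < b, Γ (i + 1) (j + 1) = localRule (Γ i j) (Γ i (j + 1)) (Γ (i + 1) j))
    (hzero : Γ a 0 = 0) {K L : Fin k → Fin r} (hK : StrictMono K)
    (hL : ∀ K₁ : Fin k → Fin r, StrictMono K₁ → K₁ ≤ L) :
    ∑ i, Γ a b (K i) ≤ ∑ i, Γ 0 b (K i) - ∑ i, Γ 0 0 (L i) := by
  have key : ∀ i ≤ a, ∃ w, ∑ m, Γ a b (K m) ≤ w ∧ Reach (Γ (a - i)) b K w := by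
    intro i
    induction i with
    | zero =>
      -- In the bottom row the constant path `K` collects the whole of `Γ a b`, because the lower
      -- left corner vanishes.
      refine fun _ => ⟨_, ?_, Reach.const (Γ a) b hK⟩
      simp [hzero]
    | succ i ih =>
      intro hi
      obtain ⟨w, hw, hr⟩ := ih (by omega)
      obtain ⟨w', hw', hr'⟩ := Reach.slide (x := Γ (a - (i + 1))) (κ := Γ (a - i))
        (hanti (a - i) (by omega)) (fun j hj => by
          have := hrule (a - (i + 1)) (by omega) j hj
          rwa [show a - (i + 1) + 1 = a - i by omega] at this) hK le_rfl hr
      exact ⟨w', by linarith, hr'⟩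
  obtain ⟨w, hw, hr⟩ := key a le_rfl
  rw [Nat.sub_self] at hr
  exact hw.trans (hr.le (hanti 0 (by omega)) hL hK)

end Dominance

/-! ### Growth triangles with rectangular final shape -/

section Growth

variable {r : ℕ}

theorem sum_fin_split {k l : ℕ} (h : k + l = r) (f : Fin r → ℤ) :
    ∑ i, f i = ∑ i : Fin k, f ⟨i, by omega⟩ + ∑ i : Fin l, f ⟨k + i, by omega⟩ := by
  subst h
  exact Fin.sum_univ_add f

/-- With equal totals, an upper bound for a final sum is a lower bound for the complementary initial
sum; hence all initial sums agree. -/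
theorem eq_of_sum_le {μ β : IntTuple r}
    (h1 : ∀ k l (h : k + l = r), ∑ i : Fin k, μ ⟨i, by omega⟩ ≤ ∑ i : Fin k, β ⟨i, by omega⟩)
    (h2 : ∀ k l (h : k + l = r),
      ∑ i : Fin l, μ ⟨k + i, by omega⟩ ≤ ∑ i : Fin l, β ⟨k + i, by omega⟩)
    (h3 : ∑ i, μ i = ∑ i, β i) : μ = β := by
  have key : ∀ k (h : k ≤ r),
      ∑ i : Fin k, μ ⟨i, by omega⟩ = ∑ i : Fin k, β ⟨i, by omega⟩ := by
    intro k h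
    have hk : k + (r - k) = r := by omega
    have a := h1 k _ hk
    have b := h2 k _ hk
    rw [sum_fin_split hk μ, sum_fin_split hk β] at h3
    linarith
  funext k
  have a := key k k.isLt.le
  have b := key (k + 1) k.isLt
  rw [Fin.sum_univ_castSucc, Fin.sum_univ_castSucc] at b
  simp only [Fin.val_castSucc, Fin.val_last, Fin.eta] at b
  linarith

theorem sum_top_rotCompl (m : ℤ) (α : IntTuple r) {k l : ℕ} (h : k + l = r) :
    ∑ i : Fin k, rotCompl m α ⟨i, by omega⟩ = ∑ _i : Fin k, m - ∑ i : Fin k, α ⟨l + i, by omega⟩ := by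
  rw [← Finset.sum_sub_distrib, ← Equiv.sum_comp Fin.revPerm]
  refine Finset.sum_congr rfl fun i _ => ?_
  rw [rotCompl]
  congr 2
  ext
  simp only [Fin.val_rev, Fin.revPerm_apply]
  omega

theorem sum_bot_rotCompl (m : ℤ) (α : IntTuple r) {k l : ℕ} (h : k + l = r) :
    ∑ i : Fin l, rotCompl m α ⟨k + i, by omega⟩ = ∑ _i : Fin l, m - ∑ i : Fin l, α ⟨i, by omega⟩ := by
  rw [← Finset.sum_sub_distrib, ← Equiv.sum_comp Fin.revPerm]
  refine Finset.sum_congr rfl fun i _ => ?_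
  rw [rotCompl]
  congr 2
  ext
  simp only [Fin.val_rev, Fin.revPerm_apply]
  omega

theorem strictMono_le_bottom {k l : ℕ} (h : k + l = r) {K : Fin k → Fin r} (hK : StrictMono K)
    (i : Fin k) : K i ≤ ⟨l + i, by omega⟩ := by
  have key : ∀ j : ℕ, ∀ i : Fin k, (i : ℕ) + j + 1 = k → (K i : ℕ) ≤ l + i := by
    intro j
    induction j with
    | zero => intro i hi; have := (K i).isLt; omega
    | succ j ih =>
      intro i hi
      have h1 := ih ⟨i + 1, by omega⟩ (by simp; omega)
      have h2 : K i < K ⟨i + 1, by omega⟩ := hK (by simp [Fin.lt_def])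
      rw [Fin.lt_def] at h2
      simp only at h1
      omega
  exact key (k - 1 - i) i (by omega)

/-- The first `k` rows in `sum_growthRectangle_le`. -/
theorem sum_top_growthRectangle_le {a b : ℕ} {Γ : ℕ → ℕ → IntTuple r}
    (hanti : ∀ i ≤ a, ∀ j ≤ b, Antitone (Γ i j))
    (hrule : ∀ i < a, ∀ j < b, Γ (i + 1) (j + 1) = localRule (Γ i j) (Γ i (j + 1)) (Γ (i + 1) j))
    (hzero : Γ a 0 = 0) {m : ℤ} (hm : Γ 0 b = fun _ => m) {k l : ℕ} (h : k + l = r) :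
    ∑ i : Fin k, Γ a b ⟨i, by omega⟩ ≤ ∑ _i : Fin k, m - ∑ i : Fin k, Γ 0 0 ⟨l + i, by omega⟩ := by
  have := sum_growthRectangle_le hanti hrule hzero (K := fun i : Fin k => ⟨i, by omega⟩)
    (L := fun i : Fin k => ⟨l + i, by omega⟩) (fun a b hab => hab)
    fun K₁ hK₁ i => strictMono_le_bottom h hK₁ i
  rw [hm] at this
  exact this

theorem growth_rule (R : ℕ → IntTuple r) {i j : ℕ} (hij : i < j) : growth R (i + 1) (j + 1) =
    localRule (growth R i j) (growth R i (j + 1)) (growth R (i + 1) j) := by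
  rw [growth, if_neg (by omega)]

/-- Used to recognize transformed triangles: it suffices to compare the boundary and check the local
rule. -/
theorem growth_unique {R : ℕ → IntTuple r} {n : ℕ} {D : ℕ → ℕ → IntTuple r}
    (h0 : ∀ j ≤ n, D 0 j = R j) (hd : ∀ i ≤ n, D i i = R 0)
    (hs : ∀ i j, i < j → j < n →
      D (i + 1) (j + 1) = localRule (D i j) (D i (j + 1)) (D (i + 1) j)) :
    ∀ i j, i ≤ j → j ≤ n → growth R i j = D i j := by
  intro i
  induction i with
  | zero => intro j _ hj; rw [growth, h0 j hj]
  | succ i ih =>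
    intro j hij
    induction j, hij using Nat.le_induction with
    | base => intro hj; rw [growth_diag, hd _ hj]
    | succ j hij ihj =>
      intro hj
      rw [growth_rule R (by omega), ih j (by omega) (by omega), ih (j + 1) (by omega) hj,
        ihj (by omega), hs i j (by omega) (by omega)]

section

variable {R : ℕ → IntTuple r} {n : ℕ} {c : ℕ → ℤ}

theorem growth_antitone (hR : ∀ j ≤ n, Antitone (R j))
    (hstep : ∀ j < n, SkewColumn (c j) (R j) (R (j + 1))) {i j : ℕ} (hij : i ≤ j) (hj : j ≤ n) :
    Antitone (growth R i j) :=
  (growth_spec R n c hR hstep i (by omega)).1 j hj hij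

theorem growth_horizontal (hR : ∀ j ≤ n, Antitone (R j))
    (hstep : ∀ j < n, SkewColumn (c j) (R j) (R (j + 1))) {i j : ℕ} (hij : i ≤ j) (hj : j < n) :
    SkewColumn (c j) (growth R i j) (growth R i (j + 1)) :=
  (growth_spec R n c hR hstep i (by omega)).2 j hj hij

theorem growth_rule_symm (hR : ∀ j ≤ n, Antitone (R j))
    (hstep : ∀ j < n, SkewColumn (c j) (R j) (R (j + 1))) {i j : ℕ} (hij : i < j) (hj : j < n) :
    growth R i j =
      localRule (growth R (i + 1) (j + 1)) (growth R i (j + 1)) (growth R (i + 1) j) := by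
  rw [growth_rule R hij, localRule_localRule (c := c i) (d := c j)
    (growth_antitone hR hstep (by omega) (by omega)) (growth_antitone hR hstep (by omega) (by omega))
    (growth_antitone hR hstep (by omega) (by omega))
    (growth_vertical R n c hR hstep i j (by omega) (by omega))
    (growth_horizontal hR hstep (by omega) hj)]

theorem sum_growth (R : ℕ → IntTuple r) {i j : ℕ} (hij : i ≤ j) :
    ∑ k, growth R i j k = ∑ k, R j k - ∑ k, R i k + ∑ k, R 0 k := by
  induction i generalizing j with
  | zero => rw [growth]; ring
  | succ i ih =>
    induction j, hij using Nat.le_induction with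
    | base => rw [growth_diag]; ring
    | succ j hij ihj =>
      rw [growth_rule R (by omega), localRule, sum_sortDesc]
      simp only [Pi.add_apply, Pi.sub_apply, Finset.sum_add_distrib, Finset.sum_sub_distrib]
      rw [ihj, ih (by omega), ih (by omega)]
      ring

/-- In a growth triangle whose first row starts at `0` and ends at a rectangle, the last column is
the rotated complement of the first row. -/
theorem growth_last_column (hR : ∀ j ≤ n, Antitone (R j))
    (hstep : ∀ j < n, SkewColumn (c j) (R j) (R (j + 1))) (h0 : R 0 = 0) {m : ℤ}
    (hm : R n = fun _ => m) {i : ℕ} (hi : i ≤ n) : growth R i n = rotCompl m (R i) := by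
  have hdiag : growth R i i = 0 := by rw [growth_diag, h0]
  refine eq_of_sum_le (fun k l h => ?_) (fun k l h => ?_) ?_
  -- The rectangle of rows `0, …, i` and columns `i, …, n` has lower left corner `0` and upper right
  -- corner the rectangle of width `m`.
  · have := sum_top_growthRectangle_le (a := i) (b := n - i) (Γ := fun p q => growth R p (i + q))
      (fun p hp q hq => growth_antitone hR hstep (by omega) (by omega))
      (fun p hp q hq => growth_rule R (i := p) (j := i + q) (by omega)) (by simpa using hdiag) (m := m)
      (by rw [growth, ← hm]; congr 1; omega) h
    rw [show i + (n - i) = n by omega] at this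
    rw [sum_top_rotCompl m _ h]
    simpa only [add_zero, growth] using this
  -- The same rectangle reflected in its antidiagonal: `R i` and the unknown corner change places,
  -- so the bound on initial sums of `R i` bounds final sums of the unknown corner.
  · have := sum_top_growthRectangle_le (a := n - i) (b := i)
      (Γ := fun p q => growth R (i - q) (n - p))
      (fun p hp q hq => growth_antitone hR hstep (by omega) (by omega))
      (fun p hp q hq => by
        have := growth_rule_symm hR hstep (i := i - (q + 1)) (j := n - (p + 1)) (by omega) (by omega)
        rw [show i - (q + 1) + 1 = i - q by omega, show n - (p + 1) + 1 = n - p by omega] at this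
        exact this)
      (by simpa [show n - (n - i) = i by omega] using hdiag) (m := m)
      (by simp [growth, hm]) (k := l) (l := k) (by omega)
    rw [show n - (n - i) = i by omega, Nat.sub_self, Nat.sub_zero, Nat.sub_zero] at this
    rw [sum_bot_rotCompl m _ h]
    simp only [growth] at this ⊢
    linarith
  · rw [sum_growth R hi, h0, hm]
    simp only [rotCompl, Finset.sum_sub_distrib]
    rw [← Equiv.sum_comp Fin.revPerm (R i)]
    simp

end

end Growth

/-! ### Evacuation and promotion diagrams of rectangular tableaux. -/

namespace FluctuatingTableau

variable {r n : ℕ} {c : Fin n → ℤ} (T : FluctuatingTableau r n c)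

theorem evacDiagram_zero (j : ℕ) : T.evacDiagram 0 j = T.row j := by
  rw [evacDiagram, growth]

theorem evacDiagram_diag (i : ℕ) : T.evacDiagram i i = 0 := by
  rw [evacDiagram, growth_diag, row_zero]

theorem evacDiagram_antitone {i j : ℕ} (hij : i ≤ j) (hj : j ≤ n) :
    Antitone (T.evacDiagram i j) :=
  growth_antitone (fun j _ => T.row_antitone j) T.row_step hij hj

theorem evacDiagram_horizontal {i j : ℕ} (hij : i ≤ j) (hj : j < n) :
    SkewColumn (typeSeq c j) (T.evacDiagram i j) (T.evacDiagram i (j + 1)) :=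
  growth_horizontal (fun j _ => T.row_antitone j) T.row_step hij hj

theorem evacDiagram_vertical {i j : ℕ} (hij : i < j) (hj : j ≤ n) :
    SkewColumn (typeSeq c i) (T.evacDiagram (i + 1) j) (T.evacDiagram i j) :=
  growth_vertical T.row n (typeSeq c) (fun j _ => T.row_antitone j) T.row_step i j hij hj

theorem evacDiagram_rule {i j : ℕ} (hij : i < j) : T.evacDiagram (i + 1) (j + 1) =
    localRule (T.evacDiagram i j) (T.evacDiagram i (j + 1)) (T.evacDiagram (i + 1) j) :=
  growth_rule T.row hij

theorem evacDiagram_rule_symm {i j : ℕ} (hij : i < j) (hj : j < n) : T.evacDiagram i j =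
    localRule (T.evacDiagram (i + 1) (j + 1)) (T.evacDiagram i (j + 1)) (T.evacDiagram (i + 1) j) :=
  growth_rule_symm (fun j _ => T.row_antitone j) T.row_step hij hj

variable {T} {m : ℤ}

theorem IsRectangular.exists_row (hT : T.IsRectangular) : ∃ m : ℤ, T.row n = fun _ => m := by
  have e : T.row n = T.shape (Fin.last n) := by
    rw [row]; congr 1; ext; simp
  rcases Nat.eq_zero_or_pos r with rfl | hr
  · exact ⟨0, Subsingleton.elim _ _⟩
  · exact ⟨T.shape (Fin.last n) ⟨0, hr⟩, by rw [e]; funext k; exact hT k _⟩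

theorem evacDiagram_last (hm : T.row n = fun _ => m) {i : ℕ} (hi : i ≤ n) :
    T.evacDiagram i n = rotCompl m (T.row i) :=
  growth_last_column (fun j _ => T.row_antitone j) T.row_step T.row_zero hm hi

/-- The complemented transpose obeys the same local rule, because the rule is an involution and
commutes with `rotCompl`. The boundaries agree by `evacDiagram_last`. -/
theorem dualEvacDiagram_eq (hm : T.row n = fun _ => m) {k j : ℕ} (hkj : k + j ≤ n) :
    T.dualEvacDiagram k j = rotCompl m (T.evacDiagram j (n - k)) := by
  have := growth_unique (R := fun l => T.row (n - l)) (n := n)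
    (D := fun k l => rotCompl m (T.evacDiagram (n - l) (n - k)))
    (fun l hl => by
      simp only [Nat.sub_zero]
      rw [evacDiagram_last hm (Nat.sub_le n l), rotCompl_rotCompl])
    (fun i hi => by
      simp only [Nat.sub_zero]
      rw [evacDiagram_diag, rotCompl_zero, hm])
    (fun i j hij hj => by
      rw [localRule_rotCompl]
      congr 1
      have := T.evacDiagram_rule_symm (i := n - (j + 1)) (j := n - (i + 1)) (by omega) (by omega)
      rwa [show n - (j + 1) + 1 = n - j by omega, show n - (i + 1) + 1 = n - i by omega] at this)
    k (n - j) (by omega) (by omega)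
  rw [dualEvacDiagram, this, show n - (n - j) = j by omega]

variable (T)

theorem row_evacuation {k : ℕ} (hk : k ≤ n) : T.evacuation.row k = T.evacDiagram (n - k) n := by
  simp only [row, evacuation]
  congr 1
  simp [hk]

theorem row_dualEvacuation {k : ℕ} (hk : k ≤ n) : T.dualEvacuation.row k = T.dualEvacDiagram k 0 := by
  simp only [row, dualEvacuation]
  congr 1
  simp [hk]

theorem row_promotion {k : ℕ} (hk : k < n) : T.promotion.row k = T.evacDiagram 1 (k + 1) := by
  simp only [row, promotion]
  rw [if_neg (by simp; omega)]
  congr 2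
  simp [hk.le]

theorem row_promotion_last : T.promotion.row n = T.row n := by
  simp only [row, promotion]
  rw [if_pos (by simp)]

theorem row_evacuation_last : T.evacuation.row n = T.row n := by
  rw [T.row_evacuation le_rfl, Nat.sub_self, evacDiagram_zero]

theorem row_eq_of_le {c' : Fin n → ℤ} {T' : FluctuatingTableau r n c'}
    (h : ∀ k ≤ n, T'.row k = T.row k) : T'.row = T.row := by
  funext k
  rcases le_total k n with hk | hk
  · exact h k hk
  · have := h n le_rfl
    simp only [row] at this ⊢
    simpa [hk] using this

variable {T}

/-- For rectangular tableaux `E*` undoes `E`: each of the two replaces the shapes, up to order, by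
rotated complements. So the lower half of the promotion matrix is determined by the diagram of `T`
itself. -/
theorem row_dualEvacuation_evacuation (hm : T.row n = fun _ => m) :
    T.evacuation.dualEvacuation.row = T.row := by
  refine T.row_eq_of_le fun k hk => ?_
  have hm' := T.row_evacuation_last.trans hm
  rw [row_dualEvacuation _ hk, dualEvacDiagram_eq hm' (by omega), evacDiagram_zero,
    T.row_evacuation (by omega), show n - (n - k) = k by omega, evacDiagram_last hm hk,
    rotCompl_rotCompl]

/-- The dual evacuation diagram of `E*(E(T))` is the rotated complement of the transposed
evacuation diagram of `T`. -/
theorem dualEvacDiagram_dualEvacuation_evacuation (hm : T.row n = fun _ => m) {k j : ℕ}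
    (hkj : k + j ≤ n) : T.evacuation.dualEvacuation.dualEvacDiagram k j =
      rotCompl m (T.evacDiagram j (n - k)) := by
  rw [← dualEvacDiagram_eq hm hkj, dualEvacDiagram, dualEvacDiagram,
    row_dualEvacuation_evacuation hm]

/-- The antidiagonal reflection of the triangle is again a growth triangle, since the local rule may
be run from the lower right corner to the upper left. -/
theorem evacDiagram_evacuation {i j : ℕ} (hij : i ≤ j) (hj : j ≤ n) :
    T.evacuation.evacDiagram i j = T.evacDiagram (n - j) (n - i) :=
  growth_unique (R := T.evacuation.row) (n := n) (D := fun i j => T.evacDiagram (n - j) (n - i))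
    (fun l hl => by simp only [Nat.sub_zero]; rw [T.row_evacuation hl])
    (fun i hi => by rw [evacDiagram_diag, row_zero])
    (fun i j hij hj => by
      have := T.evacDiagram_rule_symm (i := n - (j + 1)) (j := n - (i + 1)) (by omega) (by omega)
      rwa [show n - (j + 1) + 1 = n - j by omega, show n - (i + 1) + 1 = n - i by omega] at this)
    i j hij hj

theorem evacDiagram_promotion {i j : ℕ} (hij : i ≤ j) (hj : j < n) :
    T.promotion.evacDiagram i j = T.evacDiagram (i + 1) (j + 1) :=
  growth_unique (R := T.promotion.row) (n := n - 1) (D := fun i j => T.evacDiagram (i + 1) (j + 1))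
    (fun l hl => by rw [T.row_promotion (by omega)])
    (fun i hi => by rw [evacDiagram_diag, row_zero])
    (fun i j hij hj => T.evacDiagram_rule (by omega))
    i j hij (by omega)

/-- The only column of the promoted triangle that is not a column of the old one; rectangularity
determines it from the first row. -/
theorem evacDiagram_promotion_last (hm : T.row n = fun _ => m) {i : ℕ} (hi : i < n) :
    T.promotion.evacDiagram i n = rotCompl m (T.evacDiagram 1 (i + 1)) := by
  rw [evacDiagram_last (T.row_promotion_last.trans hm) hi.le, T.row_promotion hi]

end FluctuatingTableau

/-! ### Enumerations of finite sets of rows -/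

section Enumeration

theorem fromTop_eq_orderEmbOfFin (s : Finset ℕ) {a : ℕ} (ha : a < s.card) :
    fromTop s a = s.orderEmbOfFin rfl ⟨a, ha⟩ := by
  rw [fromTop, Finset.orderEmbOfFin_apply, List.getD_eq_getElem _ _ (by simpa using ha)]
  rfl

theorem fromBottom_eq_fromTop (s : Finset ℕ) {a : ℕ} (ha : a < s.card) :
    fromBottom s a = fromTop s (s.card - 1 - a) := by
  have h : s.sort (· ≥ ·) = (s.sort (· ≤ ·)).reverse :=
    List.Perm.eq_of_pairwise' (Finset.pairwise_sort s _)
      (List.pairwise_reverse.2 (Finset.pairwise_sort s _))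
      ((Finset.sort_perm_toList s _).trans
        ((Finset.sort_perm_toList s _).symm.trans (List.reverse_perm _).symm))
  rw [fromBottom, fromTop, h, List.getD_eq_getElem _ _ (by simpa using ha),
    List.getD_eq_getElem _ _ (by simp; omega), List.getElem_reverse]
  simp

theorem fromTop_eq_fromBottom (s : Finset ℕ) {a : ℕ} (ha : a < s.card) :
    fromTop s a = fromBottom s (s.card - 1 - a) := by
  rw [fromBottom_eq_fromTop s (by omega)]
  congr 1
  omega

theorem fromTop_mem (s : Finset ℕ) {a : ℕ} (ha : a < s.card) : fromTop s a ∈ s := by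
  rw [fromTop_eq_orderEmbOfFin s ha]
  exact Finset.orderEmbOfFin_mem _ _ _

theorem fromBottom_mem (s : Finset ℕ) {a : ℕ} (ha : a < s.card) : fromBottom s a ∈ s := by
  rw [fromBottom_eq_fromTop s ha]
  exact fromTop_mem s (by omega)

theorem fromTop_lt_iff (s : Finset ℕ) {a b : ℕ} (ha : a < s.card) (hb : b < s.card) :
    fromTop s a < fromTop s b ↔ a < b := by
  rw [fromTop_eq_orderEmbOfFin s ha, fromTop_eq_orderEmbOfFin s hb, OrderEmbedding.lt_iff_lt,
    Fin.mk_lt_mk]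

theorem fromBottom_lt_iff (s : Finset ℕ) {a b : ℕ} (ha : a < s.card) (hb : b < s.card) :
    fromBottom s a < fromBottom s b ↔ b < a := by
  rw [fromBottom_eq_fromTop s ha, fromBottom_eq_fromTop s hb, fromTop_lt_iff s (by omega) (by omega)]
  omega

theorem fromTop_inj (s : Finset ℕ) {a b : ℕ} (ha : a < s.card) (hb : b < s.card)
    (h : fromTop s a = fromTop s b) : a = b := by
  have h1 := fromTop_lt_iff s ha hb
  have h2 := fromTop_lt_iff s hb ha
  omega

theorem fromBottom_inj (s : Finset ℕ) {a b : ℕ} (ha : a < s.card) (hb : b < s.card)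
    (h : fromBottom s a = fromBottom s b) : a = b := by
  have h1 := fromBottom_lt_iff s ha hb
  have h2 := fromBottom_lt_iff s hb ha
  omega

theorem exists_fromTop_eq {s : Finset ℕ} {k : ℕ} (hk : k ∈ s) : ∃ a < s.card, fromTop s a = k := by
  have : k ∈ Set.range (s.orderEmbOfFin rfl) := by rw [Finset.range_orderEmbOfFin]; exact hk
  obtain ⟨⟨a, ha⟩, h⟩ := this
  exact ⟨a, ha, by rw [fromTop_eq_orderEmbOfFin s ha, h]⟩

theorem exists_fromBottom_eq {s : Finset ℕ} {k : ℕ} (hk : k ∈ s) :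
    ∃ a < s.card, fromBottom s a = k := by
  obtain ⟨a, ha, h⟩ := exists_fromTop_eq hk
  exact ⟨s.card - 1 - a, by omega, by rw [← fromTop_eq_fromBottom s ha, h]⟩

/-- The increasing enumeration of a finite set is unique. -/
theorem fromTop_of_strictMonoOn {s s' : Finset ℕ} {φ : ℕ → ℕ} (hcard : s'.card = s.card)
    (hmem : ∀ k ∈ s, φ k ∈ s') (hmono : StrictMonoOn φ s) {a : ℕ} (ha : a < s.card) :
    fromTop s' a = φ (fromTop s a) := by
  have := Finset.orderEmbOfFin_unique hcard (f := fun i => φ (s.orderEmbOfFin rfl i))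
    (fun i => hmem _ (Finset.orderEmbOfFin_mem _ _ _))
    (fun i j hij => hmono (Finset.orderEmbOfFin_mem _ _ _) (Finset.orderEmbOfFin_mem _ _ _)
      ((s.orderEmbOfFin rfl).strictMono hij))
  rw [fromTop_eq_orderEmbOfFin s ha, fromTop_eq_orderEmbOfFin s' (hcard ▸ ha)]
  rw [congrFun this ⟨a, ha⟩]
  exact (Finset.orderEmbOfFin_eq_orderEmbOfFin_iff).2 rfl

theorem fromBottom_of_strictMonoOn {s s' : Finset ℕ} {φ : ℕ → ℕ} (hcard : s'.card = s.card)
    (hmem : ∀ k ∈ s, φ k ∈ s') (hmono : StrictMonoOn φ s) {a : ℕ} (ha : a < s.card) :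
    fromBottom s' a = φ (fromBottom s a) := by
  rw [fromBottom_eq_fromTop s ha, fromBottom_eq_fromTop s' (hcard ▸ ha), hcard,
    fromTop_of_strictMonoOn hcard hmem hmono (by omega)]

theorem fromBottom_of_strictAntiOn {s s' : Finset ℕ} {φ : ℕ → ℕ} (hcard : s'.card = s.card)
    (hmem : ∀ k ∈ s, φ k ∈ s') (hanti : StrictAntiOn φ s) {a : ℕ} (ha : a < s.card) :
    fromBottom s' a = φ (fromTop s a) := by
  have := Finset.orderEmbOfFin_unique hcard (f := fun i => φ (s.orderEmbOfFin rfl i.rev))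
    (fun i => hmem _ (Finset.orderEmbOfFin_mem _ _ _))
    (fun i j hij => hanti (Finset.orderEmbOfFin_mem _ _ _) (Finset.orderEmbOfFin_mem _ _ _)
      ((s.orderEmbOfFin rfl).strictMono (Fin.rev_lt_rev.2 hij)))
  have ha' : s.card - 1 - a < s.card := by omega
  rw [fromBottom_eq_fromTop s' (hcard ▸ ha), hcard, fromTop_eq_orderEmbOfFin s ha,
    fromTop_eq_orderEmbOfFin s' (hcard ▸ ha')]
  have h := congrFun this ⟨s.card - 1 - a, ha'⟩
  rw [show Fin.rev ⟨s.card - 1 - a, ha'⟩ = ⟨a, ha⟩ by ext; simp only [Fin.val_rev]; omega] at h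
  rw [h]
  exact (Finset.orderEmbOfFin_eq_orderEmbOfFin_iff).2 rfl

theorem fromTop_of_strictAntiOn {s s' : Finset ℕ} {φ : ℕ → ℕ} (hcard : s'.card = s.card)
    (hmem : ∀ k ∈ s, φ k ∈ s') (hanti : StrictAntiOn φ s) {a : ℕ} (ha : a < s.card) :
    fromTop s' a = φ (fromBottom s a) := by
  rw [fromBottom_eq_fromTop s ha, fromTop_eq_fromBottom s' (hcard ▸ ha), hcard,
    fromBottom_of_strictAntiOn hcard hmem hanti (by omega)]

end Enumeration

/-! ### Rows of an edge, and their behaviour under rotated complements. -/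

section ChangedRows

variable {r : ℕ}

theorem mem_changedRows {μ ν : IntTuple r} {k : ℕ} :
    k ∈ changedRows μ ν ↔ ∃ p : Fin r, μ p ≠ ν p ∧ (p : ℕ) = k := by
  simp [changedRows]

theorem val_mem_changedRows {μ ν : IntTuple r} {p : Fin r} :
    (p : ℕ) ∈ changedRows μ ν ↔ μ p ≠ ν p := by
  rw [mem_changedRows]
  exact ⟨fun ⟨q, h, hq⟩ => Fin.ext hq ▸ h, fun h => ⟨p, h, rfl⟩⟩

theorem SkewColumn.card_changedRows {c : ℤ} {μ ν : IntTuple r} (h : SkewColumn c μ ν) :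
    (changedRows μ ν).card = c.natAbs := by
  obtain ⟨S, hS, h⟩ := h
  rw [changedRows, Finset.card_map]
  rcases eq_or_ne c 0 with rfl | hc
  · simp [h]
  · rw [← hS]
    congr 1
    ext k
    have := h k
    have hs : c.sign ≠ 0 := mt Int.sign_eq_zero_iff_zero.1 hc
    by_cases hk : k ∈ S <;> simp [this, hk, hs]

theorem changedRows_comm (μ ν : IntTuple r) : changedRows μ ν = changedRows ν μ := by
  simp only [changedRows, ne_comm]

theorem SkewColumn.natAbs_le {c : ℤ} {μ ν : IntTuple r} (h : SkewColumn c μ ν) : c.natAbs ≤ r := by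
  obtain ⟨S, hS, _⟩ := h
  rw [← hS]
  exact S.card_le_univ.trans (by simp)

/-- The rows of a skew column that is added or removed. -/
theorem SkewColumn.cases {c : ℤ} {μ ν : IntTuple r} (h : SkewColumn c μ ν) (k : Fin r) :
    (0 ≤ c → ν k = μ k ∨ ν k = μ k + 1) ∧ (c ≤ 0 → ν k = μ k ∨ ν k = μ k - 1) := by
  rw [skewColumn_iff] at h
  have := h.1 k
  rcases lt_trichotomy c 0 with hc | hc | hc
  · rw [Int.sign_eq_neg_one_of_neg hc] at this; omega
  · rw [hc, Int.sign_zero] at this; omega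
  · rw [Int.sign_eq_one_of_pos hc] at this; omega

theorem card_changedRows_rotCompl (m : ℤ) (μ ν : IntTuple r) :
    (changedRows (rotCompl m μ) (rotCompl m ν)).card = (changedRows μ ν).card := by
  rw [changedRows, changedRows, Finset.card_map, Finset.card_map]
  refine Finset.card_equiv Fin.revPerm fun k => ?_
  simp [rotCompl]

theorem rev_mem_changedRows (m : ℤ) {μ ν : IntTuple r} :
    ∀ k ∈ changedRows μ ν, r - 1 - k ∈ changedRows (rotCompl m μ) (rotCompl m ν) := by
  intro k hk
  obtain ⟨p, hp, rfl⟩ := mem_changedRows.1 hk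
  refine mem_changedRows.2 ⟨p.rev, ?_, ?_⟩
  · simpa [rotCompl] using hp
  · rw [Fin.val_rev]; omega

theorem strictAntiOn_rev (μ ν : IntTuple r) :
    StrictAntiOn (fun k => r - 1 - k) (changedRows μ ν : Set ℕ) := by
  intro a _ b hb hab
  obtain ⟨p, _, rfl⟩ := mem_changedRows.1 (Finset.mem_coe.1 hb)
  simp only
  omega

theorem fromTop_rotCompl (m : ℤ) (μ ν : IntTuple r) {a : ℕ} (ha : a < (changedRows μ ν).card) :
    fromTop (changedRows (rotCompl m μ) (rotCompl m ν)) a =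
      r - 1 - fromBottom (changedRows μ ν) a :=
  fromTop_of_strictAntiOn (card_changedRows_rotCompl m μ ν) (rev_mem_changedRows m)
    (strictAntiOn_rev μ ν) ha

theorem fromBottom_rotCompl (m : ℤ) (μ ν : IntTuple r) {a : ℕ} (ha : a < (changedRows μ ν).card) :
    fromBottom (changedRows (rotCompl m μ) (rotCompl m ν)) a =
      r - 1 - fromTop (changedRows μ ν) a :=
  fromBottom_of_strictAntiOn (card_changedRows_rotCompl m μ ν) (rev_mem_changedRows m)
    (strictAntiOn_rev μ ν) ha

theorem SkewColumn.rotCompl {c : ℤ} {μ ν : IntTuple r} (m : ℤ) (h : SkewColumn c μ ν) :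
    SkewColumn (-c) (rotCompl m μ) (rotCompl m ν) := by
  rw [skewColumn_iff] at h ⊢
  refine ⟨fun k => ?_, ?_⟩
  · have := h.1 k.rev
    rw [Int.sign_neg]
    simp only [_root_.rotCompl]
    omega
  · rw [← h.2, ← Finset.sum_neg_distrib, ← Equiv.sum_comp Fin.revPerm]
    refine Finset.sum_congr rfl fun k _ => ?_
    simp only [_root_.rotCompl, Fin.revPerm_apply, Fin.rev_rev]
    ring

end ChangedRows

/-! ### Sliding sets of rows within classes -/

section Slide

variable {r : ℕ} {κ ν : IntTuple r}

/-- If the rows with `P` come first within each class, this is the first row after those of the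
class of `p`. -/
def classCut (κ ν : IntTuple r) (P : Fin r → Prop) [DecidablePred P] (p : Fin r) : ℕ :=
  (Finset.univ.filter fun k : Fin r => (k : ℕ) < classLo κ ν p ∨ (k : ℕ) < classEnd κ ν p ∧ P k).card

/-- The rows with `P` come first within each class. -/
def IsUpper (κ ν : IntTuple r) (P : Fin r → Prop) : Prop :=
  ∀ j k : Fin r, j ≤ k → κ j = κ k → ν j = ν k → P k → P j

variable {P : Fin r → Prop} [DecidablePred P]

theorem lt_classCut_iff' (hκ : Antitone κ) (hν : Antitone ν) (hP : IsUpper κ ν P) (p k : Fin r) :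
    (k : ℕ) < classCut κ ν P p ↔
      (k : ℕ) < classLo κ ν p ∨ (k : ℕ) < classEnd κ ν p ∧ P k := by
  refine lt_card_filter_iff (fun k : Fin r => (k : ℕ) < classLo κ ν p ∨
    (k : ℕ) < classEnd κ ν p ∧ P k) (fun j k hjk h => ?_) k
  rw [Fin.le_def] at hjk
  by_cases hj : (j : ℕ) < classLo κ ν p
  · exact Or.inl hj
  · rcases h with h | ⟨h, hk⟩
    · omega
    · have h1 := (mem_class_iff hκ hν p j).1 ⟨by omega, by omega⟩
      have h2 := (mem_class_iff hκ hν p k).1 ⟨by omega, by omega⟩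
      exact Or.inr ⟨by omega, hP j k hjk (by rw [h1.1, h2.1]) (by rw [h1.2, h2.2]) hk⟩

theorem lt_classCut_iff (hκ : Antitone κ) (hν : Antitone ν) (hP : IsUpper κ ν P) {p k : Fin r}
    (h : κ k = κ p ∧ ν k = ν p) : (k : ℕ) < classCut κ ν P p ↔ P k := by
  rw [lt_classCut_iff' hκ hν hP]
  have := (mem_class_iff hκ hν p k).2 h
  exact ⟨fun h => by rcases h with h | h; · omega
                     · exact h.2, fun h => Or.inr ⟨this.2, h⟩⟩

theorem classLo_le_classCut (hκ : Antitone κ) (hν : Antitone ν) (hP : IsUpper κ ν P) (p : Fin r) :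
    classLo κ ν p ≤ classCut κ ν P p := by
  by_contra hlt
  push Not at hlt
  have hp := classLo_le hκ hν p
  have := (lt_classCut_iff' hκ hν hP p ⟨classCut κ ν P p, by omega⟩).2 (Or.inl hlt)
  exact lt_irrefl _ this

theorem classCut_le_classEnd (hκ : Antitone κ) (hν : Antitone ν) (hP : IsUpper κ ν P) (p : Fin r) :
    classCut κ ν P p ≤ classEnd κ ν p := by
  by_contra hlt
  push Not at hlt
  have hr : classCut κ ν P p ≤ r := by
    simpa [classCut] using (Finset.card_filter_le (Finset.univ : Finset (Fin r)) fun k =>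
      (k : ℕ) < classLo κ ν p ∨ (k : ℕ) < classEnd κ ν p ∧ P k)
  have hlo := classLo_le hκ hν p
  have hend := lt_classEnd hκ hν p
  have := (lt_classCut_iff' hκ hν hP p ⟨classEnd κ ν p, by omega⟩).1 hlt
  simp only at this
  omega

theorem classCut_congr {p k : Fin r} (h : κ k = κ p ∧ ν k = ν p) :
    classCut κ ν P k = classCut κ ν P p := by
  have := class_congr h
  simp only [classCut, this.1, this.2]

/-- The set of rows with `P`, as a set of numbers. -/
def rowSet (P : Fin r → Prop) [DecidablePred P] : Finset ℕ :=
  (Finset.univ.filter P).map Fin.valEmbedding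

theorem val_mem_rowSet {p : Fin r} : (p : ℕ) ∈ rowSet P ↔ P p := by
  simp only [rowSet, Finset.mem_map, Finset.mem_filter, Finset.mem_univ, true_and,
    Fin.valEmbedding_apply]
  exact ⟨fun ⟨q, h, hq⟩ => Fin.ext hq ▸ h, fun h => ⟨p, h, rfl⟩⟩

theorem exists_of_mem_rowSet {k : ℕ} (h : k ∈ rowSet P) : ∃ p : Fin r, P p ∧ (p : ℕ) = k := by
  simpa [rowSet] using h

/-- Translation of the rows with `P` to the end of their class. -/
def slideDown (κ ν : IntTuple r) (P : Fin r → Prop) [DecidablePred P] (k : ℕ) : ℕ :=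
  if h : k < r then k + (classEnd κ ν ⟨k, h⟩ - classCut κ ν P ⟨k, h⟩) else k

theorem slideDown_val (p : Fin r) :
    slideDown κ ν P p = p + (classEnd κ ν p - classCut κ ν P p) := by
  simp [slideDown]

/-- Reflecting an interval takes an initial segment to the final segment of the same length, which
is also its translate by `classEnd - classCut`. -/
theorem exists_slideDown_eq (hκ : Antitone κ) (hν : Antitone ν) (hP : IsUpper κ ν P)
    {P' : Fin r → Prop} (hP' : ∀ k, P' k ↔ P (reflectRow hκ hν k)) {p : Fin r} (hp : P p) :
    ∃ p' : Fin r, slideDown κ ν P p = p' ∧ (p' : ℕ) + classCut κ ν P p = p + classEnd κ ν p ∧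
      κ p' = κ p ∧ ν p' = ν p ∧ P' p' := by
  have h1 := classLo_le hκ hν p
  have h2 := classEnd_le (κ := κ) (ν := ν) p
  have h3 := classCut_le_classEnd hκ hν hP p
  have h4 := (lt_classCut_iff hκ hν hP ⟨rfl, rfl⟩).2 hp
  obtain ⟨p', hp'⟩ : ∃ p' : Fin r, (p' : ℕ) = p + (classEnd κ ν p - classCut κ ν P p) :=
    ⟨⟨p + (classEnd κ ν p - classCut κ ν P p), by omega⟩, rfl⟩
  have hc := (mem_class_iff hκ hν p p').1 ⟨by omega, by omega⟩
  refine ⟨p', by rw [slideDown_val, hp'], by omega, hc.1, hc.2, ?_⟩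
  have hr := reflectRow_class hκ hν p'
  rw [hP', ← lt_classCut_iff hκ hν hP (p := p) ⟨hr.1.trans hc.1, hr.2.trans hc.2⟩]
  have h5 := classLo_le_classCut hκ hν hP p
  simp only [reflectRow]
  rw [(class_congr hc).1, (class_congr hc).2]
  omega

theorem strictMonoOn_slideDown (hκ : Antitone κ) (hν : Antitone ν) (hP : IsUpper κ ν P) :
    StrictMonoOn (slideDown κ ν P) (rowSet P : Set ℕ) := by
  intro a ha b hb hab
  obtain ⟨p, hp, rfl⟩ := exists_of_mem_rowSet (Finset.mem_coe.1 ha)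
  obtain ⟨q, hq, rfl⟩ := exists_of_mem_rowSet (Finset.mem_coe.1 hb)
  rw [slideDown_val, slideDown_val]
  by_cases h : κ q = κ p ∧ ν q = ν p
  · rw [(class_congr h).2, classCut_congr h]; omega
  · have h4 := (lt_classCut_iff hκ hν hP ⟨rfl, rfl⟩).2 hp
    have h3 := classCut_le_classEnd hκ hν hP p
    have h1 := classLo_le hκ hν p
    rw [← mem_class_iff hκ hν] at h
    omega

theorem card_rowSet_reflect (hκ : Antitone κ) (hν : Antitone ν)
    {P' : Fin r → Prop} [DecidablePred P'] (hP' : ∀ k, P' k ↔ P (reflectRow hκ hν k)) :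
    (rowSet P').card = (rowSet P).card := by
  rw [rowSet, rowSet, Finset.card_map, Finset.card_map]
  refine Finset.card_equiv (reflectPerm hκ hν) fun k => ?_
  simp [hP', reflectPerm]

theorem slideDown_mem (hκ : Antitone κ) (hν : Antitone ν) (hP : IsUpper κ ν P)
    {P' : Fin r → Prop} [DecidablePred P'] (hP' : ∀ k, P' k ↔ P (reflectRow hκ hν k)) :
    ∀ k ∈ rowSet P, slideDown κ ν P k ∈ rowSet P' := by
  intro k hk
  obtain ⟨p, hp, rfl⟩ := exists_of_mem_rowSet hk
  obtain ⟨p', h, -, -, -, h'⟩ := exists_slideDown_eq hκ hν hP hP' hp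
  rw [h]
  exact val_mem_rowSet.2 h'

/-- The translation preserves order, both within and between classes, so it matches elements with
the same number. This describes the motion of an individual bullet, whereas the reflection only
describes sets. -/
theorem exists_fromBottom_slide (hκ : Antitone κ) (hν : Antitone ν) (hP : IsUpper κ ν P)
    {P' : Fin r → Prop} [DecidablePred P'] (hP' : ∀ k, P' k ↔ P (reflectRow hκ hν k)) {a : ℕ}
    (ha : a < (rowSet P).card) :
    ∃ p p' : Fin r, fromBottom (rowSet P) a = p ∧ fromBottom (rowSet P') a = p' ∧ P p ∧ P' p' ∧
      κ p' = κ p ∧ ν p' = ν p ∧ (p' : ℕ) + classCut κ ν P p = p + classEnd κ ν p := by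
  obtain ⟨p, hp, hpa⟩ := exists_of_mem_rowSet (fromBottom_mem _ ha)
  obtain ⟨p', h, h1, h2, h3, h4⟩ := exists_slideDown_eq hκ hν hP hP' hp
  refine ⟨p, p', hpa.symm, ?_, hp, h4, h2, h3, h1⟩
  rw [fromBottom_of_strictMonoOn (card_rowSet_reflect hκ hν hP') (slideDown_mem hκ hν hP hP')
    (strictMonoOn_slideDown hκ hν hP) ha, ← hpa, h]

theorem exists_fromTop_slide (hκ : Antitone κ) (hν : Antitone ν) (hP : IsUpper κ ν P)
    {P' : Fin r → Prop} [DecidablePred P'] (hP' : ∀ k, P' k ↔ P (reflectRow hκ hν k)) {a : ℕ}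
    (ha : a < (rowSet P).card) :
    ∃ p p' : Fin r, fromTop (rowSet P) a = p ∧ fromTop (rowSet P') a = p' ∧ P p ∧ P' p' ∧
      κ p' = κ p ∧ ν p' = ν p ∧ (p' : ℕ) + classCut κ ν P p = p + classEnd κ ν p := by
  have hcard := card_rowSet_reflect hκ hν hP'
  obtain ⟨p, p', h⟩ := exists_fromBottom_slide hκ hν hP hP' (a := (rowSet P).card - 1 - a) (by omega)
  rw [fromTop_eq_fromBottom _ ha, fromTop_eq_fromBottom _ (hcard ▸ ha), hcard]
  exact ⟨p, p', h⟩

end Slide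

/-! ### Local rule squares -/

theorem exists_fin_val_eq {r n : ℕ} (h : n < r) : ∃ k : Fin r, (k : ℕ) = n := ⟨⟨n, h⟩, rfl⟩

/-- A local rule diagram with corners `x` (upper left), `ν` (upper right), `κ` (lower left) and `μ`
(lower right). -/
structure LocalSquare {r : ℕ} (c d : ℤ) (x ν κ μ : IntTuple r) : Prop where
  antitone_upperLeft : Antitone x
  antitone_upperRight : Antitone ν
  antitone_lowerLeft : Antitone κ
  left : SkewColumn c κ x
  top : SkewColumn d x ν
  rule : μ = localRule x ν κ

namespace LocalSquare

variable {r : ℕ} {c d : ℤ} {x ν κ μ : IntTuple r}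

theorem antitone_lowerRight (h : LocalSquare c d x ν κ μ) : Antitone μ := by
  rw [h.rule]; exact sortDesc_antitone _

theorem bottom (h : LocalSquare c d x ν κ μ) : SkewColumn d κ μ := by
  rw [h.rule]; exact (localRule_spec h.antitone_lowerLeft h.antitone_upperRight h.left h.top).2.1

theorem right (h : LocalSquare c d x ν κ μ) : SkewColumn c μ ν := by
  rw [h.rule]; exact (localRule_spec h.antitone_lowerLeft h.antitone_upperRight h.left h.top).2.2

/-- Reflection in the diagonal through the lower left and the upper right corner. -/
theorem antiTranspose (h : LocalSquare c d x ν κ μ) : LocalSquare d c μ ν κ x where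
  antitone_upperLeft := h.antitone_lowerRight
  antitone_upperRight := h.antitone_upperRight
  antitone_lowerLeft := h.antitone_lowerLeft
  left := h.bottom
  top := h.right
  rule := by
    rw [h.rule, localRule_localRule h.antitone_lowerLeft h.antitone_upperRight h.antitone_upperLeft
      h.left h.top]

theorem rotCompl (h : LocalSquare c d x ν κ μ) (m : ℤ) :
    LocalSquare (-c) (-d) (rotCompl m x) (rotCompl m ν) (rotCompl m κ) (rotCompl m μ) where
  antitone_upperLeft := rotCompl_antitone m h.antitone_upperLeft
  antitone_upperRight := rotCompl_antitone m h.antitone_upperRight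
  antitone_lowerLeft := rotCompl_antitone m h.antitone_lowerLeft
  left := h.left.rotCompl m
  top := h.top.rotCompl m
  rule := by rw [h.rule, localRule_rotCompl]

/-- Rotated complement, combined with the reflection in the diagonal through the upper left and the
lower right corner. -/
theorem complTranspose (h : LocalSquare c d x ν κ μ) (m : ℤ) :
    LocalSquare d c (_root_.rotCompl m x) (_root_.rotCompl m κ) (_root_.rotCompl m ν)
      (_root_.rotCompl m μ) where
  antitone_upperLeft := rotCompl_antitone m h.antitone_upperLeft
  antitone_upperRight := rotCompl_antitone m h.antitone_lowerLeft
  antitone_lowerLeft := rotCompl_antitone m h.antitone_upperRight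
  left := by simpa using (h.top.rotCompl m).neg
  top := by simpa using (h.left.rotCompl m).neg
  rule := by rw [h.rule, localRule_rotCompl, localRule_comm]

theorem reflect (h : LocalSquare c d x ν κ μ) (k : Fin r) :
    μ k = ν k + κ k - x (reflectRow h.antitone_lowerLeft h.antitone_upperRight k) :=
  (congrFun h.rule k).trans (congrFun (localRule_eq_reflect h.antitone_lowerLeft
    h.antitone_upperRight h.antitone_upperLeft h.left h.top) k)

/-- By `reflect`, the increment `ν - μ` in a row is the increment `x - κ` in the reflected row. -/
theorem right_iff (h : LocalSquare c d x ν κ μ) (k : Fin r) : μ k ≠ ν k ↔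
    κ (reflectRow h.antitone_lowerLeft h.antitone_upperRight k) ≠
      x (reflectRow h.antitone_lowerLeft h.antitone_upperRight k) := by
  have h1 := h.reflect k
  have h2 := reflectRow_class h.antitone_lowerLeft h.antitone_upperRight k
  rw [h2.1]
  omega

theorem bottom_iff (h : LocalSquare c d x ν κ μ) (k : Fin r) : κ k ≠ μ k ↔
    x (reflectRow h.antitone_lowerLeft h.antitone_upperRight k) ≠
      ν (reflectRow h.antitone_lowerLeft h.antitone_upperRight k) := by
  have h1 := h.reflect k
  have h2 := reflectRow_class h.antitone_lowerLeft h.antitone_upperRight k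
  rw [h2.2]
  omega

/-- On a class `κ` is constant and `x` decreases, so the rows where `x` exceeds `κ` come first. -/
theorem isUpper_left (h : LocalSquare c d x ν κ μ) (hc : 0 ≤ c) :
    IsUpper κ ν fun k => κ k ≠ x k := by
  intro j k hjk hκ _ hk
  have h1 := (h.left.cases k).1 hc
  have h2 := h.antitone_upperLeft hjk
  omega

theorem isUpper_top (h : LocalSquare c d x ν κ μ) (hd : d ≤ 0) :
    IsUpper κ ν fun k => x k ≠ ν k := by
  intro j k hjk _ hν hk
  have h1 := (h.top.cases k).2 hd
  have h2 := h.antitone_upperLeft hjk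
  omega

theorem bullet (h : LocalSquare c d x ν κ μ) (hc : 0 ≤ c) {a : ℕ} (ha : a < c.natAbs) :
    ∃ p p' : Fin r, bulletRow c κ x a = p ∧ bulletRow c μ ν a = p' ∧ κ p ≠ x p ∧ μ p' ≠ ν p' ∧
      κ p' = κ p ∧ ν p' = ν p ∧
      (p' : ℕ) + classCut κ ν (fun k => κ k ≠ x k) p = p + classEnd κ ν p := by
  rw [bulletRow, bulletRow, if_pos hc, if_pos hc]
  exact exists_fromBottom_slide h.antitone_lowerLeft h.antitone_upperRight (h.isUpper_left hc)
    h.right_iff (by rw [← h.left.card_changedRows] at ha; exact ha)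

/-- The antidiagonal reflection exchanges letters and bullets and reverses the direction of the
slide: a positive letter moves up. -/
theorem letter (h : LocalSquare c d x ν κ μ) (hd : 0 ≤ d) {b : ℕ} (hb : b < d.natAbs) :
    ∃ q q' : Fin r, letterRow d x ν b = q ∧ letterRow d κ μ b = q' ∧ x q ≠ ν q ∧ κ q' ≠ μ q' ∧
      κ q' = κ q ∧ ν q' = ν q ∧
      (q : ℕ) + classCut κ ν (fun k => κ k ≠ μ k) q = q' + classEnd κ ν q := by
  rw [letterRow, letterRow, if_pos hd, if_pos hd]
  obtain ⟨q', q, h1, h2, h3, h4, h5, h6, h7⟩ := exists_fromTop_slide h.antitone_lowerLeft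
    h.antitone_upperRight (h.antiTranspose.isUpper_left hd) h.antiTranspose.right_iff
    (a := b) (by rw [← h.bottom.card_changedRows] at hb; exact hb)
  refine ⟨q, q', h2, h1, h4, h3, h5.symm, h6.symm, ?_⟩
  rw [classCut_congr ⟨h5, h6⟩, (class_congr ⟨h5, h6⟩).2]
  exact h7

theorem letter_of_nonpos (h : LocalSquare c d x ν κ μ) (hd : d ≤ 0) {b : ℕ} (hb : b < d.natAbs) :
    ∃ q q' : Fin r, letterRow d x ν b = q ∧ letterRow d κ μ b = q' ∧ x q ≠ ν q ∧ κ q' ≠ μ q' ∧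
      κ q' = κ q ∧ ν q' = ν q ∧
      (q' : ℕ) + classCut κ ν (fun k => x k ≠ ν k) q = q + classEnd κ ν q := by
  rw [letterRow, letterRow, if_neg (by omega), if_neg (by omega)]
  exact exists_fromBottom_slide h.antitone_lowerLeft h.antitone_upperRight (h.isUpper_top hd)
    h.bottom_iff (by rw [← h.top.card_changedRows] at hb; exact hb)

/-- In a class in which every row changes exactly once, and which contains both a bullet `p` and
a letter `q`, the cut between bullets and letters is determined by `x` alone. -/
theorem classCut_eq_card (h : LocalSquare c d x ν κ μ) (hc : 0 ≤ c) {p q : Fin r}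
    (hp : κ p ≠ x p) (hq : κ q = x q) (hκ : κ q = κ p) (hν : ν q = ν p) :
    classCut κ ν (fun k => κ k ≠ x k) p = (Finset.univ.filter fun k => κ p < x k).card := by
  have hK := h.antitone_lowerLeft
  have hN := h.antitone_upperRight
  have hU := h.isUpper_left hc
  have hlt := fun k : Fin r => lt_card_filter_iff (fun k => κ p < x k)
    (fun _ _ hjk hk => hk.trans_le (h.antitone_upperLeft hjk)) k
  have hp1 := (lt_classCut_iff hK hN hU (p := p) ⟨rfl, rfl⟩).2 hp
  have hq1 := mt (lt_classCut_iff hK hN hU (p := p) ⟨hκ, hν⟩).1 (not_not.2 hq)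
  have hlo := classLo_le hK hN p
  have hend := ((mem_class_iff hK hN p q).2 ⟨hκ, hν⟩).2
  have hqr := q.isLt
  apply le_antisymm
  · obtain ⟨k, hk⟩ := exists_fin_val_eq (r := r) (n := classCut κ ν (fun k => κ k ≠ x k) p - 1) (by omega)
    have hcl := (mem_class_iff hK hN p k).1 ⟨by omega, by omega⟩
    have h1 := (lt_classCut_iff hK hN hU hcl).1 (by omega)
    have h2 := (h.left.cases k).1 hc
    have := (hlt k).2 (by omega)
    omega
  · obtain ⟨k, hk⟩ := exists_fin_val_eq (r := r) (n := classCut κ ν (fun k => κ k ≠ x k) p) (by omega)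
    have hcl := (mem_class_iff hK hN p k).1 ⟨by omega, by omega⟩
    have h1 := mt (lt_classCut_iff hK hN hU hcl).2 (by omega)
    have := mt (hlt k).1 (by omega)
    omega

/-- A bullet and a letter swap if and only if they lie in the same class, and no row of this class
changes twice. -/
theorem swap_iff (h : LocalSquare c d x ν κ μ) (hc : 0 ≤ c) (hd : 0 ≤ d) {p p' q q' : Fin r}
    (hp : κ p ≠ x p) (hp' : μ p' ≠ ν p') (hpκ : κ p' = κ p) (hpν : ν p' = ν p)
    (hpc : (p' : ℕ) + classCut κ ν (fun k => κ k ≠ x k) p = p + classEnd κ ν p)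
    (hq : x q ≠ ν q) (hq' : κ q' ≠ μ q') (hqκ : κ q' = κ q) (hqν : ν q' = ν q)
    (hqc : (q : ℕ) + classCut κ ν (fun k => κ k ≠ μ k) q = q' + classEnd κ ν q) :
    ((p : ℕ) < q ∧ (q' : ℕ) < p') ↔ κ p = κ q ∧ ν p = κ p + 1 ∧ ν q = κ q + 1 := by
  have hK := h.antitone_lowerLeft
  have hN := h.antitone_upperRight
  have hU := h.isUpper_left hc
  have hU' := h.antiTranspose.isUpper_left hd
  have hxp := (h.left.cases p).1 hc
  have hxq := (h.left.cases q).1 hc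
  have hyp := (h.top.cases p).1 hd
  have hyq := (h.top.cases q).1 hd
  constructor
  · rintro ⟨h1, h2⟩
    have a1 := hK (Fin.le_def.2 h1.le)
    have a2 := hN (Fin.le_def.2 h1.le)
    have a3 := hK (Fin.le_def.2 h2.le)
    have a4 := hN (Fin.le_def.2 h2.le)
    have e1 : κ q = κ p := by omega
    have e2 : ν q = ν p := by omega
    -- If the class gained two cells per row, every row would hold both a bullet and a letter, and
    -- nothing in the class could move.
    suffices ν p ≠ κ p + 2 by omega
    intro h3
    have hend := ((mem_class_iff hK hN p q).2 ⟨e1, e2⟩).2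
    have hlo := classLo_le hK hN p
    have hb1 := classCut_le_classEnd hK hN hU p
    have hb2 := classLo_le_classCut hK hN hU p
    have hb1' := classCut_le_classEnd hK hN hU' p
    have hb2' := classLo_le_classCut hK hN hU' p
    have hr := classEnd_le (κ := κ) (ν := ν) p
    have c1 : classCut κ ν (fun k => κ k ≠ x k) p = classEnd κ ν p := by
      by_contra hne
      obtain ⟨k, hk⟩ := exists_fin_val_eq (r := r) (n := classCut κ ν (fun k => κ k ≠ x k) p) (by omega)
      have hcl := (mem_class_iff hK hN p k).1 ⟨by omega, by omega⟩
      have h4 := mt (lt_classCut_iff hK hN hU hcl).2 (by omega)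
      have h5 := (h.top.cases k).1 hd
      omega
    have c2 : classCut κ ν (fun k => κ k ≠ μ k) p = classEnd κ ν p := by
      by_contra hne
      obtain ⟨k, hk⟩ := exists_fin_val_eq (r := r) (n := classCut κ ν (fun k => κ k ≠ μ k) p) (by omega)
      have hcl := (mem_class_iff hK hN p k).1 ⟨by omega, by omega⟩
      have h4 := mt (lt_classCut_iff hK hN hU' hcl).2 (by omega)
      have h5 := (h.right.cases k).1 hc
      omega
    rw [classCut_congr ⟨e1, e2⟩, (class_congr ⟨e1, e2⟩).2] at hqc
    omega
  · rintro ⟨h1, h2, h3⟩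
    have hcl : κ q = κ p ∧ ν q = ν p := ⟨h1.symm, by omega⟩
    have b1 := (lt_classCut_iff hK hN hU (p := p) ⟨rfl, rfl⟩).2 hp
    have b2 := mt (lt_classCut_iff hK hN hU hcl).1 (by omega)
    have hrp := (h.right.cases p').1 hc
    have hbq := (h.bottom.cases q').1 hd
    have hbp := (h.bottom.cases p').1 hd
    have b3 := (lt_classCut_iff hK hN hU' (p := p) ⟨hqκ.trans hcl.1, hqν.trans hcl.2⟩).2 hq'
    have b4 := mt (lt_classCut_iff hK hN hU' (p := p) ⟨hpκ, hpν⟩).1 (by omega)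
    omega

/-- The local rule grid for two positive steps. -/
theorem mem_grid_iff (h : LocalSquare c d x ν κ μ) (hc : 0 ≤ c) (hd : 0 ≤ d) {a b : ℕ}
    (ha : a < c.natAbs) (hb : b < d.natAbs) (i : ℕ) : ∃ p q : Fin r,
      bulletRow c κ x a = p ∧ letterRow d x ν b = q ∧ κ p ≠ x p ∧ x q ≠ ν q ∧
      (i ∈ localRuleGrid c d x ν κ μ a b ↔ κ p = κ q ∧ ν p = κ p + 1 ∧ ν q = κ q + 1 ∧
        i + (Finset.univ.filter fun k => κ p < x k).card = p + q + 1) := by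
  obtain ⟨p, p', hpa, hpa', hp, hp', hpκ, hpν, hpc⟩ := h.bullet hc ha
  obtain ⟨q, q', hqb, hqb', hq, hq', hqκ, hqν, hqc⟩ := h.letter hd hb
  refine ⟨p, q, hpa, hqb, hp, hq, ?_⟩
  have hK := h.antitone_lowerLeft
  have hN := h.antitone_upperRight
  have hU := h.isUpper_left hc
  simp only [localRuleGrid, if_pos (And.intro hc hd), hpa, hpa', hqb, hqb',
    h.swap_iff hc hd hp hp' hpκ hpν hpc hq hq' hqκ hqν hqc]
  by_cases hs : κ p = κ q ∧ ν p = κ p + 1 ∧ ν q = κ q + 1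
  swap
  · rw [if_neg hs]
    simp only [Finset.notMem_empty, false_iff]
    tauto
  rw [if_pos hs, Finset.mem_singleton]
  obtain ⟨h1, h2, h3⟩ := hs
  simp only [h1, h2, h3, true_and]
  have hxq := (h.left.cases q).1 hc
  have hyq := (h.top.cases q).1 hd
  have hcut := h.classCut_eq_card hc (p := p) (q := q) hp (by omega) h1.symm (by omega)
  rw [← h1, ← hcut]
  have hpt := (lt_classCut_iff hK hN hU (p := p) ⟨rfl, rfl⟩).2 hp
  have hqt := mt (lt_classCut_iff hK hN hU (p := p) (k := q) ⟨h1.symm, by omega⟩).1 (by omega)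
  have hlo := classLo_le hK hN p
  have hend := ((mem_class_iff hK hN p q).2 ⟨h1.symm, by omega⟩).2
  have hcardB : (changedRows x ν).card = d.natAbs := h.top.card_changedRows
  -- The swapping letters numbered up to `b` fill the rows from the cut of the class to `q`. So the
  -- entry, `p` plus their number, is `p + (q + 1 - cut)`.
  have hcount : ((Finset.range (b + 1)).filter fun b' => (p : ℕ) < letterRow d x ν b' ∧
      letterRow d κ μ b' < p').card + classCut κ ν (fun k => κ k ≠ x k) p = q + 1 := by
    have himage : ((Finset.range (b + 1)).filter fun b' => (p : ℕ) < letterRow d x ν b' ∧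
        letterRow d κ μ b' < p').image (letterRow d x ν) =
        Finset.Ico (classCut κ ν (fun k => κ k ≠ x k) p) (q + 1) := by
      ext k
      simp only [Finset.mem_image, Finset.mem_filter, Finset.mem_range, Finset.mem_Ico]
      constructor
      · rintro ⟨b', ⟨hb', hsw⟩, rfl⟩
        obtain ⟨s, s', hsb, hsb', hs, hs', hsκ, hsν, hsc⟩ :=
          h.letter hd (b := b') (by omega)
        rw [hsb, hsb', h.swap_iff hc hd hp hp' hpκ hpν hpc hs hs' hsκ hsν hsc] at hsw
        have hys := (h.top.cases s).1 hd
        have hst := mt (lt_classCut_iff hK hN hU (p := p) (k := s) ⟨hsw.1.symm, by omega⟩).1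
          (by omega)
        have hle := fromTop_lt_iff (changedRows x ν) (a := b) (b := b') (by omega) (by omega)
        rw [letterRow, if_pos hd] at hqb hsb
        rw [letterRow, if_pos hd]
        omega
      · rintro ⟨hk1, hk2⟩
        obtain ⟨s, rfl⟩ : ∃ s : Fin r, (s : ℕ) = k := ⟨⟨k, by omega⟩, rfl⟩
        have hcl := (mem_class_iff hK hN p s).1 ⟨by omega, by omega⟩
        have hns := mt (lt_classCut_iff hK hN hU hcl).2 (by omega)
        obtain ⟨b', hb', hbs⟩ := exists_fromTop_eq ((val_mem_changedRows (μ := x) (ν := ν)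
          (p := s)).2 (by omega))
        have hsb : letterRow d x ν b' = s := by rw [letterRow, if_pos hd, hbs]
        obtain ⟨u, s', hub, hsb', hs, hs', hsκ, hsν, hsc⟩ :=
          h.letter hd (b := b') (by omega)
        obtain rfl : u = s := Fin.ext (hub.symm.trans hsb)
        have hle := fromTop_lt_iff (changedRows x ν) (a := b) (b := b') (by omega) (by omega)
        refine ⟨b', ⟨?_, ?_⟩, hsb⟩
        · rw [letterRow, if_pos hd] at hqb
          omega
        · rw [hsb, hsb', h.swap_iff hc hd hp hp' hpκ hpν hpc hs hs' hsκ hsν hsc]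
          omega
    rw [← Finset.card_image_of_injOn (f := letterRow d x ν), himage, Nat.card_Ico]
    · omega
    · intro b₁ hb₁ b₂ hb₂ he
      simp only [Finset.coe_filter, Finset.mem_range, Set.mem_ofPred_eq] at hb₁ hb₂
      simp only [letterRow, if_pos hd] at he
      exact fromTop_inj _ (by omega) (by omega) he
  omega

end LocalSquare

/-! ### Symmetries of local rule grids -/

section Rows

variable {r : ℕ} {c : ℤ} {μ ν : IntTuple r} {a : ℕ}

theorem bulletRow_lt (h : SkewColumn c μ ν) (ha : a < c.natAbs) : bulletRow c μ ν a < r := by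
  rw [← h.card_changedRows] at ha
  rw [bulletRow]
  split_ifs
  · obtain ⟨p, -, hp⟩ := mem_changedRows.1 (fromBottom_mem _ ha)
    omega
  · obtain ⟨p, -, hp⟩ := mem_changedRows.1 (fromTop_mem _ ha)
    omega

theorem letterRow_eq_bulletRow (h : SkewColumn c μ ν) (ha : a < c.natAbs) :
    letterRow c μ ν a = bulletRow c μ ν (c.natAbs - 1 - a) := by
  rw [bulletRow, letterRow, ← h.card_changedRows]
  rw [← h.card_changedRows] at ha
  split_ifs
  · exact fromTop_eq_fromBottom _ ha
  · exact fromBottom_eq_fromTop _ ha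

theorem bulletRow_eq_letterRow (h : SkewColumn c μ ν) (ha : a < c.natAbs) :
    bulletRow c μ ν a = letterRow c μ ν (c.natAbs - 1 - a) := by
  rw [letterRow_eq_bulletRow h (by omega)]
  congr 1
  omega

theorem letterRow_lt (h : SkewColumn c μ ν) (ha : a < c.natAbs) : letterRow c μ ν a < r := by
  rw [letterRow_eq_bulletRow h ha]
  exact bulletRow_lt h (by omega)

theorem bulletRow_neg_rotCompl (m : ℤ) (h : SkewColumn c μ ν) (ha : a < c.natAbs) :
    bulletRow (-c) (rotCompl m μ) (rotCompl m ν) a = r - 1 - bulletRow c μ ν a := by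
  have hc : c ≠ 0 := by rintro rfl; simp at ha
  rw [← h.card_changedRows] at ha
  rw [bulletRow, bulletRow]
  by_cases h0 : 0 ≤ c
  · rw [if_neg (by omega), if_pos h0, fromTop_rotCompl m μ ν ha]
  · rw [if_pos (by omega), if_neg h0, fromBottom_rotCompl m μ ν ha]

theorem letterRow_neg_rotCompl (m : ℤ) (h : SkewColumn c μ ν) (ha : a < c.natAbs) :
    letterRow (-c) (rotCompl m μ) (rotCompl m ν) a = r - 1 - letterRow c μ ν a := by
  rw [letterRow_eq_bulletRow h ha, letterRow_eq_bulletRow (h.rotCompl m) (by simpa using ha),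
    Int.natAbs_neg, bulletRow_neg_rotCompl m h (by omega)]

theorem bulletRow_rotCompl (m : ℤ) (h : SkewColumn c μ ν) (ha : a < c.natAbs) :
    bulletRow c (rotCompl m ν) (rotCompl m μ) a = r - 1 - letterRow c μ ν a := by
  rw [← h.card_changedRows] at ha
  rw [bulletRow, letterRow, changedRows_comm]
  split_ifs
  · exact fromBottom_rotCompl m μ ν ha
  · exact fromTop_rotCompl m μ ν ha

theorem letterRow_rotCompl (m : ℤ) (h : SkewColumn c μ ν) (ha : a < c.natAbs) :
    letterRow c (rotCompl m ν) (rotCompl m μ) a = r - 1 - bulletRow c μ ν a := by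
  rw [← h.card_changedRows] at ha
  rw [bulletRow, letterRow, changedRows_comm]
  split_ifs
  · exact fromTop_rotCompl m μ ν ha
  · exact fromBottom_rotCompl m μ ν ha

end Rows

theorem mem_localRuleGrid_of_pos_of_neg {r : ℕ} {c d : ℤ} {x ν κ μ : IntTuple r} {a b i : ℕ}
    (hc : 0 < c) (hd : d < 0) : i ∈ localRuleGrid c d x ν κ μ a b ↔
      bulletRow c κ x a = letterRow d x ν b ∧ bulletRow c μ ν a = letterRow d κ μ b ∧
        bulletRow c κ x a < i ∧ i ≤ bulletRow c μ ν a := by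
  simp only [localRuleGrid]
  rw [if_neg (by omega), if_neg (by omega), if_pos hc.le]
  split_ifs with h
  · simp [h]
  · simp only [Finset.notMem_empty, false_iff]; tauto

theorem mem_localRuleGrid_of_neg_of_pos {r : ℕ} {c d : ℤ} {x ν κ μ : IntTuple r} {a b i : ℕ}
    (hc : c < 0) (hd : 0 < d) : i ∈ localRuleGrid c d x ν κ μ a b ↔
      bulletRow c κ x a = letterRow d x ν b ∧ bulletRow c μ ν a = letterRow d κ μ b ∧
        bulletRow c μ ν a < i ∧ i ≤ bulletRow c κ x a := by
  simp only [localRuleGrid]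
  rw [if_neg (show ¬(0 ≤ c ∧ 0 ≤ d) by omega), if_neg (show ¬(c ≤ 0 ∧ d ≤ 0) by omega),
    if_neg (show ¬ 0 ≤ c by omega)]
  split_ifs with h
  · simp [h]
  · simp only [Finset.notMem_empty, false_iff]; tauto

namespace LocalSquare

variable {r : ℕ} {c d : ℤ} {x ν κ μ : IntTuple r} {a b : ℕ}

/-- Row `k` becomes row `r - 1 - k`. The missing unit in `r - i` comes from reading a bullet after
its swap but a barred bullet before it; for opposite signs it comes from the half-open intervals. -/
theorem mem_grid_rotCompl_of_pos (h : LocalSquare c d x ν κ μ) (m : ℤ) (ha : a < c.natAbs)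
    (hb : b < d.natAbs) {i : ℕ} (hi : i ≤ r) (hc : 0 < c) :
    i ∈ localRuleGrid (-c) (-d) (_root_.rotCompl m x) (_root_.rotCompl m ν) (_root_.rotCompl m κ)
      (_root_.rotCompl m μ) a b ↔ r - i ∈ localRuleGrid c d x ν κ μ a b := by
  have e1 := bulletRow_neg_rotCompl m h.left ha
  have e2 := bulletRow_neg_rotCompl m h.right ha
  have e3 := fun {b'} hb' => letterRow_neg_rotCompl m h.top (a := b') hb'
  have e4 := fun {b'} hb' => letterRow_neg_rotCompl m h.bottom (a := b') hb'
  have l1 := bulletRow_lt h.left ha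
  have l2 := bulletRow_lt h.right ha
  have l3 := fun {b'} hb' => letterRow_lt h.top (a := b') hb'
  have l4 := fun {b'} hb' => letterRow_lt h.bottom (a := b') hb'
  have hd0 : d ≠ 0 := by rintro rfl; simp at hb
  rcases lt_or_gt_of_ne hd0 with hd | hd
  · rw [mem_localRuleGrid_of_pos_of_neg hc hd, mem_localRuleGrid_of_neg_of_pos (by omega) (by omega),
      e1, e2, e3 hb, e4 hb]
    have := l3 hb
    have := l4 hb
    omega
  · obtain ⟨p, q, hp, hq, hpx, -, hmem⟩ := h.mem_grid_iff hc.le hd.le ha hb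
      (bulletRow c κ x a + ((Finset.range (b + 1)).filter fun b' =>
        bulletRow c κ x a < letterRow d x ν b' ∧ letterRow d κ μ b' < bulletRow c μ ν a).card)
    simp only [localRuleGrid] at hmem ⊢
    rw [if_pos ⟨hc.le, hd.le⟩] at hmem
    rw [if_pos (show 0 ≤ c ∧ 0 ≤ d by omega), if_neg (show ¬(0 ≤ -c ∧ 0 ≤ -d) by omega),
      if_pos (show -c ≤ 0 ∧ -d ≤ 0 by omega), e1, e2, e3 hb, e4 hb]
    have := l3 hb
    have := l4 hb
    by_cases hs : bulletRow c κ x a < letterRow d x ν b ∧ letterRow d κ μ b < bulletRow c μ ν a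
    · rw [if_pos hs, if_pos (by omega)]
      rw [if_pos hs, Finset.mem_singleton] at hmem
      replace hmem := hmem.1 rfl
      have hcard : ((Finset.range b).filter fun b' => letterRow (-d) (_root_.rotCompl m x)
          (_root_.rotCompl m ν) b' < r - 1 - bulletRow c κ x a ∧ r - 1 - bulletRow c μ ν a <
          letterRow (-d) (_root_.rotCompl m κ) (_root_.rotCompl m μ) b') =
          (Finset.range b).filter fun b' =>
            bulletRow c κ x a < letterRow d x ν b' ∧ letterRow d κ μ b' < bulletRow c μ ν a := by
        refine Finset.filter_congr fun b' hb' => ?_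
        have hb'' : b' < d.natAbs := (Finset.mem_range.1 hb').trans hb
        rw [e3 hb'', e4 hb'']
        have := l3 hb''
        have := l4 hb''
        omega
      rw [hcard, Finset.mem_singleton, Finset.mem_singleton]
      -- Since `p` lies above the cut, the entry is at most `q < r`, and the subtractions do not
      -- truncate.
      have hpt := (lt_card_filter_iff (fun k => κ p < x k)
        (fun _ _ hjk hk => hk.trans_le (h.antitone_upperLeft hjk)) p).2
        (by have := (h.left.cases p).1 hc.le; omega)
      have hrange : ((Finset.range (b + 1)).filter fun b' =>
          bulletRow c κ x a < letterRow d x ν b' ∧ letterRow d κ μ b' < bulletRow c μ ν a).card =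
          ((Finset.range b).filter fun b' => bulletRow c κ x a < letterRow d x ν b' ∧
            letterRow d κ μ b' < bulletRow c μ ν a).card + 1 := by
        rw [Finset.range_add_one, Finset.filter_insert, if_pos hs,
          Finset.card_insert_of_notMem (by simp)]
      have := q.isLt
      rw [hrange] at hmem ⊢
      omega
    · rw [if_neg hs, if_neg (by omega)]
      simp

/-- Rotating all corners by 180 degrees and taking complements turns `i` into `r - i` in the
local rule grid. -/
theorem mem_grid_rotCompl (h : LocalSquare c d x ν κ μ) (m : ℤ) (ha : a < c.natAbs)
    (hb : b < d.natAbs) {i : ℕ} (hi : i ≤ r) :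
    i ∈ localRuleGrid (-c) (-d) (_root_.rotCompl m x) (_root_.rotCompl m ν) (_root_.rotCompl m κ)
      (_root_.rotCompl m μ) a b ↔ r - i ∈ localRuleGrid c d x ν κ μ a b := by
  have hc0 : c ≠ 0 := by rintro rfl; simp at ha
  rcases lt_or_gt_of_ne hc0 with hc | hc
  · have := (h.rotCompl m).mem_grid_rotCompl_of_pos m (a := a) (b := b) (by simpa using ha)
      (by simpa using hb) (i := r - i) (by omega) (by omega)
    simp only [neg_neg, rotCompl_rotCompl] at this
    rw [this, Nat.sub_sub_self hi]
  · exact h.mem_grid_rotCompl_of_pos m ha hb hi hc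

/-- Letters swapping with bullet `a` occupy the rows from the cut to the end of its class, and give
the consecutive entries `p + 1, …, p'`. The difference of indicators is the form that telescopes
along a strip. -/
theorem sum_grid_of_nonneg (h : LocalSquare c d x ν κ μ) (hc : 0 ≤ c) (hd : 0 ≤ d)
    (ha : a < c.natAbs) (i : ℕ) :
    (∑ b ∈ Finset.range d.natAbs, if i ∈ localRuleGrid c d x ν κ μ a b then 1 else 0 : ℤ) =
      (if i ≤ bulletRow c μ ν a then 1 else 0) - (if i ≤ bulletRow c κ x a then 1 else 0) := by
  obtain ⟨p, p', hpa, hpa', hp, hp', hpκ, hpν, hpc⟩ := h.bullet hc ha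
  have hK := h.antitone_lowerLeft
  have hN := h.antitone_upperRight
  have hU := h.isUpper_left hc
  have hle := classCut_le_classEnd hK hN hU p
  have hend := classEnd_le (κ := κ) (ν := ν) p
  have hpt := (lt_classCut_iff hK hN hU (p := p) ⟨rfl, rfl⟩).2 hp
  have hlo := classLo_le hK hN p
  have hxp := (h.left.cases p).1 hc
  have hmem : ∀ b < d.natAbs, i ∈ localRuleGrid c d x ν κ μ a b ↔
      classCut κ ν (fun k => κ k ≠ x k) p ≤ letterRow d x ν b ∧
        letterRow d x ν b < classEnd κ ν p ∧
        i + classCut κ ν (fun k => κ k ≠ x k) p = p + letterRow d x ν b + 1 := by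
    intro b hb
    obtain ⟨p₁, q, hp₁, hq, -, hqx, hi⟩ := h.mem_grid_iff hc hd ha hb i
    obtain rfl : p₁ = p := Fin.ext (hp₁.symm.trans hpa)
    rw [hi, hq]
    have hxq := (h.left.cases q).1 hc
    have hyq := (h.top.cases q).1 hd
    constructor
    · rintro ⟨h1, h2, h3, h4⟩
      have hcut := h.classCut_eq_card hc (p := p₁) (q := q) hp (by omega) h1.symm (by omega)
      have h5 := mt (lt_classCut_iff hK hN hU (p := p₁) (k := q) ⟨h1.symm, by omega⟩).1 (by omega)
      have h6 := ((mem_class_iff hK hN p₁ q).2 ⟨h1.symm, by omega⟩).2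
      omega
    · rintro ⟨h1, h2, h3⟩
      have hcl := (mem_class_iff hK hN p₁ q).1 ⟨by omega, h2⟩
      have h5 := mt (lt_classCut_iff hK hN hU hcl).2 (by omega)
      have hyp := (h.top.cases p₁).1 hd
      have hcut := h.classCut_eq_card hc (p := p₁) (q := q) hp (by omega) hcl.1 hcl.2
      omega
  rw [hpa, hpa']
  by_cases hi : (p : ℕ) < i ∧ i ≤ p'
  · rw [if_pos hi.2, if_neg (by omega)]
    obtain ⟨q, hq⟩ := exists_fin_val_eq (r := r)
      (n := i + classCut κ ν (fun k => κ k ≠ x k) p - p - 1) (by omega)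
    have hcl := (mem_class_iff hK hN p q).1 ⟨by omega, by omega⟩
    have h5 := mt (lt_classCut_iff hK hN hU hcl).2 (by omega)
    have hyp := (h.top.cases p).1 hd
    obtain ⟨b, hb, hbq⟩ := exists_fromTop_eq ((val_mem_changedRows (μ := x) (ν := ν) (p := q)).2
      (by
        intro hxν
        have hle' : (p : ℕ) ≤ q := by omega
        have := h.antitone_upperLeft (Fin.le_def.2 hle')
        omega))
    rw [h.top.card_changedRows] at hb
    have hlb : letterRow d x ν b = q := by rw [letterRow, if_pos hd, hbq]
    rw [Finset.sum_eq_single_of_mem b (Finset.mem_range.2 hb), if_pos]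
    · norm_num
    · rw [hmem b hb]; omega
    · intro b' hb' hne
      rw [Finset.mem_range] at hb'
      rw [if_neg]
      rw [hmem b' hb']
      intro hh
      refine hne (fromTop_inj (changedRows x ν) (by rw [h.top.card_changedRows]; exact hb')
        (by rw [h.top.card_changedRows]; exact hb) ?_)
      rw [letterRow, if_pos hd] at hh
      omega
  · rw [Finset.sum_eq_zero]
    · split_ifs <;> omega
    · intro b hb
      rw [if_neg]
      rw [hmem b (Finset.mem_range.1 hb)]
      omega

/-- A bullet is either paired with a barred letter in its cell, and the pair slides together, giving
one interval; or it is unpaired and stays in place. -/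
theorem sum_grid_of_pos_of_neg (h : LocalSquare c d x ν κ μ) (hc : 0 < c) (hd : d < 0)
    (ha : a < c.natAbs) (i : ℕ) :
    (∑ b ∈ Finset.range d.natAbs, if i ∈ localRuleGrid c d x ν κ μ a b then 1 else 0 : ℤ) =
      (if i ≤ bulletRow c μ ν a then 1 else 0) - (if i ≤ bulletRow c κ x a then 1 else 0) := by
  obtain ⟨p, p', hpa, hpa', hp, hp', hpκ, hpν, hpc⟩ := h.bullet hc.le ha
  have hK := h.antitone_lowerLeft
  have hN := h.antitone_upperRight
  have hU := h.isUpper_left hc.le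
  have hle := classCut_le_classEnd hK hN hU p
  have hxp := (h.left.cases p).1 hc.le
  have hyp := (h.top.cases p).2 hd.le
  simp only [mem_localRuleGrid_of_pos_of_neg hc hd, hpa, hpa']
  by_cases hpB : x p ≠ ν p
  · obtain ⟨b, hb, hbp⟩ := exists_fromBottom_eq ((val_mem_changedRows (μ := x) (ν := ν)
      (p := p)).2 hpB)
    rw [h.top.card_changedRows] at hb
    obtain ⟨q, q', hqb, hqb', -, -, -, -, hqc⟩ := h.letter_of_nonpos hd.le hb
    have hlb : letterRow d x ν b = p := by rw [letterRow, if_neg (by omega), hbp]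
    obtain rfl : q = p := Fin.ext (hqb.symm.trans hlb)
    -- In the class of a pair `κ = ν`, so bullets and barred letters occupy the same rows there.
    have hcut : classCut κ ν (fun k => κ k ≠ x k) q = classCut κ ν (fun k => x k ≠ ν k) q := by
      simp only [classCut]
      congr 1
      refine Finset.filter_congr fun k _ => ?_
      by_cases hk : (k : ℕ) < classLo κ ν q
      · simp [hk]
      · by_cases hk' : (k : ℕ) < classEnd κ ν q
        · have hcl := (mem_class_iff hK hN q k).1 ⟨by omega, by omega⟩
          have : κ k = ν k := by omega
          rw [this]
          simp only [ne_comm]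
        · simp [hk']
    rw [Finset.sum_eq_single_of_mem b (Finset.mem_range.2 hb)]
    · rw [hlb, hqb']
      by_cases h1 : i ≤ (p' : ℕ) <;> by_cases h2 : i ≤ (q : ℕ)
      · rw [if_neg (by omega), if_pos h1, if_pos h2]; norm_num
      · rw [if_pos (by omega), if_pos h1, if_neg h2]; norm_num
      · omega
      · rw [if_neg (by omega), if_neg h1, if_neg h2]; norm_num
    · intro b' hb' hne
      rw [Finset.mem_range] at hb'
      rw [if_neg]
      intro hh
      refine hne (fromBottom_inj (changedRows x ν) (by rw [h.top.card_changedRows]; exact hb')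
        (by rw [h.top.card_changedRows]; exact hb) ?_)
      rw [letterRow, if_neg (by omega)] at hh
      omega
  -- Without a partner `ν p = κ p + 1`, which forces every row of the class to hold a bullet; there
  -- is no room to slide.
  · have hpp : (p' : ℕ) = p := by
      suffices classCut κ ν (fun k => κ k ≠ x k) p = classEnd κ ν p by omega
      by_contra hne
      have hend := classEnd_le (κ := κ) (ν := ν) p
      have hlo := classLo_le_classCut hK hN hU p
      obtain ⟨k, hk⟩ := exists_fin_val_eq (r := r) (n := classCut κ ν (fun k => κ k ≠ x k) p)
        (by omega)
      have hcl := (mem_class_iff hK hN p k).1 ⟨by omega, by omega⟩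
      have h4 := mt (lt_classCut_iff hK hN hU hcl).2 (by omega)
      have h5 := (h.top.cases k).2 hd.le
      omega
    rw [hpp, sub_self]
    refine Finset.sum_eq_zero fun b _ => if_neg ?_
    omega

/-- In row `a` of the local rule grid, the numbers passed by the `a`-th bullet occur exactly once,
and no other number occurs. -/
theorem sum_grid (h : LocalSquare c d x ν κ μ) (ha : a < c.natAbs) {i : ℕ} (hi : i ≤ r) :
    (∑ b ∈ Finset.range d.natAbs, if i ∈ localRuleGrid c d x ν κ μ a b then 1 else 0 : ℤ) =
      c.sign * ((if i ≤ bulletRow c μ ν a then 1 else 0) -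
        (if i ≤ bulletRow c κ x a then 1 else 0)) := by
  have pos : ∀ {c d : ℤ} {x ν κ μ : IntTuple r}, LocalSquare c d x ν κ μ → a < c.natAbs →
      0 < c → ∀ i, (∑ b ∈ Finset.range d.natAbs,
        if i ∈ localRuleGrid c d x ν κ μ a b then 1 else 0 : ℤ) =
      (if i ≤ bulletRow c μ ν a then 1 else 0) - (if i ≤ bulletRow c κ x a then 1 else 0) := by
    intro c d x ν κ μ h ha hc i
    rcases lt_or_ge d 0 with hd | hd
    · exact h.sum_grid_of_pos_of_neg hc hd ha i
    · exact h.sum_grid_of_nonneg hc.le hd ha i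
  have hc0 : c ≠ 0 := by rintro rfl; simp at ha
  rcases lt_or_gt_of_ne hc0 with hc | hc
  -- The width of the complement is irrelevant, since grids only depend on the changed rows.
  · have := pos (h.rotCompl 0) (by simpa using ha) (by omega) (r - i)
    rw [Int.natAbs_neg, bulletRow_neg_rotCompl 0 h.left ha, bulletRow_neg_rotCompl 0 h.right ha] at this
    rw [Int.sign_eq_neg_one_of_neg hc]
    have l1 := bulletRow_lt h.left ha
    have l2 := bulletRow_lt h.right ha
    refine ((Finset.sum_congr rfl fun b hb => if_congr ?_ rfl rfl).trans this).trans ?_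
    · rw [h.mem_grid_rotCompl 0 ha (Finset.mem_range.1 hb) (by omega), Nat.sub_sub_self hi]
    split_ifs <;> omega
  · rw [Int.sign_eq_one_of_pos hc, one_mul]
    exact pos h ha hc i

/-- In the formula of `mem_grid_iff`, `p` and `q` turn into `r - 1 - p` and `r - 1 - q`, and the cut
into `r` minus the cut; so `i` turns into `r - i`. -/
theorem mem_grid_complTranspose_of_pos (h : LocalSquare c d x ν κ μ) (m : ℤ) (ha : a < c.natAbs)
    (hb : b < d.natAbs) {i : ℕ} (hi : i ≤ r) (hc : 0 < c) (hd : 0 < d) :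
    i ∈ localRuleGrid d c (_root_.rotCompl m x) (_root_.rotCompl m κ) (_root_.rotCompl m ν)
      (_root_.rotCompl m μ) b a ↔ r - i ∈ localRuleGrid c d x ν κ μ a b := by
  obtain ⟨p, q, hp, hq, hpx, hqx, hmem⟩ := h.mem_grid_iff hc.le hd.le ha hb (r - i)
  obtain ⟨q₁, p₁, hq₁, hp₁, -, -, hmem'⟩ := (h.complTranspose m).mem_grid_iff hd.le hc.le hb ha i
  rw [bulletRow_rotCompl m h.top hb, hq] at hq₁
  rw [letterRow_rotCompl m h.left ha, hp] at hp₁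
  obtain rfl : q₁ = q.rev := by ext; rw [Fin.val_rev]; omega
  obtain rfl : p₁ = p.rev := by ext; rw [Fin.val_rev]; omega
  rw [hmem, hmem']
  have hxp := (h.left.cases p).1 hc.le
  have hyq := (h.top.cases q).1 hd.le
  have hcount : ν q = κ p + 1 → (Finset.univ.filter fun k =>
      _root_.rotCompl m ν q.rev < _root_.rotCompl m x k).card +
      (Finset.univ.filter fun k => κ p < x k).card = r := by
    intro he
    have h1 : (Finset.univ.filter fun k =>
        _root_.rotCompl m ν q.rev < _root_.rotCompl m x k).card =
        (Finset.univ.filter fun k => ¬ κ p < x k).card := by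
      refine Finset.card_equiv Fin.revPerm fun k => ?_
      simp only [_root_.rotCompl, Fin.rev_rev, Finset.mem_filter, Finset.mem_univ, true_and,
        Fin.revPerm_apply]
      omega
    rw [h1, add_comm, Finset.card_filter_add_card_filter_not, Finset.card_univ, Fintype.card_fin]
  simp only [_root_.rotCompl, Fin.rev_rev, Fin.val_rev] at hcount ⊢
  have := p.isLt
  have := q.isLt
  have hpt := (lt_card_filter_iff (fun k => κ p < x k)
    (fun _ _ hjk hk => hk.trans_le (h.antitone_upperLeft hjk)) p).2 (by omega)
  constructor
  · rintro ⟨h1, h2, h3, h4⟩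
    have := hcount (by omega)
    refine ⟨by omega, by omega, by omega, by omega⟩
  · rintro ⟨h1, h2, h3, h4⟩
    have := hcount (by omega)
    refine ⟨by omega, by omega, by omega, by omega⟩

/-- The grid of the rotated complement of the transposed square is the transpose of the grid, with
`i` replaced by `r - i`. -/
theorem mem_grid_complTranspose (h : LocalSquare c d x ν κ μ) (m : ℤ) (ha : a < c.natAbs)
    (hb : b < d.natAbs) {i : ℕ} (hi : i ≤ r) :
    i ∈ localRuleGrid d c (_root_.rotCompl m x) (_root_.rotCompl m κ) (_root_.rotCompl m ν)
      (_root_.rotCompl m μ) b a ↔ r - i ∈ localRuleGrid c d x ν κ μ a b := by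
  have hc0 : c ≠ 0 := by rintro rfl; simp at ha
  have hd0 : d ≠ 0 := by rintro rfl; simp at hb
  have e1 := bulletRow_rotCompl m h.top hb
  have e2 := bulletRow_rotCompl m h.bottom hb
  have e3 := letterRow_rotCompl m h.left ha
  have e4 := letterRow_rotCompl m h.right ha
  have l1 := bulletRow_lt h.left ha
  have l2 := bulletRow_lt h.right ha
  have l3 := letterRow_lt h.top hb
  have l4 := letterRow_lt h.bottom hb
  rcases lt_or_gt_of_ne hc0 with hc | hc <;> rcases lt_or_gt_of_ne hd0 with hd | hd
  · have h1 := (h.complTranspose m).mem_grid_rotCompl m hb ha (i := r - i) (by omega)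
    have h2 := (h.rotCompl m).mem_grid_complTranspose_of_pos m (a := a) (b := b) (by simpa using ha)
      (by simpa using hb) (i := r - i) (by omega) (by omega) (by omega)
    rw [Nat.sub_sub_self hi] at h1 h2
    rw [← h1, h2, h.mem_grid_rotCompl m ha hb hi]
  · rw [mem_localRuleGrid_of_neg_of_pos hc hd, mem_localRuleGrid_of_pos_of_neg hd hc, e1, e2, e3, e4]
    omega
  · rw [mem_localRuleGrid_of_neg_of_pos hd hc, mem_localRuleGrid_of_pos_of_neg hc hd, e1, e2, e3, e4]
    omega
  · exact h.mem_grid_complTranspose_of_pos m ha hb hi hc hd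

theorem mem_grid_antiTranspose_of_pos (h : LocalSquare c d x ν κ μ) (ha : a < c.natAbs)
    (hb : b < d.natAbs) (i : ℕ) (hc : 0 < c) (hd : 0 < d) :
    i ∈ localRuleGrid d c μ ν κ x (d.natAbs - 1 - b) (c.natAbs - 1 - a) ↔
      i ∈ localRuleGrid c d x ν κ μ a b := by
  obtain ⟨p₁, q₁, hp₁, hq₁, -, -, hmem⟩ := h.mem_grid_iff hc.le hd.le ha hb i
  obtain ⟨q₂, p₂, hq₂, hp₂, -, -, hmem'⟩ := h.antiTranspose.mem_grid_iff hd.le hc.le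
    (a := d.natAbs - 1 - b) (b := c.natAbs - 1 - a) (by omega) (by omega) i
  rw [← letterRow_eq_bulletRow h.bottom hb] at hq₂
  rw [← bulletRow_eq_letterRow h.right ha] at hp₂
  obtain ⟨p, p', hpa, hpa', hp, hp', hpκ, hpν, hpc⟩ := h.bullet hc.le ha
  obtain ⟨q, q', hqb, hqb', hq, hq', hqκ, hqν, hqc⟩ := h.letter hd.le hb
  obtain rfl : p₁ = p := Fin.ext (hp₁.symm.trans hpa)
  obtain rfl : q₁ = q := Fin.ext (hq₁.symm.trans hqb)
  obtain rfl : p₂ = p' := Fin.ext (hp₂.symm.trans hpa')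
  obtain rfl : q₂ = q' := Fin.ext (hq₂.symm.trans hqb')
  rw [hmem, hmem']
  have hxp := (h.left.cases p₁).1 hc.le
  have hxq := (h.left.cases q₁).1 hc.le
  have hyq := (h.top.cases q₁).1 hd.le
  have hzp := (h.bottom.cases p₂).1 hd.le
  have hwp := (h.right.cases p₂).1 hc.le
  -- Bullet and letter cross the same class: `p₂ - p₁` is the class end minus the bullet cut, and
  -- `q₁ - q₂` the class end minus the letter cut. Eliminating the end shows that `p + q - cut` is
  -- unchanged.
  have key : κ p₁ = κ q₁ → ν p₁ = κ p₁ + 1 → ν q₁ = κ q₁ + 1 →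
      ((p₂ : ℕ) + (Finset.univ.filter fun k => κ p₁ < x k).card + q₂ =
        p₁ + (Finset.univ.filter fun k => κ q₂ < μ k).card + q₁) := by
    intro h1 h2 h3
    have c1 := h.classCut_eq_card hc.le (p := p₁) (q := q₁) hp (by omega) h1.symm (by omega)
    have c2 := h.antiTranspose.classCut_eq_card hd.le (p := q₂) (q := p₂) hq' (by omega) (by omega)
      (by omega)
    rw [classCut_congr ⟨hqκ, hqν⟩] at c2
    have e1 := class_congr (κ := κ) (ν := ν) (p := p₁) (k := q₁) ⟨h1.symm, by omega⟩
    omega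
  constructor
  · rintro ⟨h1, h2, h3, h4⟩
    have := key (by omega) (by omega) (by omega)
    exact ⟨by omega, by omega, by omega, by omega⟩
  · rintro ⟨h1, h2, h3, h4⟩
    have := key (by omega) (by omega) (by omega)
    exact ⟨by omega, by omega, by omega, by omega⟩

/-- The grid of the square reflected in its antidiagonal is the transpose of the grid in its
antidiagonal. -/
theorem mem_grid_antiTranspose (h : LocalSquare c d x ν κ μ) (ha : a < c.natAbs)
    (hb : b < d.natAbs) {i : ℕ} (hi : i ≤ r) :
    i ∈ localRuleGrid d c μ ν κ x (d.natAbs - 1 - b) (c.natAbs - 1 - a) ↔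
      i ∈ localRuleGrid c d x ν κ μ a b := by
  have hc0 : c ≠ 0 := by rintro rfl; simp at ha
  have hd0 : d ≠ 0 := by rintro rfl; simp at hb
  have e1 := letterRow_eq_bulletRow h.bottom hb
  have e2 := letterRow_eq_bulletRow h.top hb
  have e3 := bulletRow_eq_letterRow h.right ha
  have e4 := bulletRow_eq_letterRow h.left ha
  rcases lt_or_gt_of_ne hc0 with hc | hc <;> rcases lt_or_gt_of_ne hd0 with hd | hd
  · have h1 := h.antiTranspose.mem_grid_rotCompl 0 (a := d.natAbs - 1 - b) (b := c.natAbs - 1 - a)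
      (by omega) (by omega) (i := r - i) (by omega)
    have h2 := h.mem_grid_rotCompl 0 ha hb (i := r - i) (by omega)
    have h3 := (h.rotCompl 0).mem_grid_antiTranspose_of_pos (a := a) (b := b) (by simpa using ha)
      (by simpa using hb) (r - i) (by omega) (by omega)
    rw [Nat.sub_sub_self hi] at h1 h2
    rw [Int.natAbs_neg, Int.natAbs_neg] at h3
    rw [← h1, ← h2, h3]
  · rw [mem_localRuleGrid_of_neg_of_pos hc hd, mem_localRuleGrid_of_pos_of_neg hd hc, e1, e2, e3, e4]
    omega
  · rw [mem_localRuleGrid_of_neg_of_pos hd hc, mem_localRuleGrid_of_pos_of_neg hc hd, e1, e2, e3, e4]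
    omega
  · exact h.mem_grid_antiTranspose_of_pos ha hb i hc hd

end LocalSquare

/-! ### Rows of the promotion matrix -/

section InitialSteps

variable {r : ℕ} {c : ℤ} {X : IntTuple r} {a : ℕ}

/-- A decreasing tuple with entries `0` and `1` has its ones on top. -/
theorem changedRows_zero_of_nonneg (hc : 0 ≤ c) (hX : Antitone X) (h : SkewColumn c 0 X) :
    changedRows 0 X = Finset.range c.natAbs := by
  ext k
  rw [← h.card_changedRows, Finset.mem_range]
  have hlt := lt_card_filter_iff (fun k => (0 : IntTuple r) k ≠ X k) (fun i j hij hj => by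
    have h1 := hX hij
    have h2 := (h.cases j).1 hc
    simp only [Pi.zero_apply] at h2 hj ⊢
    omega)
  have hle : (changedRows 0 X).card ≤ r := h.card_changedRows ▸ h.natAbs_le
  have hcard : (changedRows 0 X).card = (Finset.univ.filter fun k => (0 : IntTuple r) k ≠ X k).card := by
    rw [changedRows, Finset.card_map]
  constructor
  · intro hk
    obtain ⟨p, hp, rfl⟩ := mem_changedRows.1 hk
    rw [hcard, hlt]
    exact hp
  · intro hk
    obtain ⟨p, rfl⟩ := exists_fin_val_eq (hk.trans_le hle)
    rw [hcard, hlt] at hk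
    exact val_mem_changedRows.2 hk

theorem fromTop_range {k : ℕ} (ha : a < k) : fromTop (Finset.range k) a = a := by
  rw [fromTop, Finset.sort_range, List.getD_eq_getElem _ _ (by simpa using ha), List.getElem_range]

theorem letterRow_zero_of_nonneg (hc : 0 ≤ c) (hX : Antitone X) (h : SkewColumn c 0 X)
    (ha : a < c.natAbs) : letterRow c 0 X a = a := by
  rw [letterRow, if_pos hc, changedRows_zero_of_nonneg hc hX h, fromTop_range ha]

theorem letterRow_zero_of_nonpos (hc : c ≤ 0) (hX : Antitone X) (h : SkewColumn c 0 X)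
    (ha : a < c.natAbs) : letterRow c 0 X a = r - 1 - a := by
  have h' : SkewColumn (-c) 0 (rotCompl 0 X) := by
    have := h.rotCompl 0
    rwa [rotCompl_zero] at this
  have := letterRow_neg_rotCompl 0 h' (by simpa using ha)
  rw [neg_neg, rotCompl_zero, rotCompl_rotCompl, letterRow_zero_of_nonneg (by omega)
    (rotCompl_antitone 0 hX) h' (by simpa using ha)] at this
  exact this

end InitialSteps

/-! ### Diagonal blocks of the promotion matrix. -/

section DiagonalBlock

variable {r : ℕ} {c : ℤ} {a b i : ℕ}

theorem mem_diagonalBlock_of_nonneg (hc : 0 ≤ c) (hr : c.natAbs ≤ r) (ha : a < c.natAbs) :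
    i ∈ diagonalBlock r c a b ↔
      (a = b ∧ i = 0) ∨ (a < b ∧ i + a = b) ∨ (b < a ∧ i + a = r + b) := by
  rw [diagonalBlock, upperTriangle, lowerTriangle, if_pos hc, if_pos hc]
  rcases lt_trichotomy a b with h | h | h
  · rw [if_neg (by omega), if_pos (by omega), if_neg (by omega), Finset.union_empty,
      Finset.mem_singleton]
    omega
  · subst h
    simp
  · rw [if_neg (by omega), if_neg (by omega), if_pos (by omega), Finset.empty_union,
      Finset.mem_singleton]
    omega

theorem mem_diagonalBlock_of_neg (hc : c < 0) (hr : c.natAbs ≤ r) (hb : b < c.natAbs) :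
    i ∈ diagonalBlock r c a b ↔
      (a = b ∧ i = 0) ∨ (a < b ∧ i + b = r + a) ∨ (b < a ∧ i + b = a) := by
  rw [diagonalBlock, upperTriangle, lowerTriangle, if_neg hc.not_ge, if_neg hc.not_ge]
  rcases lt_trichotomy a b with h | h | h
  · rw [if_neg (by omega), if_pos (by omega), if_neg (by omega), Finset.union_empty,
      Finset.mem_singleton]
    omega
  · subst h
    simp
  · rw [if_neg (by omega), if_neg (by omega), if_pos (by omega), Finset.empty_union,
      Finset.mem_singleton]
    omega

theorem mem_diagonalBlock_symm (hr : c.natAbs ≤ r) (ha : a < c.natAbs) (hb : b < c.natAbs)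
    (h0 : 0 < i) (hi : i < r) : i ∈ diagonalBlock r c a b ↔ r - i ∈ diagonalBlock r c b a := by
  rcases lt_or_ge c 0 with hc | hc
  · rw [mem_diagonalBlock_of_neg hc hr hb, mem_diagonalBlock_of_neg hc hr ha]
    omega
  · rw [mem_diagonalBlock_of_nonneg hc hr ha, mem_diagonalBlock_of_nonneg hc hr hb]
    omega

theorem mem_diagonalBlock_rev (hr : c.natAbs ≤ r) (ha : a < c.natAbs) (hb : b < c.natAbs) :
    i ∈ diagonalBlock r c (c.natAbs - 1 - b) (c.natAbs - 1 - a) ↔ i ∈ diagonalBlock r c a b := by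
  rcases lt_or_ge c 0 with hc | hc
  · rw [mem_diagonalBlock_of_neg hc hr (by omega), mem_diagonalBlock_of_neg hc hr hb]
    omega
  · rw [mem_diagonalBlock_of_nonneg hc hr (by omega), mem_diagonalBlock_of_nonneg hc hr ha]
    omega

theorem zero_mem_diagonalBlock (hr : c.natAbs ≤ r) (ha : a < c.natAbs) (hb : b < c.natAbs) :
    0 ∈ diagonalBlock r c a b ↔ a = b := by
  rcases lt_or_ge c 0 with hc | hc
  · rw [mem_diagonalBlock_of_neg hc hr hb]
    omega
  · rw [mem_diagonalBlock_of_nonneg hc hr ha]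
    omega

theorem sum_indicator_eq_one {k : ℕ} {P : ℕ → Prop} [DecidablePred P] {b : ℕ} (hb : b < k)
    (h : ∀ b' < k, P b' ↔ b' = b) :
    (∑ b' ∈ Finset.range k, if P b' then 1 else 0 : ℤ) = 1 := by
  rw [Finset.sum_eq_single_of_mem b (Finset.mem_range.2 hb), if_pos ((h b hb).2 rfl)]
  intro b' hb' hne
  exact if_neg fun hP => hne ((h b' (Finset.mem_range.1 hb')).1 hP)

theorem sum_indicator_eq_zero {k : ℕ} {P : ℕ → Prop} [DecidablePred P] (h : ∀ b' < k, ¬P b') :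
    (∑ b' ∈ Finset.range k, if P b' then 1 else 0 : ℤ) = 0 :=
  Finset.sum_eq_zero fun b' hb' => if_neg (h b' (Finset.mem_range.1 hb'))

/-- The numbers in row `a` of the diagonal block are those that the `a`-th bullet does not pass
on its way through the other blocks. -/
theorem sum_diagonalBlock {X : IntTuple r} (hX : Antitone X) (h : SkewColumn c 0 X)
    (ha : a < c.natAbs) (h0 : 0 < i) (hi : i < r) :
    (∑ b ∈ Finset.range c.natAbs, if i ∈ diagonalBlock r c a b then 1 else 0 : ℤ) =
      1 - c.sign * ((if i ≤ r - 1 - letterRow c 0 X a then 1 else 0) -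
        (if i ≤ bulletRow c 0 X a then 1 else 0)) := by
  have hr := h.natAbs_le
  rw [bulletRow_eq_letterRow h ha]
  rcases lt_or_ge c 0 with hc | hc
  · rw [letterRow_zero_of_nonpos hc.le hX h ha, letterRow_zero_of_nonpos hc.le hX h (by omega),
      Int.sign_eq_neg_one_of_neg hc]
    -- Row `a` contains `1, …, a` left of the diagonal and `r + a - |c| + 1, …, r - 1` right of it.
    by_cases h1 : i ≤ a
    · rw [if_pos (by omega), if_pos (by omega), sum_indicator_eq_one (b := a - i) (by omega)]
      · norm_num
      · intro b hb
        rw [mem_diagonalBlock_of_neg hc hr hb]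
        omega
    · by_cases h2 : i + c.natAbs ≤ r + a
      · rw [if_neg (by omega), if_pos (by omega), sum_indicator_eq_zero]
        · norm_num
        · intro b hb
          rw [mem_diagonalBlock_of_neg hc hr hb]
          omega
      · rw [if_neg (by omega), if_neg (by omega), sum_indicator_eq_one (b := r + a - i) (by omega)]
        · norm_num
        · intro b hb
          rw [mem_diagonalBlock_of_neg hc hr hb]
          omega
  · rw [letterRow_zero_of_nonneg hc hX h ha, letterRow_zero_of_nonneg hc hX h (by omega),
      Int.sign_eq_one_of_pos (by omega)]
    -- Row `a` contains `1, …, |c| - 1 - a` right of the diagonal and `r - a, …, r - 1` left of it.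
    by_cases h1 : i + a < c.natAbs
    · rw [if_pos (by omega), if_pos (by omega), sum_indicator_eq_one (b := a + i) (by omega)]
      · norm_num
      · intro b hb
        rw [mem_diagonalBlock_of_nonneg hc hr ha]
        omega
    · by_cases h2 : i + a < r
      · rw [if_pos (by omega), if_neg (by omega), sum_indicator_eq_zero]
        · norm_num
        · intro b hb
          rw [mem_diagonalBlock_of_nonneg hc hr ha]
          omega
      · rw [if_neg (by omega), if_neg (by omega), sum_indicator_eq_one (b := i + a - r) (by omega)]
        · norm_num
        · intro b hb
          rw [mem_diagonalBlock_of_nonneg hc hr ha]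
          omega

end DiagonalBlock

/-- No bullet passes the number `0`: the row sum in `sum_grid` vanishes for `i = 0`. -/
theorem LocalSquare.zero_notMem_grid {r : ℕ} {c d : ℤ} {x ν κ μ : IntTuple r} {a b : ℕ}
    (h : LocalSquare c d x ν κ μ) (ha : a < c.natAbs) (hb : b < d.natAbs) :
    0 ∉ localRuleGrid c d x ν κ μ a b := by
  intro hmem
  have hsum := h.sum_grid ha (Nat.zero_le r)
  simp only [Nat.zero_le, if_true, sub_self, mul_zero] at hsum
  rw [Finset.sum_eq_zero_iff_of_nonneg (fun b _ => by split_ifs <;> norm_num)] at hsum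
  have := hsum b (Finset.mem_range.2 hb)
  rw [if_pos hmem] at this
  exact one_ne_zero this

/-! ### Assembling the blocks. -/

namespace FluctuatingTableau

variable {r n : ℕ} {c : Fin n → ℤ} (T : FluctuatingTableau r n c)

theorem natAbs_le (T : FluctuatingTableau r n c) (u : Fin n) : (c u).natAbs ≤ r := (T.step u).natAbs_le

theorem localSquare {u v : Fin n} (huv : u < v) : LocalSquare (c u) (c v)
    (T.evacDiagram u v) (T.evacDiagram u (v + 1)) (T.evacDiagram (u + 1) v)
    (T.evacDiagram (u + 1) (v + 1)) := by
  rw [Fin.lt_def] at huv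
  have hv := v.isLt
  exact {
    antitone_upperLeft := T.evacDiagram_antitone (by omega) (by omega)
    antitone_upperRight := T.evacDiagram_antitone (by omega) (by omega)
    antitone_lowerLeft := T.evacDiagram_antitone (by omega) (by omega)
    left := typeSeq_val c u ▸ T.evacDiagram_vertical huv (by omega)
    top := typeSeq_val c v ▸ T.evacDiagram_horizontal (by omega) hv
    rule := T.evacDiagram_rule huv }

variable {T} {m : ℤ} {p q : (j : Fin n) × Fin (c j).natAbs}

theorem promMatrix_of_lt (h : p.1 < q.1) : T.promMatrix p q = localRuleGrid (c p.1) (c q.1)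
    (T.evacDiagram p.1 q.1) (T.evacDiagram p.1 (q.1 + 1)) (T.evacDiagram (p.1 + 1) q.1)
    (T.evacDiagram (p.1 + 1) (q.1 + 1)) p.2 q.2 := by
  rw [Fin.lt_def] at h
  simp only [promMatrix, if_pos h]

/-- Each block below the diagonal is the grid of the complemented transpose of the square of the
mirrored block, the situation of `mem_grid_complTranspose`. -/
theorem promMatrix_of_gt (hm : T.row n = fun _ => m) (h : q.1 < p.1) :
    T.promMatrix p q = localRuleGrid (c p.1) (c q.1)
      (rotCompl m (T.evacDiagram q.1 p.1)) (rotCompl m (T.evacDiagram (q.1 + 1) p.1))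
      (rotCompl m (T.evacDiagram q.1 (p.1 + 1)))
      (rotCompl m (T.evacDiagram (q.1 + 1) (p.1 + 1))) p.2 q.2 := by
  rw [Fin.lt_def] at h
  have hp := p.1.isLt
  simp only [promMatrix, if_neg h.asymm, if_pos h]
  rw [dualEvacDiagram_dualEvacuation_evacuation hm (by omega),
    dualEvacDiagram_dualEvacuation_evacuation hm (by omega),
    dualEvacDiagram_dualEvacuation_evacuation hm (by omega),
    dualEvacDiagram_dualEvacuation_evacuation hm (by omega),
    Nat.sub_sub_self hp.le, Nat.sub_sub_self hp]

theorem promMatrix_of_eq (h : p.1 = q.1) :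
    T.promMatrix p q = diagonalBlock r (c p.1) p.2 q.2 := by
  simp only [promMatrix, h, lt_irrefl, if_false]

theorem mem_promMatrix_symm_of_lt (hm : T.row n = fun _ => m) (h : p.1 < q.1) {i : ℕ}
    (hi : i ≤ r) : i ∈ T.promMatrix q p ↔ r - i ∈ T.promMatrix p q := by
  rw [promMatrix_of_gt hm h, promMatrix_of_lt h]
  exact (T.localSquare h).mem_grid_complTranspose m p.2.isLt q.2.isLt hi

/-- Transposition of the promotion matrix turns `i` into `r - i`. -/
theorem mem_promMatrix_symm (hm : T.row n = fun _ => m) {i : ℕ} (h0 : 0 < i) (hi : i < r) :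
    i ∈ T.promMatrix p q ↔ r - i ∈ T.promMatrix q p := by
  rcases lt_trichotomy p.1 q.1 with h | h | h
  · rw [mem_promMatrix_symm_of_lt hm h (by omega), Nat.sub_sub_self hi.le]
  · obtain ⟨u, a⟩ := p
    obtain ⟨v, b⟩ := q
    obtain rfl : u = v := h
    rw [promMatrix_of_eq (p := ⟨u, a⟩) (q := ⟨u, b⟩) rfl,
      promMatrix_of_eq (p := ⟨u, b⟩) (q := ⟨u, a⟩) rfl]
    exact mem_diagonalBlock_symm (T.natAbs_le u) a.isLt b.isLt h0 hi
  · exact mem_promMatrix_symm_of_lt hm h hi.le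

theorem zero_mem_promMatrix (hm : T.row n = fun _ => m) : 0 ∈ T.promMatrix p q ↔ p = q := by
  rcases lt_trichotomy p.1 q.1 with h | h | h
  · rw [promMatrix_of_lt h]
    refine iff_of_false ((T.localSquare h).zero_notMem_grid p.2.isLt q.2.isLt) ?_
    rintro rfl
    exact lt_irrefl _ h
  · obtain ⟨u, a⟩ := p
    obtain ⟨v, b⟩ := q
    obtain rfl : u = v := h
    rw [promMatrix_of_eq (p := ⟨u, a⟩) (q := ⟨u, b⟩) rfl, zero_mem_diagonalBlock (T.natAbs_le u) a.isLt b.isLt]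
    simp [Fin.ext_iff]
  · rw [promMatrix_of_gt hm h]
    refine iff_of_false (((T.localSquare h).complTranspose m).zero_notMem_grid p.2.isLt q.2.isLt) ?_
    rintro rfl
    exact lt_irrefl _ h

theorem sum_range_split {n u : ℕ} (hu : u < n) (F : ℕ → ℤ) : ∑ v ∈ Finset.range n, F v =
    ∑ v ∈ Finset.range u, F v + F u + ∑ v ∈ Finset.Ico (u + 1) n, F v := by
  rw [← Finset.sum_range_succ, Finset.sum_range_add_sum_Ico _ hu]

/-- Every number `0 < i < r` occurs exactly once in every row of the promotion matrix. -/
theorem sum_promMatrix (hm : T.row n = fun _ => m) (p : (j : Fin n) × Fin (c j).natAbs) {i : ℕ}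
    (h0 : 0 < i) (hi : i < r) : (∑ q, if i ∈ T.promMatrix p q then 1 else 0 : ℤ) = 1 := by
  obtain ⟨u, a⟩ := p
  have hu := u.isLt
  let F : ℕ → ℤ := fun v => if h : v < n then
    ∑ b : Fin (c ⟨v, h⟩).natAbs, if i ∈ T.promMatrix ⟨u, a⟩ ⟨⟨v, h⟩, b⟩ then 1 else 0 else 0
  -- `β` and `γ` tell whether bullet `a` has reached row `i` when it arrives at column `v`, right
  -- and left of the diagonal respectively.
  let β : ℕ → ℤ := fun v =>
    if i ≤ bulletRow (c u) (T.evacDiagram (u + 1) v) (T.evacDiagram u v) a then 1 else 0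
  let γ : ℕ → ℤ := fun v => if i ≤ bulletRow (c u) (rotCompl m (T.evacDiagram v (u + 1)))
    (rotCompl m (T.evacDiagram v u)) a then 1 else 0
  have hF : (∑ q, if i ∈ T.promMatrix ⟨u, a⟩ q then 1 else 0 : ℤ) = ∑ v ∈ Finset.range n, F v := by
    rw [Fintype.sum_sigma, Finset.sum_range]
    refine Finset.sum_congr rfl fun v _ => ?_
    simp only [F, dif_pos v.isLt, Fin.eta]
  have hupper : ∀ v ∈ Finset.Ico ((u : ℕ) + 1) n, F v = (c u).sign * (β (v + 1) - β v) := by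
    intro v hv
    rw [Finset.mem_Ico] at hv
    have huv : u < ⟨v, hv.2⟩ := Fin.lt_def.2 hv.1
    simp only [F, dif_pos hv.2]
    rw [← (T.localSquare huv).sum_grid a.isLt hi.le, Finset.sum_range]
    refine Finset.sum_congr rfl fun b _ => ?_
    rw [promMatrix_of_lt huv]
  have hlower : ∀ v ∈ Finset.range (u : ℕ), F v = (c u).sign * (γ (v + 1) - γ v) := by
    intro v hv
    rw [Finset.mem_range] at hv
    have huv : (⟨v, hv.trans hu⟩ : Fin n) < u := Fin.lt_def.2 hv
    simp only [F, dif_pos (hv.trans hu)]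
    rw [← ((T.localSquare huv).complTranspose m).sum_grid a.isLt hi.le, Finset.sum_range]
    refine Finset.sum_congr rfl fun b _ => ?_
    rw [promMatrix_of_gt hm huv]
  have hX := T.evacDiagram_antitone (i := u) (j := u + 1) (by omega) hu
  have hstep : SkewColumn (c u) 0 (T.evacDiagram u (u + 1)) := by
    have := T.evacDiagram_horizontal (i := u) le_rfl hu
    rwa [evacDiagram_diag, typeSeq_val] at this
  have hdiag : F u = 1 - (c u).sign * (γ u - β (u + 1)) := by
    have := sum_diagonalBlock hX hstep a.isLt h0 hi
    simp only [F, β, γ, dif_pos hu, Fin.eta, evacDiagram_diag]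
    rw [bulletRow_rotCompl m hstep a.isLt, ← this, Finset.sum_range]
    refine Finset.sum_congr rfl fun b _ => ?_
    rw [promMatrix_of_eq (p := ⟨u, a⟩) (q := ⟨u, b⟩) rfl]
  -- Here rectangularity closes the path of the bullet: the right end of its upper strip equals the
  -- left end of its lower strip.
  have hjoin : γ 0 = β n := by
    simp only [γ, β]
    rw [evacDiagram_zero, evacDiagram_zero, evacDiagram_last hm hu, evacDiagram_last hm hu.le]
  rw [hF, sum_range_split hu, Finset.sum_congr rfl hupper, Finset.sum_congr rfl hlower, hdiag,
    ← Finset.mul_sum, ← Finset.mul_sum, Finset.sum_range_sub, Finset.sum_Ico_sub _ (by omega), hjoin]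
  ring

theorem existsUnique_mem_promMatrix (hm : T.row n = fun _ => m)
    (p : (j : Fin n) × Fin (c j).natAbs) {i : ℕ} (h0 : 0 < i) (hi : i < r) :
    ∃ q, ∀ q', i ∈ T.promMatrix p q' ↔ q = q' := by
  have h := sum_promMatrix hm p h0 hi
  rw [Finset.sum_boole, Nat.cast_eq_one, Finset.card_eq_one] at h
  obtain ⟨q, hq⟩ := h
  refine ⟨q, fun q' => ?_⟩
  have := Finset.ext_iff.1 hq q'
  simpa [eq_comm] using this

/-! ### Promotion permutations -/

theorem mem_promMatrix_normalized_symm (hm : T.row n = fun _ => m) {i : ℕ} (hi : i ≤ r) :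
    (if i = r then 0 else i) ∈ T.promMatrix p q ↔
      (if r - i = r then 0 else r - i) ∈ T.promMatrix q p := by
  by_cases h1 : i = r
  · rw [if_pos h1, zero_mem_promMatrix hm]
    have : (if r - i = r then 0 else r - i) = 0 := by split_ifs <;> omega
    rw [this, zero_mem_promMatrix hm, eq_comm]
  · by_cases h2 : i = 0
    · subst h2
      rw [if_neg h1, if_pos (by omega), zero_mem_promMatrix hm, zero_mem_promMatrix hm, eq_comm]
    · rw [if_neg h1, if_neg (by omega), mem_promMatrix_symm hm (by omega) (by omega)]

theorem exists_forall_mem_promMatrix_iff (hm : T.row n = fun _ => m) {i : ℕ} (hi : i ≤ r)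
    (p : (j : Fin n) × Fin (c j).natAbs) :
    ∃ q, ∀ q', (if i = r then 0 else i) ∈ T.promMatrix p q' ↔ q = q' := by
  by_cases h : (if i = r then 0 else i) = 0
  · rw [h]
    exact ⟨p, fun q' => zero_mem_promMatrix hm⟩
  · have hne : i ≠ r := by rintro rfl; simp at h
    rw [if_neg hne] at h ⊢
    exact existsUnique_mem_promMatrix hm p (by omega) (by omega)

/-- Uniqueness in rows gives maps for `i` and `r - i`, and transposition makes them mutually
inverse, so columns need no separate count. -/
theorem exists_perm_promMatrix (hm : T.row n = fun _ => m) :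
    ∃ f : ℕ → Equiv.Perm ((j : Fin n) × Fin (c j).natAbs), ∀ i ≤ r,
      (∀ p q, (if i = r then 0 else i) ∈ T.promMatrix p q ↔ f i p = q) ∧ f i = (f (r - i))⁻¹ := by
  have hex : ∀ i : ℕ, ∃ f : Equiv.Perm ((j : Fin n) × Fin (c j).natAbs), i ≤ r →
      ∀ p q, (if i = r then 0 else i) ∈ T.promMatrix p q ↔ f p = q := by
    intro i
    by_cases hi : i ≤ r
    · choose f hf using exists_forall_mem_promMatrix_iff (T := T) hm hi
      choose g hg using exists_forall_mem_promMatrix_iff (T := T) hm (Nat.sub_le r i)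
      refine ⟨⟨f, g, fun p => ?_, fun p => ?_⟩, fun _ => hf⟩
      · rw [← hg, ← mem_promMatrix_normalized_symm hm hi, hf]
      · rw [← hf, mem_promMatrix_normalized_symm hm hi, hg]
    · exact ⟨1, fun h => absurd h hi⟩
  choose f hf using hex
  refine ⟨f, fun i hi => ⟨hf i hi, ?_⟩⟩
  ext1 p
  rw [Equiv.Perm.eq_inv_iff_eq, ← hf (r - i) (Nat.sub_le r i), ← mem_promMatrix_normalized_symm hm hi,
    hf i hi]

end FluctuatingTableau

/-! ### Promotion and evacuation of promotion permutations -/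

namespace FluctuatingTableau

variable {r n : ℕ} {c : Fin n → ℤ} {T : FluctuatingTableau r n c} {m : ℤ} {i : ℕ}

/-- The relabelling of the rows of the promotion matrix under promotion. -/
def promotionIndex (c : Fin n → ℤ) :
    ((j : Fin n) × Fin ((c ∘ finRotate n) j).natAbs) ≃ ((j : Fin n) × Fin (c j).natAbs) :=
  Equiv.sigmaCongrLeft (β := fun j => Fin (c j).natAbs) (finRotate n)

/-- The relabelling of the rows of the promotion matrix under evacuation. -/
def evacuationIndex (c : Fin n → ℤ) :
    ((j : Fin n) × Fin ((c ∘ Fin.rev) j).natAbs) ≃ ((j : Fin n) × Fin (c j).natAbs) :=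
  (Equiv.sigmaCongrRight fun _ => Fin.revPerm).trans
    (Equiv.sigmaCongrLeft (β := fun j => Fin (c j).natAbs) Fin.revPerm)

theorem val_finRotate_of_lt {u : Fin n} (h : (u : ℕ) + 1 < n) : (finRotate n u : ℕ) = u + 1 := by
  obtain ⟨k, rfl⟩ : ∃ k, n = k + 1 := ⟨n - 1, by omega⟩
  exact coe_finRotate_of_ne_last fun hu => by
    rw [hu, Fin.val_last] at h
    exact lt_irrefl _ h

theorem val_finRotate_of_eq {u : Fin n} (h : (u : ℕ) + 1 = n) : (finRotate n u : ℕ) = 0 := by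
  obtain ⟨k, rfl⟩ : ∃ k, n = k + 1 := ⟨u, h.symm⟩
  have hu : u = Fin.last k := Fin.ext (Nat.succ.inj h)
  rw [hu, finRotate_last]
  rfl

/-- Squares outside the last column are shifted along the diagonal. The last block column comes from
block column `0` of `T`, below the diagonal, and the complemented last column makes the corners
match. -/
theorem promMatrix_promotion_of_lt (hm : T.row n = fun _ => m)
    {p q : (j : Fin n) × Fin ((c ∘ finRotate n) j).natAbs} (h : p.1 < q.1) :
    T.promotion.promMatrix p q = T.promMatrix (promotionIndex c p) (promotionIndex c q) := by
  obtain ⟨u, a⟩ := p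
  obtain ⟨v, b⟩ := q
  rw [promMatrix_of_lt h]
  have h' : (u : ℕ) < v := h
  have hv := v.isLt
  have hu' : (finRotate n u : ℕ) = u + 1 := val_finRotate_of_lt (by omega)
  change localRuleGrid (c (finRotate n u)) (c (finRotate n v)) _ _ _ _ _ _ =
    T.promMatrix ⟨finRotate n u, a⟩ ⟨finRotate n v, b⟩
  rcases (show (v : ℕ) + 1 ≤ n from hv).lt_or_eq with hlt | heq
  · have hv' := val_finRotate_of_lt hlt
    rw [promMatrix_of_lt (p := ⟨finRotate n u, a⟩) (q := ⟨finRotate n v, b⟩)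
      (Fin.lt_def.2 (by simp only [hu', hv']; omega))]
    simp only [hu', hv']
    rw [evacDiagram_promotion (by omega) (by omega), evacDiagram_promotion (by omega) (by omega),
      evacDiagram_promotion (by omega) (by omega), evacDiagram_promotion (by omega) (by omega)]
  · have hv' := val_finRotate_of_eq heq
    rw [promMatrix_of_gt (p := ⟨finRotate n u, a⟩) (q := ⟨finRotate n v, b⟩) hm
      (Fin.lt_def.2 (by simp only [hu', hv']; omega))]
    simp only [hu', hv']
    rw [evacDiagram_promotion (i := u) (j := v) (by omega) hv,
      evacDiagram_promotion (i := u + 1) (j := v) (by omega) hv, heq, evacDiagram_promotion_last hm (by omega), evacDiagram_promotion_last hm (by omega),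
      evacDiagram_last hm (by omega), evacDiagram_last hm (by omega), evacDiagram_zero,
      evacDiagram_zero]

theorem mem_promMatrix_promotion (hm : T.row n = fun _ => m)
    (p q : (j : Fin n) × Fin ((c ∘ finRotate n) j).natAbs) (h0 : 0 < i) (hi : i < r) :
    i ∈ T.promotion.promMatrix p q ↔
      i ∈ T.promMatrix (promotionIndex c p) (promotionIndex c q) := by
  rcases lt_trichotomy p.1 q.1 with h | h | h
  · rw [promMatrix_promotion_of_lt hm h]
  · obtain ⟨u, a⟩ := p
    obtain ⟨v, b⟩ := q
    obtain rfl : u = v := h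
    rw [promMatrix_of_eq (p := ⟨u, a⟩) (q := ⟨u, b⟩) rfl]
    change _ ↔ _ ∈ T.promMatrix ⟨finRotate n u, a⟩ ⟨finRotate n u, b⟩
    rw [promMatrix_of_eq (p := ⟨finRotate n u, a⟩) (q := ⟨finRotate n u, b⟩) rfl]
    rfl
  · rw [mem_promMatrix_symm (T.row_promotion_last.trans hm) h0 hi, promMatrix_promotion_of_lt hm h,
      ← mem_promMatrix_symm hm h0 hi]

/-- Block `(u, v)` belongs to the antidiagonal reflection of the square of block `(rev v, rev u)`.
The transposition that remains is what later turns `i` into `r - i`. -/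
theorem mem_promMatrix_evacuation_of_lt
    {p q : (j : Fin n) × Fin ((c ∘ Fin.rev) j).natAbs} (h : p.1 < q.1) (hi : i ≤ r) :
    i ∈ T.evacuation.promMatrix p q ↔
      i ∈ T.promMatrix (evacuationIndex c q) (evacuationIndex c p) := by
  obtain ⟨u, a⟩ := p
  obtain ⟨v, b⟩ := q
  rw [promMatrix_of_lt h]
  have h' : (u : ℕ) < v := h
  have hv := v.isLt
  have hrev : Fin.rev v < Fin.rev u := Fin.rev_lt_rev.2 h
  change _ ↔ _ ∈ T.promMatrix ⟨Fin.rev v, Fin.rev b⟩ ⟨Fin.rev u, Fin.rev a⟩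
  rw [promMatrix_of_lt (p := ⟨Fin.rev v, Fin.rev b⟩) (q := ⟨Fin.rev u, Fin.rev a⟩) hrev,
    ← (T.localSquare hrev).mem_grid_antiTranspose (Fin.rev b).isLt (Fin.rev a).isLt hi]
  dsimp only
  rw [evacDiagram_evacuation (by omega) (by omega), evacDiagram_evacuation (by omega) (by omega),
    evacDiagram_evacuation (by omega) (by omega), evacDiagram_evacuation (by omega) (by omega)]
  have ha : (c (Fin.rev u)).natAbs - 1 - (Fin.rev a : ℕ) = a := by
    have : (a : ℕ) < (c (Fin.rev u)).natAbs := a.isLt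
    rw [Fin.val_rev]
    simp only [Function.comp_apply]
    omega
  have hb : (c (Fin.rev v)).natAbs - 1 - (Fin.rev b : ℕ) = b := by
    have : (b : ℕ) < (c (Fin.rev v)).natAbs := b.isLt
    rw [Fin.val_rev]
    simp only [Function.comp_apply]
    omega
  rw [ha, hb, Fin.val_rev, Fin.val_rev, show n - (v + 1 : ℕ) + 1 = n - v by omega,
    show n - (u + 1 : ℕ) + 1 = n - u by omega]
  rfl

theorem mem_promMatrix_evacuation (hm : T.row n = fun _ => m)
    (p q : (j : Fin n) × Fin ((c ∘ Fin.rev) j).natAbs) (h0 : 0 < i) (hi : i < r) :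
    i ∈ T.evacuation.promMatrix p q ↔
      r - i ∈ T.promMatrix (evacuationIndex c p) (evacuationIndex c q) := by
  rw [← mem_promMatrix_symm hm h0 hi]
  rcases lt_trichotomy p.1 q.1 with h | h | h
  · exact mem_promMatrix_evacuation_of_lt h hi.le
  · obtain ⟨u, a⟩ := p
    obtain ⟨v, b⟩ := q
    obtain rfl : u = v := h
    rw [promMatrix_of_eq (p := ⟨u, a⟩) (q := ⟨u, b⟩) rfl]
    change _ ↔ _ ∈ T.promMatrix ⟨Fin.rev u, Fin.rev b⟩ ⟨Fin.rev u, Fin.rev a⟩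
    rw [promMatrix_of_eq (p := ⟨Fin.rev u, Fin.rev b⟩) (q := ⟨Fin.rev u, Fin.rev a⟩) rfl,
      ← mem_diagonalBlock_rev ((T.evacuation).natAbs_le u) a.isLt b.isLt]
    dsimp only
    rw [Fin.val_rev, Fin.val_rev, Nat.sub_sub, Nat.sub_sub, Nat.add_comm 1, Nat.add_comm 1]
    rfl
  · rw [mem_promMatrix_symm (T.row_evacuation_last.trans hm) h0 hi,
      mem_promMatrix_evacuation_of_lt h (by omega), ← mem_promMatrix_symm hm h0 hi]

theorem mem_promMatrix_normalized_promotion (hm : T.row n = fun _ => m)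
    (p q : (j : Fin n) × Fin ((c ∘ finRotate n) j).natAbs) (hi : i ≤ r) :
    (if i = r then 0 else i) ∈ T.promotion.promMatrix p q ↔
      (if i = r then 0 else i) ∈ T.promMatrix (promotionIndex c p) (promotionIndex c q) := by
  by_cases h : (if i = r then 0 else i) = 0
  · rw [h, zero_mem_promMatrix (T.row_promotion_last.trans hm), zero_mem_promMatrix hm,
      (promotionIndex c).apply_eq_iff_eq]
  · have hne : i ≠ r := by rintro rfl; simp at h
    rw [if_neg hne] at h ⊢
    exact mem_promMatrix_promotion hm p q (by omega) (by omega)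

theorem mem_promMatrix_normalized_evacuation (hm : T.row n = fun _ => m)
    (p q : (j : Fin n) × Fin ((c ∘ Fin.rev) j).natAbs) (hi : i ≤ r) :
    (if i = r then 0 else i) ∈ T.evacuation.promMatrix p q ↔
      (if r - i = r then 0 else r - i) ∈
        T.promMatrix (evacuationIndex c p) (evacuationIndex c q) := by
  by_cases h : (if i = r then 0 else i) = 0
  · have h' : (if r - i = r then 0 else r - i) = 0 := by split_ifs at h ⊢ <;> omega
    rw [h, h', zero_mem_promMatrix (T.row_evacuation_last.trans hm), zero_mem_promMatrix hm,
      (evacuationIndex c).apply_eq_iff_eq]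
  · have hne : i ≠ r := by rintro rfl; simp at h
    rw [if_neg hne] at h ⊢
    rw [if_neg (by omega)]
    exact mem_promMatrix_evacuation hm p q (by omega) (by omega)

/-! ### Numbering the rows of the promotion matrix -/

variable {t : ℕ}

/-- The numbering of the rows of the promotion matrix by `Fin t`, block by block. -/
def position (c : Fin n → ℤ) (ht : ∑ j, (c j).natAbs = t) :
    ((j : Fin n) × Fin (c j).natAbs) ≃ Fin t :=
  finSigmaFinEquiv.trans (finCongr ht)

theorem val_position (ht : ∑ j, (c j).natAbs = t) (p : (j : Fin n) × Fin (c j).natAbs) :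
    (position c ht p : ℕ) = ∑ j ∈ Finset.range p.1, (typeSeq c j).natAbs + p.2 := by
  change (finSigmaFinEquiv p : ℕ) = _
  rw [finSigmaFinEquiv_apply, Finset.sum_range]
  congr 1
  refine Finset.sum_congr rfl fun j _ => ?_
  rw [← typeSeq_val c]
  rfl

theorem sum_typeSeq (ht : ∑ j, (c j).natAbs = t) :
    ∑ j ∈ Finset.range n, (typeSeq c j).natAbs = t := by
  rw [← ht, Finset.sum_range]
  exact Finset.sum_congr rfl fun j _ => by rw [typeSeq_val]

theorem promGraph_position (ht : ∑ j, (c j).natAbs = t) (p q : (j : Fin n) × Fin (c j).natAbs) :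
    T.PromGraph i (position c ht p) (position c ht q) ↔
      (if i = r then 0 else i) ∈ T.promMatrix p q := by
  refine ⟨?_, fun h => ⟨p, q, rfl, rfl, h⟩⟩
  rintro ⟨p', q', hp, hq, h⟩
  obtain rfl : p' = p := finSigmaFinEquiv.injective (Fin.ext hp)
  obtain rfl : q' = q := finSigmaFinEquiv.injective (Fin.ext hq)
  exact h

theorem promEq_permCongr (ht : ∑ j, (c j).natAbs = t)
    {f : Equiv.Perm ((j : Fin n) × Fin (c j).natAbs)}
    (hf : ∀ p q, (if i = r then 0 else i) ∈ T.promMatrix p q ↔ f p = q) :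
    T.PromEq i ((position c ht).permCongr f) := by
  intro a b
  obtain ⟨p, rfl⟩ := (position c ht).surjective a
  obtain ⟨q, rfl⟩ := (position c ht).surjective b
  rw [promGraph_position, hf, Equiv.permCongr_apply, Equiv.symm_apply_apply,
    (position c ht).apply_eq_iff_eq]

/-- Transport along a relabelling `g` of the blocks that becomes the permutation `τ` of `[t]` after
numbering. -/
theorem PromEq.conj {c' : Fin n → ℤ} {T' : FluctuatingTableau r n c'} {k : ℕ}
    {π τ : Equiv.Perm (Fin t)} (ht : ∑ j, (c j).natAbs = t) (ht' : ∑ j, (c' j).natAbs = t)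
    (g : ((j : Fin n) × Fin (c' j).natAbs) ≃ ((j : Fin n) × Fin (c j).natAbs))
    (hτ : ∀ p, τ (position c' ht' p) = position c ht (g p))
    (hg : ∀ p q, (if i = r then 0 else i) ∈ T'.promMatrix p q ↔
      (if k = r then 0 else k) ∈ T.promMatrix (g p) (g q))
    (h : T.PromEq k π) : T'.PromEq i (τ⁻¹ * π * τ) := by
  intro a b
  obtain ⟨p, rfl⟩ := (position c' ht').surjective a
  obtain ⟨q, rfl⟩ := (position c' ht').surjective b
  rw [promGraph_position, hg, ← promGraph_position ht, h, ← hτ, ← hτ, Equiv.Perm.mul_apply,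
    Equiv.Perm.mul_apply, Equiv.Perm.inv_eq_iff_eq]

theorem val_finRotate_pow (k : ℕ) (a : Fin t) : ((finRotate t ^ k) a : ℕ) = (a + k) % t := by
  obtain ⟨s, rfl⟩ : ∃ s, t = s + 1 := ⟨t - 1, by have := a.isLt; omega⟩
  induction k with
  | zero => rw [pow_zero, Equiv.Perm.one_apply, add_zero, Nat.mod_eq_of_lt a.isLt]
  | succ k ih =>
    rw [pow_succ', Equiv.Perm.mul_apply, finRotate_apply, Fin.val_add, ih, Fin.val_one',
      ← Nat.add_mod, add_assoc]

theorem typeSeq_finRotate {j : ℕ} (hj : j + 1 < n) :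
    typeSeq (c ∘ finRotate n) j = typeSeq c (j + 1) := by
  have h := typeSeq_val (c ∘ finRotate n) ⟨j, by omega⟩
  have h' := val_finRotate_of_lt (u := ⟨j, by omega⟩) hj
  rw [h, Function.comp_apply, ← typeSeq_val c, h']

/-- Promotion moves the first block to the end, so old and new positions differ by its size modulo
`t`; only the positions of that block wrap around. -/
theorem finRotate_pow_position (h : 0 < n) (ht : ∑ j, (c j).natAbs = t)
    (ht' : ∑ j, ((c ∘ finRotate n) j).natAbs = t)
    (p : (j : Fin n) × Fin ((c ∘ finRotate n) j).natAbs) :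
    (finRotate t ^ (c ⟨0, h⟩).natAbs) (position _ ht' p) = position c ht (promotionIndex c p) := by
  ext
  have hlt := (position c ht (promotionIndex c p)).isLt
  rw [val_finRotate_pow, val_position]
  rw [val_position] at hlt ⊢
  obtain ⟨u, a⟩ := p
  change (_ + (a : ℕ) + _) % t = ∑ j ∈ Finset.range (finRotate n u), _ + (a : ℕ)
  change ∑ j ∈ Finset.range (finRotate n u), _ + (a : ℕ) < t at hlt
  have hu := u.isLt
  have hsum : ∑ j ∈ Finset.range u, (typeSeq (c ∘ finRotate n) j).natAbs + (c ⟨0, h⟩).natAbs =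
      ∑ j ∈ Finset.range (u + 1), (typeSeq c j).natAbs := by
    rw [Finset.sum_range_succ', ← typeSeq_val c]
    congr 1
    refine Finset.sum_congr rfl fun j hj => ?_
    rw [typeSeq_finRotate (by rw [Finset.mem_range] at hj; omega)]
  dsimp only
  rw [add_right_comm, hsum]
  rcases (show (u : ℕ) + 1 ≤ n from hu).lt_or_eq with hun | hun
  · rw [val_finRotate_of_lt hun] at hlt ⊢
    exact Nat.mod_eq_of_lt hlt
  · rw [val_finRotate_of_eq hun, Finset.sum_range_zero, zero_add] at hlt ⊢
    rw [hun, sum_typeSeq ht, Nat.add_mod_left, Nat.mod_eq_of_lt hlt]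

theorem typeSeq_rev {j : ℕ} (hj : j < n) : typeSeq (c ∘ Fin.rev) j = typeSeq c (n - (j + 1)) := by
  have h := typeSeq_val (c ∘ Fin.rev) ⟨j, hj⟩
  rw [h, Function.comp_apply, ← typeSeq_val c, Fin.val_rev]

theorem sum_typeSeq_rev {u : ℕ} (hu : u ≤ n) :
    ∑ j ∈ Finset.range u, (typeSeq (c ∘ Fin.rev) j).natAbs +
      ∑ j ∈ Finset.range (n - u), (typeSeq c j).natAbs =
    ∑ j ∈ Finset.range n, (typeSeq c j).natAbs := by
  induction u with
  | zero => simp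
  | succ u ih =>
    rw [← ih (by omega), Finset.sum_range_succ, typeSeq_rev hu,
      show n - u = n - (u + 1) + 1 by omega, Finset.sum_range_succ]
    ring

theorem revPerm_position (ht : ∑ j, (c j).natAbs = t)
    (ht' : ∑ j, ((c ∘ Fin.rev) j).natAbs = t)
    (p : (j : Fin n) × Fin ((c ∘ Fin.rev) j).natAbs) :
    Fin.revPerm (position _ ht' p) = position c ht (evacuationIndex c p) := by
  ext
  rw [Fin.revPerm_apply, Fin.val_rev, val_position, val_position]
  obtain ⟨u, a⟩ := p
  have hu := u.isLt
  have ha : (a : ℕ) < (c (Fin.rev u)).natAbs := a.isLt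
  change t - (_ + (a : ℕ) + 1) = ∑ j ∈ Finset.range (Fin.rev u), _ + (Fin.rev a : ℕ)
  have hsum := sum_typeSeq_rev (c := c) hu.le
  have hrev : (Fin.rev a : ℕ) = (c (Fin.rev u)).natAbs - (a + 1) := Fin.val_rev a
  rw [sum_typeSeq ht, show n - (u : ℕ) = n - (u + 1) + 1 by omega, Finset.sum_range_succ,
    ← Fin.val_rev, typeSeq_val] at hsum
  dsimp only
  omega

end FluctuatingTableau

open FluctuatingTableau in
/-- All `prom_i(T)` are permutations `π i` of `[t]`; here `finRotate t` is the long cycle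
`σ = (1 2 ⋯ t)` and `Fin.revPerm` is the longest element `w_0`. -/
theorem theorem5p6 (r n t : ℕ) (c : Fin n → ℤ) (T : FluctuatingTableau r n c)
    (hT : T.IsRectangular) (ht : ∑ j, (c j).natAbs = t) :
    ∃ π : ℕ → Equiv.Perm (Fin t),
      (∀ i ≤ r, T.PromEq i (π i)) ∧
      (∀ i ≤ r, π i = (π (r - i))⁻¹) ∧
      (∀ h : 0 < n, ∀ i ≤ r, T.promotion.PromEq i
        (finRotate t ^ (-|c ⟨0, h⟩|) * π i * finRotate t ^ |c ⟨0, h⟩|)) ∧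
      (∀ i ≤ r, T.evacuation.PromEq i
        ((Fin.revPerm : Equiv.Perm (Fin t)) * π (r - i) * Fin.revPerm)) := by
  obtain ⟨m, hm⟩ := hT.exists_row
  obtain ⟨f, hf⟩ := exists_perm_promMatrix hm
  have hπ : ∀ i ≤ r, T.PromEq i ((position c ht).permCongr (f i)) :=
    fun i hi => promEq_permCongr ht (hf i hi).1
  refine ⟨fun i => (position c ht).permCongr (f i), hπ, fun i hi => ?_, fun h i hi => ?_,
    fun i hi => ?_⟩
  · change (position c ht).permCongr (f i) = _
    rw [(hf i hi).2]
    rfl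
  · rw [Int.abs_eq_natAbs, zpow_neg, zpow_natCast]
    exact (hπ i hi).conj ht ((Equiv.sum_comp (finRotate n) fun j => (c j).natAbs).trans ht)
      (promotionIndex c) (finRotate_pow_position h ht _)
      fun p q => mem_promMatrix_normalized_promotion hm p q hi
  · exact (hπ (r - i) (Nat.sub_le r i)).conj (τ := Fin.revPerm) ht
      ((Equiv.sum_comp Fin.revPerm fun j => (c j).natAbs).trans ht)
      (evacuationIndex c) (revPerm_position ht _)
      fun p q => mem_promMatrix_normalized_evacuation hm p q hi
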